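/- Let $\alpha>0$, $n\ge 1$, and let $W_{11},\dots,W_{n1}$ be i.i.d. non-negative random variables whose tail is regularly varying with index $\alpha$, i.e. $\mathbb P(W_{11}>\lambda x)/\mathbb P(W_{11}>x)\to\lambda^{-\alpha}$ as $x\to\infty$ for every $\lambda>0$. Put $W_{i2}=W_{i1}$, $\mathbf W_i=(W_{i1},W_{i2})$, $\mathbf W_{[n]}=(\mathbf W_1,\dots,\mathbf W_n)$, and consider two Norros–Reittu layers $l=1,2$ on $n$ nodes: given $\mathbf W_{[n]}$, the edge counts $A_{ijl}=A_{jil}$ ($1\le i\le j\le n$, $l=1,2$) are independent, $A_{ijl}\sim\mathrm{Poisson}(W_{il}W_{jl}/\sum_{k=1}^nW_{kl})$ (with $0/0=0$). Let $D_{1l}(n)=\sum_{j=1}^nA_{1jl}$. Let $\boldsymbol{\mathcal D}_1=(\mathcal D_{11},\mathcal D_{12})$ be a random vector whose entries, given $\mathbf W_1$, are independent Poisson variables with means $W_{11}$ and $W_{12}$. Let $b(t)$ and $b_0(t)$ be the $(1-1/t)$-quantiles of $W_{11}$ and of $\sqrt{W_{11}}$, let $\mathbb C_0=\{\mathbf x\in\mathbb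 R_+^2:x_1=x_2\}$, let $d_2$ be the Euclidean distance, and let $\phi$ be the standard normal density. For a closed cone $\mathbb C\subset\mathbb R_+^2$, say that the law of a random vector $\mathbf Z$ in $\mathbb R_+^2$ is in $\mathrm{MRV}(\beta,c,\nu,\mathbb R_+^2\setminus\mathbb C)$ if $\beta>0$, $c$ is a regularly varying function with index $1/\beta$, $\nu\neq0$ is a Borel measure on $\mathbb R_+^2\setminus\mathbb C$ that is finite on sets bounded away from $\mathbb C$, and $t\,\mathbb E f(\mathbf Z/c(t))\to\int f\,d\nu$ as $t\to\infty$ for every bounded continuous $f\ge0$ on $\mathbb R_+^2\setminus\mathbb C$ (set to $0$ on $\mathbb C$) whose support is bounded away from $\mathbb C$. The law of $\mathbf Z$ has hidden regular variation on $\mathbb R_+^2\setminus\mathbb C_0$ if it is in $\mathrm{MRV}(\beta,c,\nu,\mathbb R_+^2\setminus\{\mathbf 0\})\cap\mathrm{MRV}(\beta_0,c_0,\nu_0,\mathbb R_+^2\setminus\mathbb C_0)$ for some $0<\beta\le\beta_0$, $c$, $c_0$, $\nu$, $\nu_0$ with $c(t)/c_0(t)\to\infty$. Then: 1. Given $\mathbf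 W_{[n]}$, the entries of $(D_{11}(n),D_{12}(n))$ are independent Poisson variables with means $W_{11}$ and $W_{12}$. 2. The law of $\mathbf W_1$ is in $\mathrm{MRV}(\alpha,b,\nu,\mathbb R_+^2\setminus\{\mathbf 0\})$ for some $\nu$ that is concentrated on $\mathbb C_0$. 3. For all real $u,v\ge0$ (with $1/0=\infty$ and $0^{-2\alpha}=\infty$), as $t\to\infty$, $$t\,\mathbb P\left(\frac{|\mathcal D_{11}-\mathcal D_{12}|}{\sqrt2\,b_0(t)}>u,\ \frac{\sqrt2\,\mathcal D_{11}/\sqrt{W_{11}}}{|\mathcal D_{11}-\mathcal D_{12}|}>v\right)\to u^{-2\alpha}\cdot2\int_0^{1/v}z^{2\alpha}\phi(z)\,dz,$$ and, in rescaled form, $$t\,\mathbb P\left(\frac{|\mathcal D_{11}-\mathcal D_{12}|}{b_0(t)}\left(\frac{\sqrt\pi}{\Gamma(\alpha+\frac12)}\right)^{\frac1{2\alpha}}>u,\ \frac{\sqrt2\,\mathcal D_{11}/\sqrt{W_{11}}}{|\mathcal D_{11}-\mathcal D_{12}|}>v\right)\to u^{-2\alpha}\cdot\frac{2^{1+\alpha}\sqrt\pi}{\Gamma(\alpha+\frac12)}\int_0^{1/v}z^{2\alpha}\phi(z)\,dz.$$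 4. The distance $d_2(\boldsymbol{\mathcal D}_1,\mathbb C_0)$ has a regularly varying tail with index $2\alpha$. 5. The law of $\boldsymbol{\mathcal D}_1$ is not in $\mathrm{MRV}(\alpha_0,c,\nu_0,\mathbb R_+^2\setminus\mathbb C_0)$ for any $\alpha_0>0$, any scaling function $c$ and any $\nu_0$; in particular it does not have hidden regular variation on $\mathbb R_+^2\setminus\mathbb C_0$. -/

import Mathlib

open MeasureTheory ProbabilityTheory Filter Topology Set
open scoped ENNReal NNReal

noncomputable section

namespace DegreeTails

/-! ### Regular variation on the line -/

/-- `f ∈ RV_ρ`: `f` is, near infinity, a positive measurable function, and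
`f (l x) / f x → l ^ ρ` as `x → ∞`, for every `l > 0`. -/
def IsRegularlyVarying (f : ℝ → ℝ) (ρ : ℝ) : Prop :=
  (∀ᶠ x in atTop, 0 < f x) ∧
  (∃ a : ℝ, Measurable ((Ioi a).domRestrict f)) ∧
  ∀ l : ℝ, 0 < l → Tendsto (fun x => f (l * x) / f x) atTop (𝓝 (l ^ ρ))

/-- A real random variable is regularly varying with tail index `α`:
its tail function `x ↦ ℙ(X > x)` is in `RV_{-α}`. -/
def HasRegularlyVaryingTail {Ω : Type*} [MeasurableSpace Ω] (P : Measure Ω)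
    (X : Ω → ℝ) (α : ℝ) : Prop :=
  IsRegularlyVarying (fun x => P.real {ω | x < X ω}) (-α)

/-- The `p`-quantile `inf {x | p ≤ ℙ(X ≤ x)}`. -/
def quantile {Ω : Type*} [MeasurableSpace Ω] (P : Measure Ω) (X : Ω → ℝ) (p : ℝ) : ℝ :=
  sInf {x : ℝ | p ≤ P.real {ω | X ω ≤ x}}

/-! ### Multivariate and hidden regular variation on `ℝ₊^L`, with the Euclidean metric -/

/-- The closed orthant `ℝ₊^L`. -/
def orthant (L : ℕ) : Set (EuclideanSpace ℝ (Fin L)) := {x | ∀ l, 0 ≤ x l}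

/-- The diagonal ray `{x ∈ ℝ₊² | x₁ = x₂}`. -/
def diagonal : Set (EuclideanSpace ℝ (Fin 2)) := {x | x ∈ orthant 2 ∧ x 0 = x 1}

/-- The class `𝕄(ℝ₊^L \ C)`: Borel measures on `ℝ₊^L \ C` (regarded as measures on `ℝ^L` that do not
charge the complement) which are finite on sets bounded away from `C`. -/
def IsMMeasure {L : ℕ} (C : Set (EuclideanSpace ℝ (Fin L)))
    (ν : Measure (EuclideanSpace ℝ (Fin L))) : Prop :=
  ν (orthant L \ C)ᶜ = 0 ∧
  ∀ ε : ℝ, 0 < ε → ν {x | x ∈ orthant L \ C ∧ ε ≤ Metric.infDist x C} < ∞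

/-- Test functions of `𝕄`-convergence: continuous, bounded, non-negative functions on `ℝ₊^L \ C`
whose support is bounded away from `C`. Values off `ℝ₊^L \ C` are irrelevant. -/
def IsMTest {L : ℕ} (C : Set (EuclideanSpace ℝ (Fin L)))
    (f : EuclideanSpace ℝ (Fin L) → ℝ) : Prop :=
  ContinuousOn f (orthant L \ C) ∧
  (∀ x ∈ orthant L \ C, 0 ≤ f x) ∧
  (∃ K : ℝ, ∀ x ∈ orthant L \ C, f x ≤ K) ∧
  ∃ ε : ℝ, 0 < ε ∧ ∀ x ∈ orthant L \ C, Metric.infDist x C < ε → f x = 0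

/-- `μ t → ν` in `𝕄(ℝ₊^L \ C)` as `t → ∞`. -/
def MConverges {L : ℕ} (C : Set (EuclideanSpace ℝ (Fin L)))
    (μ : ℝ → Measure (EuclideanSpace ℝ (Fin L)))
    (ν : Measure (EuclideanSpace ℝ (Fin L))) : Prop :=
  ∀ f : EuclideanSpace ℝ (Fin L) → ℝ, IsMTest C f →
    Tendsto (fun t => ∫⁻ x in orthant L \ C, ENNReal.ofReal (f x) ∂(μ t)) atTop
      (𝓝 (∫⁻ x in orthant L \ C, ENNReal.ofReal (f x) ∂ν))

/-- `μ ∈ MRV(α, b, ν, ℝ₊^L \ C)` for the law `μ` of a random vector `Z`: `b ∈ RV_{1/α}` and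
`t ℙ(Z / b(t) ∈ ·) → ν` in `𝕄(ℝ₊^L \ C)`, the limit measure `ν` being non-zero. -/
def IsMRV {L : ℕ} (μ : Measure (EuclideanSpace ℝ (Fin L))) (α : ℝ) (b : ℝ → ℝ)
    (ν : Measure (EuclideanSpace ℝ (Fin L))) (C : Set (EuclideanSpace ℝ (Fin L))) : Prop :=
  0 < α ∧ IsRegularlyVarying b (1 / α) ∧ IsMMeasure C ν ∧ ν ≠ 0 ∧
  MConverges C (fun t => ENNReal.ofReal t • μ.map (fun x => (b t)⁻¹ • x)) ν

/-- The law `μ` has hidden regular variation on `ℝ₊^L \ C₀`. -/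
def HasHRV {L : ℕ} (μ : Measure (EuclideanSpace ℝ (Fin L)))
    (C₀ : Set (EuclideanSpace ℝ (Fin L))) : Prop :=
  ∃ (α α₀ : ℝ) (b b₀ : ℝ → ℝ) (ν ν₀ : Measure (EuclideanSpace ℝ (Fin L))),
    α ≤ α₀ ∧ Tendsto (fun t => b t / b₀ t) atTop atTop ∧
    IsMRV μ α b ν {0} ∧ IsMRV μ α₀ b₀ ν₀ C₀

/-! ### The multilayer Norros–Reittu model and its limiting degrees -/

/-- Given `X`, the entries of the integer vector `D` are independent Poisson variables with means
`rate X l`: for all events `{X ∈ B}` and all `m`,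
`ℙ(X ∈ B, D = m) = 𝔼[1_{X ∈ B} ∏ l, Poisson(rate X l){m l}]`. -/
def IsMixedPoisson {Ω S : Type*} [MeasurableSpace Ω] [MeasurableSpace S] {L : ℕ}
    (P : Measure Ω) (X : Ω → S) (rate : S → Fin L → ℝ) (D : Ω → Fin L → ℕ) : Prop :=
  Measurable D ∧
  ∀ (B : Set S), MeasurableSet B → ∀ m : Fin L → ℕ,
    P {ω | X ω ∈ B ∧ D ω = m} =
      ∫⁻ ω in {ω | X ω ∈ B}, ∏ l, poissonMeasure (Real.toNNReal (rate (X ω) l)) {m l} ∂P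

/-- `L` Norros–Reittu layers on `n` nodes: the weight vectors `W i` are i.i.d. in `ℝ₊^L`, every layer
of the adjacency cube `A` is symmetric, and given all the weights the `A i j l` with `i ≤ j` are
independent Poisson variables with means `W i l * W j l / T l`, where `T l = ∑ k, W k l`. -/
structure IsNorrosReittu {Ω : Type*} [MeasurableSpace Ω] {n L : ℕ} (P : Measure Ω)
    (W : Fin n → Ω → Fin L → ℝ) (A : Ω → Fin n → Fin n → Fin L → ℕ) : Prop where
  measurable_weight : ∀ i, Measurable (W i)
  measurable_adj : Measurable A
  nonneg : ∀ i ω l, 0 ≤ W i ω l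
  indep : iIndepFun W P
  ident : ∀ i j, IdentDistrib (W i) (W j) P P
  symm : ∀ ω i j l, A ω i j l = A ω j i l
  cond : ∀ (B : Set (Fin n → Fin L → ℝ)), MeasurableSet B →
    ∀ a : Fin n → Fin n → Fin L → ℕ,
      P {ω | (fun i => W i ω) ∈ B ∧ ∀ l i j, i ≤ j → A ω i j l = a i j l} =
        ∫⁻ ω in {ω | (fun i => W i ω) ∈ B},
          ∏ l, ∏ i, ∏ j ∈ Finset.Ici i,
            poissonMeasure (Real.toNNReal (W i ω l * W j ω l / ∑ k, W k ω l)) {a i j l} ∂P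

/-- The degree of node `i` in layer `l`. -/
def degree {Ω : Type*} {n L : ℕ} (A : Ω → Fin n → Fin n → Fin L → ℕ) (i : Fin n) (ω : Ω)
    (l : Fin L) : ℕ := ∑ j, A ω i j l

/-- A real vector as a point of Euclidean space. -/
def vec {L : ℕ} (x : Fin L → ℝ) : EuclideanSpace ℝ (Fin L) := WithLp.toLp 2 x

/-- An integer vector as a point of Euclidean space. -/
def natVec {L : ℕ} (m : Fin L → ℕ) : EuclideanSpace ℝ (Fin L) := vec (fun l => (m l : ℝ))

/-- `∫_0^{1/v} z^{2α} φ(z) dz`, where `φ` is the standard normal density and `1/0 = ∞`. -/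
def gaussianMoment (α v : ℝ) : ℝ≥0∞ :=
  ∫⁻ z in (if v = 0 then Ioi (0 : ℝ) else Ioc (0 : ℝ) (1 / v)),
    ENNReal.ofReal (z ^ (2 * α) * gaussianPDFReal 0 1 z)

end DegreeTails

end

/-! Given a large weight `w`, the two degrees are independent Poisson variables with mean `w`, so
their difference divided by `√(2w)` is nearly a standard normal `N` and the first degree divided by
`w` is nearly `1`. Hence the distance from the diagonal behaves like `√W |N|`, and the second
coordinate of the joint tail like `1 / |N|`. For a genuine normal factor independent of `W`,
Breiman's argument gives `P(√W |N| > x, v |N| < 1) / P(W > x²) → E[|N|^{2α}; v |N| < 1]`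
(`HasRegularlyVaryingTail.tendsto_lintegral_normalTail`); by symmetry the limit is twice the
truncated Gaussian moment. Taking `x` to be `u` times the quantile of `√W` produces the factor
`u^{-2α}`.

Replacing Poisson by normal needs uniformity in the mean
(`exists_degreeTail_normalTail_comparison`). For means above `δx²` the central limit theorem and a
compactness argument give a uniform error. For smaller means, Chernoff bounds on the Poisson side
and moments on the Gaussian side bound both tails by a high power of `max w 1 / x²`. Potter's bound
for the tail of `W` makes the integral of that power a multiple of `δ P(W > x²)`, and `δ` is
arbitrary (`HasRegularlyVaryingTail.tendsto_lintegral_degreeTail`). The tail of the distance follows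
from the same limit with the second condition made void.

Regular variation off the diagonal fails because a pair at distance `x` from the diagonal typically
has size of order `x²`. A limit measure finite away from the diagonal forces the scaling `c(t)` to
grow at least polynomially, since the distance has a polynomially bounded below tail. A non-zero
limit charges a bounded set away from the diagonal; but distance and size are both of order `x` with
probability at most `2 exp(-a x)`, whatever the mean, so `c(t)` grows at most logarithmically. These
are incompatible (`IsMixedPoisson.not_isMRV_diagonal`).

The two remaining claims are of a different nature. The conditional law of the finite-`n` degrees is
additivity of independent Poisson variables, the total weight cancelling from the summed rates
(`isMixedPoisson_degree`). Regular variation of the weights follows by writing `t` times the law of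
`W` as the image of Lebesgue measure on `(0, t)` under the quantile function and using dominated
convergence (`map_volume_quantile`, `isMRV_diagPoint`). -/

namespace DegreeTails

/-! ### Regularly varying antitone functions -/

section RegularVariation

variable {F : ℝ → ℝ} {α : ℝ}

/-- Iterating a doubling inequality. -/
lemma le_pow_mul_of_doubling {p : ℕ} {x₀ : ℝ} (hx₀ : 0 ≤ x₀)
    (h : ∀ x, x₀ ≤ x → F x ≤ 2 ^ p * F (2 * x)) (n : ℕ) (x : ℝ) (hx : x₀ ≤ x) :
    F x ≤ (2 ^ n) ^ p * F (2 ^ n * x) := by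
  induction n with
  | zero => simp
  | succ n ih =>
    have h1 : x₀ ≤ 2 ^ n * x := by
      have : (1 : ℝ) ≤ 2 ^ n := one_le_pow₀ (by norm_num)
      nlinarith
    calc F x ≤ (2 ^ n) ^ p * F (2 ^ n * x) := ih
      _ ≤ (2 ^ n) ^ p * (2 ^ p * F (2 * (2 ^ n * x))) := by gcongr; exact h _ h1
      _ = (2 ^ (n + 1)) ^ p * F (2 ^ (n + 1) * x) := by
        rw [pow_succ (2 : ℝ) n, mul_pow]
        ring_nf

/-- A Potter bound for positive antitone functions of regular variation. -/
lemma exists_potter_bound (hF : Antitone F) (hpos : ∀ x, 0 < F x)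
    (hlim : ∀ l : ℝ, 0 < l → Tendsto (fun x => F (l * x) / F x) atTop (𝓝 (l ^ (-α))))
    {p : ℕ} (hp : α < p) :
    ∃ C : ℝ, 0 < C ∧ ∀ z y, 1 ≤ z → z ≤ y → F z ≤ C * (y / z) ^ p * F y := by
  have h2 : (2 : ℝ) ^ (-(p : ℝ)) < 2 ^ (-α) :=
    Real.rpow_lt_rpow_of_exponent_lt (by norm_num) (by linarith)
  obtain ⟨x₁, hx₁⟩ := eventually_atTop.1 ((hlim 2 (by norm_num)).eventually (lt_mem_nhds h2))
  set x₀ := max x₁ 1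
  have hx₀ : 1 ≤ x₀ := le_max_right _ _
  have hdb : ∀ x, x₀ ≤ x → F x ≤ 2 ^ p * F (2 * x) := by
    intro x hx
    have h := hx₁ x ((le_max_left _ _).trans hx)
    rw [lt_div_iff₀ (hpos x), Real.rpow_neg (by norm_num), Real.rpow_natCast, ← div_eq_inv_mul,
      div_lt_iff₀ (by positivity)] at h
    linarith
  have hbig : ∀ z y, x₀ ≤ z → z ≤ y → F z ≤ 2 ^ p * (y / z) ^ p * F y := by
    intro z y hz hzy
    have hz0 : 0 < z := by linarith
    have hy0 : 0 < y := by linarith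
    -- The dyadic bracket is `2^n ≤ y / z < 2^(n+1)`. Doubling `n + 1` times overshoots `y` by at
    -- most a factor `2`, which costs the constant `2 ^ p`.
    obtain ⟨n, hn, hn'⟩ := exists_nat_pow_near ((one_le_div hz0).2 hzy) (one_lt_two (α := ℝ))
    have h1 := le_pow_mul_of_doubling (by linarith) hdb (n + 1) z hz
    rw [le_div_iff₀ hz0] at hn
    rw [div_lt_iff₀ hz0] at hn'
    calc F z ≤ (2 ^ (n + 1)) ^ p * F (2 ^ (n + 1) * z) := h1
      _ ≤ (2 * (y / z)) ^ p * F y := by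
        have : (2 : ℝ) ^ (n + 1) ≤ 2 * (y / z) := by
          rw [pow_succ, mul_comm]
          gcongr
          rwa [le_div_iff₀ hz0]
        exact mul_le_mul (by gcongr) (hF hn'.le) (hpos _).le (by positivity)
      _ = _ := by rw [mul_pow]
  -- The ratio `F 1 / F x₀` pays for the range `[1, x₀]`, where the doubling inequality is not
  -- available and only monotonicity is used.
  have hr : 1 ≤ F 1 / F x₀ := (one_le_div (hpos _)).2 (hF hx₀)
  have hr0 : 0 < F 1 / F x₀ := by linarith
  refine ⟨F 1 / F x₀ * 2 ^ p, by positivity, fun z y hz hzy => ?_⟩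
  have hz0 : 0 < z := by linarith
  have hy0 : 0 < y := by linarith
  have hFy := hpos y
  have hF0 := hpos x₀
  rcases le_total x₀ z with h | h
  · calc F z ≤ 1 * (2 ^ p * (y / z) ^ p * F y) := by rw [one_mul]; exact hbig z y h hzy
      _ ≤ F 1 / F x₀ * (2 ^ p * (y / z) ^ p * F y) := by gcongr
      _ = _ := by ring
  · have hz1 : F z ≤ F 1 / F x₀ * F x₀ := by
      rw [div_mul_cancel₀ _ (hpos _).ne']; exact hF hz
    refine hz1.trans ?_
    rw [mul_assoc, mul_assoc]
    gcongr
    rcases le_total x₀ y with h' | h'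
    · calc F x₀ ≤ 2 ^ p * (y / x₀) ^ p * F y := hbig x₀ y le_rfl h'
        _ ≤ 2 ^ p * (y / z) ^ p * F y := by gcongr
        _ = _ := by ring
    · calc F x₀ ≤ 1 * (1 * F y) := by rw [one_mul, one_mul]; exact hF h'
        _ ≤ _ := by
          gcongr
          · exact one_le_pow₀ (by norm_num)
          · exact one_le_pow₀ ((one_le_div hz0).2 hzy)

/-- Polynomial lower bound for the tail. -/
lemma exists_polynomial_lower_bound (hF : Antitone F) (hpos : ∀ x, 0 < F x)
    (hlim : ∀ l : ℝ, 0 < l → Tendsto (fun x => F (l * x) / F x) atTop (𝓝 (l ^ (-α)))) :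
    ∃ (p : ℕ) (c : ℝ), 0 < c ∧ ∀ y, 1 ≤ y → c ≤ y ^ p * F y := by
  obtain ⟨p, hp⟩ := exists_nat_gt α
  obtain ⟨C, hC, h⟩ := exists_potter_bound hF hpos hlim hp
  refine ⟨p, F 1 / C, div_pos (hpos 1) hC, fun y hy => ?_⟩
  have := h 1 y le_rfl hy
  rw [div_one] at this
  rw [div_le_iff₀ hC]
  linarith

end RegularVariation

/-! ### Tails and quantiles of a non-negative random variable -/

section Tail

variable {Ω : Type*} [MeasurableSpace Ω] {P : Measure Ω} {X : Ω → ℝ} {α : ℝ}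

lemma tail_antitone [IsFiniteMeasure P] (X : Ω → ℝ) :
    Antitone fun x => P.real {ω | x < X ω} :=
  fun _ _ h => measureReal_mono fun _ hω => lt_of_le_of_lt h hω

lemma HasRegularlyVaryingTail.tail_pos [IsFiniteMeasure P]
    (h : HasRegularlyVaryingTail P X α) (x : ℝ) : 0 < P.real {ω | x < X ω} := by
  obtain ⟨y, hy, hxy⟩ := (h.1.and (eventually_ge_atTop x)).exists
  exact hy.trans_le (tail_antitone X hxy)

lemma HasRegularlyVaryingTail.tail_potter [IsFiniteMeasure P]
    (h : HasRegularlyVaryingTail P X α) {p : ℕ} (hp : α < p) :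
    ∃ C : ℝ, 0 < C ∧ ∀ z y, 1 ≤ z → z ≤ y →
      P.real {ω | z < X ω} ≤ C * (y / z) ^ p * P.real {ω | y < X ω} :=
  exists_potter_bound (tail_antitone X) h.tail_pos h.2.2 hp

lemma measurable_domRestrict_of_antitoneOn {f : ℝ → ℝ} {a : ℝ} (hf : AntitoneOn f (Ioi a)) :
    Measurable ((Ioi a).domRestrict f) :=
  Antitone.measurable fun x y hxy => hf x.2 y.2 hxy

/-- An eventually equivalent form of regular variation of a tail. -/
lemma hasRegularlyVaryingTail_of_tendsto [IsFiniteMeasure P] {Y : Ω → ℝ} {G : ℝ → ℝ} {c : ℝ}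
    (hc : 0 < c) (hG : ∀ᶠ x in atTop, 0 < G x)
    (hGlim : ∀ l : ℝ, 0 < l → Tendsto (fun x => G (l * x) / G x) atTop (𝓝 (l ^ (-α))))
    (h : Tendsto (fun x => P.real {ω | x < Y ω} / G x) atTop (𝓝 c)) :
    HasRegularlyVaryingTail P Y α := by
  have hpos : ∀ᶠ x in atTop, 0 < P.real {ω | x < Y ω} := by
    filter_upwards [hG, h.eventually (lt_mem_nhds hc)] with x h1 h2
    have := mul_pos h2 h1
    rwa [div_mul_cancel₀ _ h1.ne'] at this
  refine ⟨hpos, ⟨0, measurable_domRestrict_of_antitoneOn ((tail_antitone Y).antitoneOn _)⟩,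
    fun l hl => ?_⟩
  have hmul : Tendsto (fun x : ℝ => l * x) atTop atTop := tendsto_id.const_mul_atTop hl
  have h1 := ((h.comp hmul).mul (hGlim l hl)).div h hc.ne'
  rw [mul_div_cancel_left₀ _ hc.ne'] at h1
  refine h1.congr' ?_
  filter_upwards [hG, hmul.eventually hG, hpos] with x h2 h3 h4
  simp only [Function.comp_apply, Pi.div_apply]
  field_simp

lemma HasRegularlyVaryingTail.sqrt [IsFiniteMeasure P] (h : HasRegularlyVaryingTail P X α) :
    HasRegularlyVaryingTail P (fun ω => √(X ω)) (2 * α) := by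
  have hsq : Tendsto (fun x : ℝ => x ^ 2) atTop atTop := tendsto_pow_atTop two_ne_zero
  refine hasRegularlyVaryingTail_of_tendsto (G := fun x => P.real {ω | x ^ 2 < X ω}) one_pos
    (hsq.eventually h.1) (fun l hl => ?_) ?_
  · have := (h.2.2 (l ^ 2) (by positivity)).comp hsq
    convert this using 2
    · simp [mul_pow]
    · rw [← Real.rpow_natCast, ← Real.rpow_mul hl.le]
      norm_num
  · refine tendsto_const_nhds.congr' ?_
    filter_upwards [eventually_ge_atTop 0] with x hx
    have : {ω | x < √(X ω)} = {ω | x ^ 2 < X ω} := by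
      ext ω
      exact Real.lt_sqrt hx
    rw [this, div_self (h.tail_pos _).ne']

variable [IsProbabilityMeasure P]

lemma tail_eq_one_sub (hX : Measurable X) (x : ℝ) :
    P.real {ω | x < X ω} = 1 - P.real {ω | X ω ≤ x} := by
  rw [← probReal_compl_eq_one_sub (measurableSet_le hX measurable_const)]
  congr 1
  ext ω
  simp

/-- Right continuity of the distribution function; it ensures that the infimum defining the quantile
is attained. -/
lemma tendsto_tail_nhdsGT (hX : Measurable X) (x : ℝ) :
    Tendsto (fun y => P.real {ω | y < X ω}) (𝓝[>] x) (𝓝 (P.real {ω | x < X ω})) := by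
  have h := ((cdf (P.map X)).right_continuous x).mono Ioi_subset_Ici_self
  have : IsProbabilityMeasure (P.map X) := Measure.isProbabilityMeasure_map hX.aemeasurable
  have key : ∀ y, P.real {ω | y < X ω} = 1 - cdf (P.map X) y := by
    intro y
    rw [tail_eq_one_sub hX, cdf_eq_real, map_measureReal_apply hX measurableSet_Iic]
    rfl
  simp_rw [key]
  exact tendsto_const_nhds.sub h

lemma tendsto_tail_atTop (hX : Measurable X) :
    Tendsto (fun y => P.real {ω | y < X ω}) atTop (𝓝 0) := by
  have : IsProbabilityMeasure (P.map X) := Measure.isProbabilityMeasure_map hX.aemeasurable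
  have key : ∀ y, P.real {ω | y < X ω} = 1 - cdf (P.map X) y := by
    intro y
    rw [tail_eq_one_sub hX, cdf_eq_real, map_measureReal_apply hX measurableSet_Iic]
    rfl
  simp_rw [key]
  simpa using (tendsto_cdf_atTop (P.map X)).const_sub 1

/-- The Galois connection between quantile and tail. -/
lemma quantile_le_iff (hX : Measurable X) (h0 : ∀ ω, 0 ≤ X ω) {t : ℝ} (ht : 1 < t) (x : ℝ) :
    quantile P X (1 - 1 / t) ≤ x ↔ P.real {ω | x < X ω} ≤ 1 / t := by
  have ht0 : 0 < 1 / t := by positivity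
  have hset : {x : ℝ | 1 - 1 / t ≤ P.real {ω | X ω ≤ x}} =
      {x : ℝ | P.real {ω | x < X ω} ≤ 1 / t} := by
    ext x
    simp only [mem_ofPred_eq, tail_eq_one_sub hX]
    constructor <;> intro h <;> linarith
  rw [quantile, hset]
  have hbdd : BddBelow {x : ℝ | P.real {ω | x < X ω} ≤ 1 / t} := by
    refine ⟨0, fun y hy => ?_⟩
    by_contra! hlt
    have : {ω | y < X ω} = univ := eq_univ_of_forall fun ω => hlt.trans_le (h0 ω)
    rw [mem_ofPred_eq, this, probReal_univ, le_div_iff₀ (by linarith)] at hy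
    linarith
  have hne : {x : ℝ | P.real {ω | x < X ω} ≤ 1 / t}.Nonempty :=
    (((tendsto_tail_atTop hX).eventually (ge_mem_nhds ht0)).exists)
  refine ⟨fun h => ?_, fun h => csInf_le hbdd h⟩
  -- Every `y > x` lies above a member of the set whose infimum is the quantile, so its tail is at
  -- most `1 / t`; right continuity passes this on to `x`.
  refine le_of_tendsto (tendsto_tail_nhdsGT hX x) ?_
  filter_upwards [self_mem_nhdsWithin] with y hy
  obtain ⟨z, hz, hzy⟩ := exists_lt_of_csInf_lt hne (lt_of_le_of_lt h hy)
  exact (tail_antitone X hzy.le).trans hz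

lemma lt_quantile_iff (hX : Measurable X) (h0 : ∀ ω, 0 ≤ X ω) {t : ℝ} (ht : 1 < t) (x : ℝ) :
    x < quantile P X (1 - 1 / t) ↔ 1 / t < P.real {ω | x < X ω} := by
  rw [← not_le, quantile_le_iff hX h0 ht, not_le]

lemma quantile_monotoneOn (hX : Measurable X) (h0 : ∀ ω, 0 ≤ X ω) :
    MonotoneOn (fun t => quantile P X (1 - 1 / t)) (Ioi 1) := by
  intro s hs t ht hst
  have hs' : (0 : ℝ) < s := one_pos.trans hs
  simp only
  rw [quantile_le_iff hX h0 hs]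
  exact ((quantile_le_iff hX h0 ht _).1 le_rfl).trans (one_div_le_one_div_of_le hs' hst)

lemma HasRegularlyVaryingTail.tendsto_quantile (h : HasRegularlyVaryingTail P X α)
    (hX : Measurable X) (h0 : ∀ ω, 0 ≤ X ω) :
    Tendsto (fun t => quantile P X (1 - 1 / t)) atTop atTop := by
  refine tendsto_atTop.2 fun M => ?_
  filter_upwards [eventually_gt_atTop 1, eventually_gt_atTop (1 / P.real {ω | M < X ω})]
    with t h1 h2
  refine ((lt_quantile_iff hX h0 h1 M).2 ?_).le
  rw [div_lt_iff₀ (h.tail_pos M)] at h2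
  rw [div_lt_iff₀ (by linarith)]
  linarith

/-- The tail may jump at the quantile `b t`, so only `t P(X > b t) ≤ 1` is exact. From below, `b t /
l` with `l > 1` lies strictly under the quantile and has tail above `1 / t`; regular variation
compares the two tails up to `l ^ (-α)`, and `l` is taken close to `1`. -/
lemma HasRegularlyVaryingTail.tendsto_mul_tail_quantile (h : HasRegularlyVaryingTail P X α)
    (hX : Measurable X) (h0 : ∀ ω, 0 ≤ X ω) :
    Tendsto (fun t => t * P.real {ω | quantile P X (1 - 1 / t) < X ω}) atTop (𝓝 1) := by
  set b := fun t : ℝ => quantile P X (1 - 1 / t)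
  have hb := h.tendsto_quantile hX h0
  refine tendsto_order.2 ⟨fun a ha => ?_, fun a ha => ?_⟩
  · have hcont : Tendsto (fun l : ℝ => l ^ (-α)) (𝓝[>] 1) (𝓝 1) := by
      have : ContinuousAt (fun l : ℝ => l ^ (-α)) 1 :=
        Real.continuousAt_rpow_const 1 (-α) (Or.inl one_ne_zero)
      have h2 := this.tendsto.mono_left (nhdsWithin_le_nhds (s := Ioi 1))
      simpa using h2
    obtain ⟨l, hl, hl1⟩ := ((hcont.eventually (lt_mem_nhds ha)).and self_mem_nhdsWithin).exists
    have hl1' : 1 < l := hl1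
    have hl0 : 0 < l := by linarith
    have hlim := (h.2.2 l hl0).comp (hb.atTop_div_const hl0)
    filter_upwards [hlim.eventually (lt_mem_nhds hl), eventually_gt_atTop 1,
      hb.eventually_gt_atTop 0] with t h1 h2 h3
    simp only [Function.comp_apply] at h1
    rw [mul_div_cancel₀ _ hl0.ne'] at h1
    have h4 : b t / l < b t := div_lt_self h3 hl1'
    have h5 := (lt_quantile_iff hX h0 h2 _).1 h4
    have h6 := h.tail_pos (b t / l)
    refine h1.trans_le ?_
    rw [div_le_iff₀ h6]
    rw [div_lt_iff₀ (by linarith)] at h5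
    calc P.real {ω | b t < X ω} = P.real {ω | b t < X ω} * 1 := (mul_one _).symm
      _ ≤ P.real {ω | b t < X ω} * (P.real {ω | b t / l < X ω} * t) := by gcongr
      _ = _ := by ring
  · filter_upwards [eventually_gt_atTop 1] with t ht
    refine lt_of_le_of_lt ?_ ha
    have := (quantile_le_iff hX h0 ht _).1 (le_refl (quantile P X (1 - 1 / t)))
    rw [le_div_iff₀ (by linarith)] at this
    linarith

lemma HasRegularlyVaryingTail.tendsto_mul_tail_mul_quantile (h : HasRegularlyVaryingTail P X α)
    (hX : Measurable X) (h0 : ∀ ω, 0 ≤ X ω) {u : ℝ} (hu : 0 < u) :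
    Tendsto (fun t => t * P.real {ω | u * quantile P X (1 - 1 / t) < X ω}) atTop
      (𝓝 (u ^ (-α))) := by
  have h1 := (h.tendsto_mul_tail_quantile hX h0).mul
    ((h.2.2 u hu).comp (h.tendsto_quantile hX h0))
  rw [one_mul] at h1
  refine h1.congr fun t => ?_
  simp only [Function.comp_apply]
  rw [mul_assoc, mul_div_cancel₀ _ (h.tail_pos _).ne']

/-- By the Galois connection, comparing `a * b t` with `b (l * t)` amounts to comparing `t P(X > a *
b t)`, whose limit is `a ^ (-α)`, with `1 / l`. The two change order exactly at `a = l ^ (1 / α)`.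
-/
lemma HasRegularlyVaryingTail.tendsto_quantile_div (hα : 0 < α)
    (h : HasRegularlyVaryingTail P X α)
    (hX : Measurable X) (h0 : ∀ ω, 0 ≤ X ω) {l : ℝ} (hl : 0 < l) :
    Tendsto (fun t => quantile P X (1 - 1 / (l * t)) / quantile P X (1 - 1 / t)) atTop
      (𝓝 (l ^ (1 / α))) := by
  have hb := h.tendsto_quantile hX h0
  have hmul : Tendsto (fun x : ℝ => l * x) atTop atTop := tendsto_id.const_mul_atTop hl
  have hinv : ∀ a : ℝ, 0 < a → ((a < l ^ (1 / α) → 1 / l < a ^ (-α)) ∧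
      (l ^ (1 / α) < a → a ^ (-α) < 1 / l)) := by
    intro a ha
    have e : (l ^ (1 / α)) ^ (-α) = 1 / l := by
      rw [← Real.rpow_mul hl.le, mul_neg, one_div_mul_cancel hα.ne', Real.rpow_neg_one, one_div]
    rw [← e]
    exact ⟨fun hlt => Real.rpow_lt_rpow_of_neg ha hlt (by linarith),
      fun hlt => Real.rpow_lt_rpow_of_neg (by positivity) hlt (by linarith)⟩
  refine tendsto_order.2 ⟨fun a ha => ?_, fun a ha => ?_⟩
  · rcases le_or_gt a 0 with ha0 | ha0
    · filter_upwards [hb.eventually_gt_atTop 0, (hb.comp hmul).eventually_gt_atTop 0]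
        with t h1 h2
      exact ha0.trans_lt (div_pos h2 h1)
    · filter_upwards [hb.eventually_gt_atTop 0, eventually_gt_atTop 1,
        hmul.eventually_gt_atTop 1, (h.tendsto_mul_tail_mul_quantile hX h0 ha0).eventually
          (lt_mem_nhds ((hinv a ha0).1 ha))] with t h1 h2 h3 h4
      rw [lt_div_iff₀ h1, lt_quantile_iff hX h0 h3, one_div, mul_inv, ← one_div l,
        ← div_eq_mul_inv, div_lt_iff₀ (by linarith), mul_comm]
      exact h4
  · have ha0 : 0 < a := lt_trans (by positivity) ha
    obtain ⟨a', ha1, ha2⟩ := exists_between ha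
    have ha0' : 0 < a' := lt_trans (by positivity) ha1
    filter_upwards [hb.eventually_gt_atTop 0, eventually_gt_atTop 1,
        hmul.eventually_gt_atTop 1, (h.tendsto_mul_tail_mul_quantile hX h0 ha0').eventually
          (gt_mem_nhds ((hinv a' ha0').2 ha1))] with t h1 h2 h3 h4
    refine lt_of_le_of_lt ?_ ha2
    rw [div_le_iff₀ h1, quantile_le_iff hX h0 h3, one_div (l * t), mul_inv, ← one_div l,
        ← div_eq_mul_inv, le_div_iff₀ (by linarith), mul_comm]
    exact h4.le

lemma HasRegularlyVaryingTail.isRegularlyVarying_quantile (hα : 0 < α)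
    (h : HasRegularlyVaryingTail P X α) (hX : Measurable X) (h0 : ∀ ω, 0 ≤ X ω) :
    IsRegularlyVarying (fun t => quantile P X (1 - 1 / t)) (1 / α) := by
  refine ⟨(h.tendsto_quantile hX h0).eventually_gt_atTop 0, ⟨1, ?_⟩,
    fun l hl => h.tendsto_quantile_div hα hX h0 hl⟩
  exact Monotone.measurable fun x y hxy => quantile_monotoneOn hX h0 x.2 y.2 hxy

end Tail

/-! ### Regular variation of a random vector on the diagonal -/

section Diagonal

variable {Ω : Type*} [MeasurableSpace Ω] {P : Measure Ω} [IsProbabilityMeasure P]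
  {X : Ω → ℝ} {α : ℝ}

/-- The point `(r, r)` of the plane. -/
noncomputable def diagPoint (r : ℝ) : EuclideanSpace ℝ (Fin 2) := vec fun _ => r

lemma continuous_diagPoint : Continuous diagPoint :=
  (PiLp.continuous_toLp 2 _).comp (continuous_pi fun _ => continuous_id)

lemma smul_diagPoint (c r : ℝ) : c • diagPoint r = diagPoint (c * r) := by
  ext i
  simp [diagPoint, vec]

lemma norm_diagPoint {r : ℝ} (hr : 0 ≤ r) : ‖diagPoint r‖ = √2 * r := by
  rw [diagPoint, vec, EuclideanSpace.norm_eq]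
  simp only [Real.norm_eq_abs, sq_abs, Finset.sum_const, Finset.card_univ, Fintype.card_fin,
    nsmul_eq_mul, Nat.cast_ofNat]
  rw [Real.sqrt_mul (by norm_num), Real.sqrt_sq hr]

lemma measurableSet_orthant (L : ℕ) : MeasurableSet (orthant L) := by
  have : orthant L = ⋂ l, {x : EuclideanSpace ℝ (Fin L) | 0 ≤ x l} := by
    ext; simp [orthant]
  rw [this]
  exact MeasurableSet.iInter fun l => measurableSet_le measurable_const (by fun_prop)

lemma measurableSet_diagonal : MeasurableSet diagonal :=
  (measurableSet_orthant 2).inter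
    (measurableSet_eq_fun (f := fun x : EuclideanSpace ℝ (Fin 2) => x 0) (g := fun x => x 1)
      (by fun_prop) (by fun_prop))

lemma diagPoint_mem_diff {r : ℝ} (hr : 0 < r) : diagPoint r ∈ orthant 2 \ {0} := by
  refine ⟨fun _ => hr.le, fun h => ?_⟩
  have := congrArg (fun x : EuclideanSpace ℝ (Fin 2) => x 0) h
  simp [diagPoint, vec] at this
  exact hr.ne' this

/-- The quantile transform: the image of Lebesgue measure on `(0, t)` under the quantile function
is `t` times the law. -/
lemma map_volume_quantile (hX : Measurable X) (h0 : ∀ ω, 0 ≤ X ω) {t : ℝ} (ht : 0 < t) :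
    (volume.restrict (Ioo 0 t)).map (fun s => quantile P X (1 - 1 / (t / s))) =
      ENNReal.ofReal t • P.map X := by
  have hanti : AntitoneOn (fun s => quantile P X (1 - 1 / (t / s))) (Ioo 0 t) := by
    intro s hs s' hs' hss
    have h1 : 1 < t / s := (one_lt_div hs.1).2 hs.2
    have h2 : 1 < t / s' := (one_lt_div hs'.1).2 hs'.2
    exact quantile_monotoneOn hX h0 h2 h1 (div_le_div_of_nonneg_left ht.le hs.1 hss)
  have hm : AEMeasurable (fun s => quantile P X (1 - 1 / (t / s)))
      (volume.restrict (Ioo 0 t)) := aemeasurable_restrict_of_antitoneOn measurableSet_Ioo hanti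
  have : IsFiniteMeasure (volume.restrict (Ioo 0 t)) := ⟨by simp⟩
  have : IsFiniteMeasure (ENNReal.ofReal t • P.map X) :=
    ⟨by simp [ENNReal.mul_lt_top_iff, measure_lt_top]⟩
  refine Measure.ext_of_Iic _ _ fun x => ?_
  rw [Measure.map_apply_of_aemeasurable hm measurableSet_Iic, Measure.smul_apply,
    Measure.map_apply hX measurableSet_Iic, Measure.restrict_apply' measurableSet_Ioo]
  -- The quantile at `t / s` is at most `x` iff `s ≥ t P(X > x)`, so the preimage is, up to an
  -- endpoint, an interval of length `t P(X ≤ x)`.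
  have hset : (fun s => quantile P X (1 - 1 / (t / s))) ⁻¹' Iic x ∩ Ioo 0 t =
      Ico (t * P.real {ω | x < X ω}) t ∩ Ioi 0 := by
    ext s
    simp only [mem_inter_iff, mem_preimage, mem_Iic, mem_Ioo, mem_Ico, mem_Ioi]
    constructor
    · rintro ⟨h, h1, h2⟩
      rw [quantile_le_iff hX h0 ((one_lt_div h1).2 h2), one_div_div, le_div_iff₀ ht] at h
      exact ⟨⟨by linarith, h2⟩, h1⟩
    · rintro ⟨⟨h, h2⟩, h1⟩
      rw [quantile_le_iff hX h0 ((one_lt_div h1).2 h2), one_div_div, le_div_iff₀ ht]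
      exact ⟨by linarith, h1, h2⟩
  have hnn : 0 ≤ t * P.real {ω | x < X ω} := by positivity
  have hae : (Ico (t * P.real {ω | x < X ω}) t ∩ Ioi 0 : Set ℝ) =ᵐ[volume]
      Ioo (t * P.real {ω | x < X ω}) t := by
    have h1 : (Ico (t * P.real {ω | x < X ω}) t ∩ Ioi 0 : Set ℝ) =ᵐ[volume]
        (Ioo (t * P.real {ω | x < X ω}) t ∩ Ioi 0 : Set ℝ) :=
      Ioo_ae_eq_Ico.symm.inter (ae_eq_refl _)
    refine h1.trans (Eq.eventuallyEq ?_)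
    exact inter_eq_left.2 fun s hs => hnn.trans_lt hs.1
  rw [hset, measure_congr hae, Real.volume_Ioo, tail_eq_one_sub hX, smul_eq_mul,
    show t - t * (1 - P.real {ω | X ω ≤ x}) = t * P.real {ω | X ω ≤ x} by ring,
    ENNReal.ofReal_mul ht.le, ofReal_measureReal]
  rfl

/-- The limit measure on the diagonal, `x ↦ α x^{-α-1} dx` carried to the ray `x₁ = x₂`. -/
noncomputable def diagMeasure (α : ℝ) : Measure (EuclideanSpace ℝ (Fin 2)) :=
  (volume.restrict (Ioi 0)).map fun s : ℝ => diagPoint (s ^ (-1 / α))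

lemma measurable_diagPoint_rpow (α : ℝ) :
    Measurable fun s : ℝ => diagPoint (s ^ (-1 / α)) :=
  continuous_diagPoint.measurable.comp (by fun_prop)

lemma diagMeasure_apply {s : Set (EuclideanSpace ℝ (Fin 2))} (hs : MeasurableSet s) :
    diagMeasure α s = volume ({r : ℝ | diagPoint (r ^ (-1 / α)) ∈ s} ∩ Ioi 0) := by
  rw [diagMeasure, Measure.map_apply (measurable_diagPoint_rpow α) hs,
    Measure.restrict_apply (measurable_diagPoint_rpow α hs)]
  rfl

lemma diagMeasure_compl_diagonal : diagMeasure α diagonalᶜ = 0 := by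
  rw [diagMeasure_apply measurableSet_diagonal.compl]
  convert measure_empty (μ := (volume : Measure ℝ))
  ext r
  simp only [mem_inter_iff, mem_ofPred_eq, mem_compl_iff, mem_Ioi, mem_empty_iff_false, iff_false,
    not_and]
  intro h hr
  exact h ⟨(diagPoint_mem_diff (Real.rpow_pos_of_pos hr _)).1, rfl⟩

lemma isMMeasure_diagMeasure (hα : 0 < α) : IsMMeasure {0} (diagMeasure α) := by
  have hmeas : MeasurableSet (orthant 2 \ {0}) :=
    (measurableSet_orthant 2).diff (measurableSet_singleton 0)
  refine ⟨?_, fun ε hε => ?_⟩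
  · rw [diagMeasure_apply hmeas.compl]
    convert measure_empty (μ := (volume : Measure ℝ))
    ext r
    simp only [mem_inter_iff, mem_ofPred_eq, mem_compl_iff, mem_Ioi, mem_empty_iff_false, iff_false,
      not_and]
    intro h hr
    exact h (diagPoint_mem_diff (Real.rpow_pos_of_pos hr _))
  · have hm : MeasurableSet {x : EuclideanSpace ℝ (Fin 2) | x ∈ orthant 2 \ {0} ∧
        ε ≤ Metric.infDist x {0}} :=
      hmeas.inter (measurableSet_le measurable_const
        (Metric.continuous_infDist_pt _).measurable)
    rw [diagMeasure_apply hm]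
    -- The curve `s ↦ diagPoint (s ^ (-1 / α))` approaches the origin as `s` grows, so staying at
    -- distance `ε` confines `s` to a bounded interval.
    refine lt_of_le_of_lt (measure_mono (t := Icc 0 ((ε / √2) ^ (-α))) ?_) (by simp)
    rintro r ⟨⟨-, hr⟩, hr0⟩
    have hr0' : 0 < r := hr0
    have hrp := Real.rpow_pos_of_pos hr0' (-1 / α)
    rw [Metric.infDist_singleton, dist_zero_right, norm_diagPoint hrp.le] at hr
    refine ⟨hr0'.le, ?_⟩
    have h1 : ε / √2 ≤ r ^ (-1 / α) := by rwa [div_le_iff₀' (by positivity)]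
    have h2 := Real.rpow_le_rpow_of_nonpos (by positivity) h1 (by linarith : -α ≤ 0)
    rwa [← Real.rpow_mul hr0'.le, show -1 / α * -α = 1 by field_simp, Real.rpow_one] at h2

lemma diagMeasure_ne_zero : diagMeasure α ≠ 0 := by
  intro h
  have := congrArg (fun μ => μ univ) h
  simp [diagMeasure, Measure.map_apply (measurable_diagPoint_rpow α) MeasurableSet.univ] at this

/-- A vector with two equal non-negative regularly varying entries is multivariate regularly
varying, and its limit measure lives on the diagonal. -/
theorem isMRV_diagPoint (hα : 0 < α) (h : HasRegularlyVaryingTail P X α) (hX : Measurable X)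
    (h0 : ∀ ω, 0 ≤ X ω) :
    IsMRV (P.map fun ω => diagPoint (X ω)) α (fun t => quantile P X (1 - 1 / t))
      (diagMeasure α) {0} := by
  refine ⟨hα, h.isRegularlyVarying_quantile hα hX h0, isMMeasure_diagMeasure hα,
    diagMeasure_ne_zero, fun f hf => ?_⟩
  obtain ⟨hfc, hf0, ⟨K, hK⟩, ε, hε, hfε⟩ := hf
  set b := fun t : ℝ => quantile P X (1 - 1 / t) with hbdef
  have hb : Tendsto b atTop atTop := h.tendsto_quantile hX h0
  have hO : MeasurableSet (orthant 2 \ {0}) :=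
    (measurableSet_orthant 2).diff (measurableSet_singleton 0)
  -- the test function, extended by zero
  set g : EuclideanSpace ℝ (Fin 2) → ℝ≥0∞ :=
    (orthant 2 \ {0}).indicator fun x => ENNReal.ofReal (f x) with hg
  have hgm : Measurable g := by
    classical
    rw [hg, ← piecewise_eq_indicator]
    exact (ENNReal.continuous_ofReal.comp_continuousOn hfc).measurable_piecewise
      continuousOn_const hO
  have hgpos : ∀ r : ℝ, 0 < r → g (diagPoint r) = ENNReal.ofReal (f (diagPoint r)) :=
    fun r hr => indicator_of_mem (diagPoint_mem_diff hr) _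
  have hgle : ∀ x, g x ≤ ENNReal.ofReal K := by
    intro x
    by_cases hx : x ∈ orthant 2 \ {0}
    · rw [hg, indicator_of_mem hx]
      exact ENNReal.ofReal_le_ofReal (hK x hx)
    · rw [hg, indicator_of_notMem hx]
      exact zero_le
  set ε' := ε / √2 with hε'
  have hε'0 : 0 < ε' := by positivity
  have hgzero : ∀ r : ℝ, 0 ≤ r → r < ε' → g (diagPoint r) = 0 := by
    intro r hr hrε
    by_cases hx : diagPoint r ∈ orthant 2 \ {0}
    · rw [hg, indicator_of_mem hx, hfε _ hx, ENNReal.ofReal_zero]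
      rw [Metric.infDist_singleton, dist_zero_right, norm_diagPoint hr]
      rwa [hε', lt_div_iff₀' (by positivity)] at hrε
    · rw [hg, indicator_of_notMem hx]
  have hgdm : Measurable fun r : ℝ => g (diagPoint r) :=
    hgm.comp continuous_diagPoint.measurable
  -- the quantile transform turns both sides into Lebesgue integrals
  have hlhs : ∀ t, 0 < t → ∫⁻ x in orthant 2 \ {0}, ENNReal.ofReal (f x)
      ∂(ENNReal.ofReal t • (P.map fun ω => diagPoint (X ω)).map fun x => (b t)⁻¹ • x) =
      ∫⁻ s in Ioo 0 t, g (diagPoint ((b t)⁻¹ * b (t / s))) := by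
    intro t ht
    have hm : AEMeasurable (fun s => quantile P X (1 - 1 / (t / s)))
        (volume.restrict (Ioo 0 t)) := by
      refine aemeasurable_restrict_of_antitoneOn measurableSet_Ioo ?_
      intro s hs s' hs' hss
      exact quantile_monotoneOn hX h0 ((one_lt_div hs'.1).2 hs'.2) ((one_lt_div hs.1).2 hs.2)
        (div_le_div_of_nonneg_left ht.le hs.1 hss)
    have hdm : Measurable fun ω => diagPoint (X ω) := continuous_diagPoint.measurable.comp hX
    rw [← lintegral_indicator hO, ← hg, lintegral_smul_measure, lintegral_map hgm (by fun_prop),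
      lintegral_map (f := fun x => g ((b t)⁻¹ • x)) (by fun_prop) hdm]
    simp_rw [smul_diagPoint]
    have hgb : Measurable fun r => g (diagPoint ((b t)⁻¹ * r)) :=
      hgdm.comp (measurable_const_mul _)
    have h2 : ∫⁻ ω, g (diagPoint ((b t)⁻¹ * X ω)) ∂P =
        ∫⁻ r, g (diagPoint ((b t)⁻¹ * r)) ∂(P.map X) := by
      rw [lintegral_map hgb hX]
    rw [h2, ← lintegral_smul_measure, ← map_volume_quantile hX h0 ht,
      lintegral_map' hgb.aemeasurable hm]
  have hrhs : ∫⁻ x in orthant 2 \ {0}, ENNReal.ofReal (f x) ∂(diagMeasure α) =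
      ∫⁻ s in Ioi (0 : ℝ), g (diagPoint (s ^ (-1 / α))) := by
    rw [← lintegral_indicator hO, ← hg, diagMeasure,
      lintegral_map hgm (measurable_diagPoint_rpow α)]
  rw [hrhs]
  have hlim0 := h.tendsto_mul_tail_mul_quantile hX h0 (half_pos hε'0)
  -- Eventually `t P(X > ε' / 2 * b t) < M`. For `s > M` this forces `b (t / s) ≤ ε' / 2 * b t`,
  -- where the test function vanishes; the integrands are thus dominated by a constant on `(0, M]`.
  set M := (ε' / 2) ^ (-α) + 1
  have key : Tendsto (fun t => ∫⁻ s in Ioi (0 : ℝ),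
      (Ioo 0 t).indicator (fun s => g (diagPoint ((b t)⁻¹ * b (t / s)))) s) atTop
      (𝓝 (∫⁻ s in Ioi (0 : ℝ), g (diagPoint (s ^ (-1 / α))))) := by
    refine tendsto_lintegral_filter_of_dominated_convergence'
      ((Iic M).indicator fun _ => ENNReal.ofReal K) ?_ ?_ ?_ ?_
    · filter_upwards [eventually_gt_atTop 0] with t ht
      refine AEMeasurable.restrict ?_
      refine (aemeasurable_indicator_iff measurableSet_Ioo).2 ?_
      refine hgdm.comp_aemeasurable (AEMeasurable.const_mul ?_ _)
      refine aemeasurable_restrict_of_antitoneOn measurableSet_Ioo ?_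
      intro s hs s' hs' hss
      exact quantile_monotoneOn hX h0 ((one_lt_div hs'.1).2 hs'.2) ((one_lt_div hs.1).2 hs.2)
        (div_le_div_of_nonneg_left ht.le hs.1 hss)
    · filter_upwards [eventually_gt_atTop 0, hb.eventually_gt_atTop 0,
        hlim0.eventually (gt_mem_nhds (lt_add_one _))] with t ht hbt hMt
      refine ae_of_all _ fun s => ?_
      by_cases hs : s ∈ Ioo 0 t
      · rw [indicator_of_mem hs]
        by_cases hsM : s ∈ Iic M
        · rw [indicator_of_mem hsM]
          exact hgle _
        · rw [indicator_of_notMem hsM]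
          have h1 : 1 < t / s := (one_lt_div hs.1).2 hs.2
          have h2 : b (t / s) ≤ ε' / 2 * b t := by
            rw [hbdef, quantile_le_iff hX h0 h1, one_div_div, le_div_iff₀ ht, mul_comm]
            exact hMt.le.trans (not_le.1 hsM).le
          have h3 : 0 ≤ b (t / s) := by
            by_contra! hneg
            have := (quantile_le_iff hX h0 h1 _).1 hneg.le
            obtain ⟨y, hy1, hy2⟩ := exists_between hneg
            have h5 := (quantile_le_iff hX h0 h1 _).1 hy1.le
            have : {ω | y < X ω} = univ := eq_univ_of_forall fun ω => hy2.trans_le (h0 ω)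
            rw [this, probReal_univ, le_div_iff₀ (by linarith)] at h5
            linarith
          rw [hgzero _ (by positivity)]
          rw [inv_mul_lt_iff₀ hbt]
          nlinarith
      · rw [indicator_of_notMem hs]
        exact zero_le
    · rw [lintegral_indicator measurableSet_Iic, Measure.restrict_restrict measurableSet_Iic]
      rw [lintegral_const, Measure.restrict_apply_univ]
      refine ENNReal.mul_ne_top ENNReal.ofReal_ne_top (ne_top_of_le_ne_top ?_
        (measure_mono (t := Icc 0 M) fun x hx => ⟨(mem_Ioi.1 hx.2).le, hx.1⟩))
      simp
    · refine (ae_restrict_iff' measurableSet_Ioi).2 (ae_of_all _ fun s hs => ?_)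
      have hs0 : 0 < s := hs
      have hq : Tendsto (fun t => (b t)⁻¹ * b (t / s)) atTop (𝓝 (s ^ (-1 / α))) := by
        have := h.tendsto_quantile_div hα hX h0 (inv_pos.2 hs0)
        rw [Real.inv_rpow hs0.le, ← Real.rpow_neg hs0.le, ← neg_div] at this
        refine this.congr fun t => ?_
        rw [inv_mul_eq_div, inv_mul_eq_div]
      have hlim : Tendsto (fun r => g (diagPoint r)) (𝓝 (s ^ (-1 / α)))
          (𝓝 (g (diagPoint (s ^ (-1 / α))))) := by
        have hsp := Real.rpow_pos_of_pos hs0 (-1 / α)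
        rw [hgpos _ hsp]
        have hc : ContinuousOn (fun r => f (diagPoint r)) (Ioi 0) :=
          hfc.comp continuous_diagPoint.continuousOn fun r hr => diagPoint_mem_diff hr
        refine ((ENNReal.continuous_ofReal.tendsto _).comp
          (hc.continuousAt (Ioi_mem_nhds hsp)).tendsto).congr' ?_
        filter_upwards [Ioi_mem_nhds hsp] with r hr
        exact (hgpos r hr).symm
      refine (hlim.comp hq).congr' ?_
      filter_upwards [eventually_gt_atTop s] with t ht
      rw [indicator_of_mem (show s ∈ Ioo 0 t from ⟨hs0, ht⟩)]
      rfl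
  refine key.congr' ?_
  filter_upwards [eventually_gt_atTop 0] with t ht
  rw [hlhs t ht, lintegral_indicator measurableSet_Ioo, Measure.restrict_restrict measurableSet_Ioo,
    inter_eq_left.2 Ioo_subset_Ioi_self]

end Diagonal

/-! ### Mixed Poisson laws -/

section MixedPoisson

variable {Ω S T : Type*} [MeasurableSpace Ω] [MeasurableSpace S] {P : Measure Ω}

/-- Disintegration of the joint law of a random element and a discrete random element along a
conditional law. -/
lemma measure_mem_eq_lintegral [Countable T] [MeasurableSpace T] [MeasurableSingletonClass T]
    {X : Ω → S} {D : Ω → T} (hX : Measurable X) (hD : Measurable D) {κ : S → Measure T}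
    (hκ : ∀ a, Measurable fun s => κ s {a})
    (h : ∀ B, MeasurableSet B → ∀ a,
      P {ω | X ω ∈ B ∧ D ω = a} = ∫⁻ ω in {ω | X ω ∈ B}, κ (X ω) {a} ∂P)
    {E : S → Set T} (hE : ∀ a, MeasurableSet {s | a ∈ E s}) :
    P {ω | D ω ∈ E (X ω)} = ∫⁻ ω, κ (X ω) (E (X ω)) ∂P := by
  have hset : {ω | D ω ∈ E (X ω)} = ⋃ a, {ω | X ω ∈ {s | a ∈ E s} ∧ D ω = a} := by
    ext ω
    simp
  rw [hset, measure_iUnion]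
  · simp_rw [h _ (hE _)]
    have : ∀ a, ∫⁻ ω in {ω | X ω ∈ {s | a ∈ E s}}, κ (X ω) {a} ∂P =
        ∫⁻ ω, (E (X ω)).indicator (fun b => κ (X ω) {b}) a ∂P := by
      intro a
      rw [← lintegral_indicator (show MeasurableSet {ω | X ω ∈ {s | a ∈ E s}} from hX (hE a))]
      rfl
    simp_rw [this]
    rw [← lintegral_tsum]
    · simp_rw [Measure.tsum_indicator_apply_singleton _ _ (Set.to_countable _).measurableSet]
    · intro a
      exact (((hκ a).comp hX).indicator (hX (hE a))).aemeasurable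
  · intro a b hab
    refine Set.disjoint_left.2 fun ω h1 h2 => hab ?_
    rw [← h1.2, ← h2.2]
  · intro a
    exact (hX (hE a)).inter (hD (measurableSet_singleton a))

lemma measurable_poissonMeasure_toNNReal_singleton (n : ℕ) :
    Measurable fun r : ℝ => poissonMeasure r.toNNReal {n} := by
  simp_rw [poissonMeasure_singleton]
  fun_prop

/-- A sum of independent Poisson variables is Poisson. -/
lemma pi_poissonMeasure_sum_eq {ι : Type*} [Fintype ι] (r : ι → ℝ≥0) (n : ℕ) :
    Measure.pi (fun i => poissonMeasure (r i)) {c | ∑ i, c i = n} =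
      poissonMeasure (∑ i, r i) {n} := by
  classical
  have hind : iIndepFun (fun i (ω : ι → ℕ) => ω i) (Measure.pi fun i => poissonMeasure (r i)) :=
    iIndepFun_pi (X := fun _ => id) fun _ => aemeasurable_id
  have hlaw : ∀ s : Finset ι, HasLaw (∑ i ∈ s, fun ω : ι → ℕ => ω i)
      (poissonMeasure (∑ i ∈ s, r i)) (Measure.pi fun i => poissonMeasure (r i)) := by
    intro s
    induction s using Finset.induction_on with
    | empty =>
      refine ⟨by fun_prop, ?_⟩
      simp only [Finset.sum_empty]
      have : (0 : (ι → ℕ) → ℕ) = fun _ => 0 := rfl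
      rw [this, Measure.map_const, measure_univ, one_smul]
      refine Measure.ext_of_singleton fun k => ?_
      rw [poissonMeasure_singleton]
      rcases Nat.eq_zero_or_pos k with rfl | hk
      · simp
      · simp [hk.ne', hk.ne]
    | insert a s ha ih =>
      rw [Finset.sum_insert ha, Finset.sum_insert ha]
      refine IndepFun.hasLaw_add_poissonMeasure ?_ ?_ ih
      · exact (hind.indepFun_finsetSum_of_notMem (fun i => measurable_pi_apply i) ha).symm
      · exact (measurePreserving_eval (fun i => poissonMeasure (r i)) a).hasLaw
  have h := (hlaw Finset.univ).map_eq
  rw [← h, Measure.map_apply (by fun_prop) (measurableSet_singleton n)]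
  congr 1
  ext c
  simp

/-- The degrees in the Norros–Reittu model are conditionally independent Poisson variables. -/
theorem isMixedPoisson_degree {n L : ℕ} [NeZero n] {W : Fin n → Ω → Fin L → ℝ}
    {A : Ω → Fin n → Fin n → Fin L → ℕ} (h : IsNorrosReittu P W A) :
    IsMixedPoisson P (fun ω i => W i ω) (fun w => w 0) (degree A 0) := by
  have hA : ∀ i j l, Measurable fun ω => A ω i j l := fun i j l =>
    (measurable_pi_apply l).comp ((measurable_pi_apply j).comp
      ((measurable_pi_apply i).comp h.measurable_adj))
  refine ⟨measurable_pi_lambda _ fun l => Finset.measurable_sum _ fun j _ => hA 0 j l,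
    fun B hB m => ?_⟩
  -- Entries below the diagonal get rate zero and, in `A'`, the value zero. Since a Poisson variable
  -- of mean zero vanishes, the conditional law of the whole array is then a plain product measure.
  set rate : (Fin n → Fin L → ℝ) → Fin L → Fin n → Fin n → ℝ := fun w l i j =>
    if i ≤ j then w i l * w j l / ∑ k, w k l else 0 with hrate
  set κ : (Fin n → Fin L → ℝ) → Measure (Fin L → Fin n → Fin n → ℕ) := fun w =>
    Measure.pi fun l => Measure.pi fun i => Measure.pi fun j =>
      poissonMeasure (rate w l i j).toNNReal with hκdef
  set A' : Ω → Fin L → Fin n → Fin n → ℕ := fun ω l i j => if i ≤ j then A ω i j l else 0 with hA'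
  have hX : Measurable fun ω i => W i ω := measurable_pi_lambda _ h.measurable_weight
  have hA'm : Measurable A' := by
    refine measurable_pi_lambda _ fun l => measurable_pi_lambda _ fun i =>
      measurable_pi_lambda _ fun j => ?_
    by_cases hij : i ≤ j
    · simpa [hA', hij] using hA i j l
    · simp [hA', hij]
  have hκs : ∀ w a, κ w {a} =
      ∏ l, ∏ i, ∏ j, poissonMeasure (rate w l i j).toNNReal {a l i j} := by
    intro w a
    simp_rw [hκdef, Measure.pi_singleton]
  have hrm : ∀ l i j, Measurable fun w => rate w l i j := by
    intro l i j
    by_cases hij : i ≤ j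
    · simp only [hrate, hij, if_true]
      fun_prop
    · simp [hrate, hij]
  have hκm : ∀ a, Measurable fun w => κ w {a} := by
    intro a
    simp_rw [hκs]
    exact Finset.measurable_fun_prod _ fun l _ => Finset.measurable_fun_prod _ fun i _ =>
      Finset.measurable_fun_prod _ fun j _ =>
        (measurable_poissonMeasure_toNNReal_singleton _).comp (hrm l i j)
  have hcond : ∀ B, MeasurableSet B → ∀ a,
      P {ω | (fun i => W i ω) ∈ B ∧ A' ω = a} =
        ∫⁻ ω in {ω | (fun i => W i ω) ∈ B}, κ (fun i => W i ω) {a} ∂P := by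
    intro B hB a
    -- For arrays vanishing below the diagonal the extra factors equal one; for all other arrays
    -- both sides are zero.
    by_cases ha : ∀ l i j, ¬ i ≤ j → a l i j = 0
    · convert h.cond B hB (fun i j l => a l i j) using 2
      · ext ω
        refine and_congr_right fun _ => ?_
        simp only [funext_iff]
        refine forall_congr' fun l => forall_congr' fun i => forall_congr' fun j => ?_
        by_cases hij : i ≤ j
        · simp [hA', hij]
        · simp [hA', hij, ha l i j hij]
      · refine funext fun ω => ?_
        rw [hκs]
        refine Finset.prod_congr rfl fun l _ => Finset.prod_congr rfl fun i _ => ?_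
        symm
        refine Finset.prod_subset_one_on_sdiff (Finset.subset_univ _) (fun j hj => ?_)
          fun j hj => ?_
        · have hij : ¬ i ≤ j := by simpa using hj
          simp [hrate, hij, ha l i j hij, poissonMeasure_singleton]
        · have hij : i ≤ j := by simpa using hj
          simp [hrate, hij]
    · push Not at ha
      obtain ⟨l, i, j, hij, hne⟩ := ha
      have h1 : {ω | (fun i => W i ω) ∈ B ∧ A' ω = a} = ∅ := by
        ext ω
        simp only [mem_ofPred_eq, mem_empty_iff_false, iff_false, not_and]
        rintro - rfl
        exact hne (if_neg (not_le.2 hij))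
      have h2 : ∀ w, κ w {a} = 0 := by
        intro w
        rw [hκs]
        refine Finset.prod_eq_zero (Finset.mem_univ l) (Finset.prod_eq_zero (Finset.mem_univ i)
          (Finset.prod_eq_zero (Finset.mem_univ j) ?_))
        simp [hrate, not_le.2 hij, hne, poissonMeasure_singleton]
      rw [h1, measure_empty]
      simp [h2]
  have key := measure_mem_eq_lintegral (P := P) hX hA'm hκm hcond
    (E := fun w => {a | w ∈ B ∧ ∀ l, ∑ j, a l 0 j = m l}) fun a => by
      by_cases ha : ∀ l, ∑ j, a l 0 j = m l
      · simpa [ha] using hB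
      · simp [ha]
  -- Index `0` is minimal, so the whole row of node `0` lies on or above the diagonal and survives
  -- in `A'`.
  have hdeg : ∀ ω, degree A 0 ω = m ↔ ∀ l, ∑ j, A' ω l 0 j = m l := by
    intro ω
    simp [funext_iff, degree, hA']
  simp_rw [hdeg]
  refine key.trans ?_
  rw [← lintegral_indicator (show MeasurableSet {ω | (fun i => W i ω) ∈ B} from hX hB)]
  refine lintegral_congr fun ω => ?_
  by_cases hω : (fun i => W i ω) ∈ B
  · rw [indicator_of_mem (show ω ∈ {ω | (fun i => W i ω) ∈ B} from hω)]
    have hset : {a : Fin L → Fin n → Fin n → ℕ | (fun i => W i ω) ∈ B ∧ ∀ l, ∑ j, a l 0 j = m l} =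
        univ.pi fun l => (Function.eval 0) ⁻¹' {c : Fin n → ℕ | ∑ j, c j = m l} := by
      ext a
      simp [hω]
    rw [hset, hκdef, Measure.pi_pi]
    refine Finset.prod_congr rfl fun l _ => ?_
    rw [(measurePreserving_eval (fun i => Measure.pi fun j =>
      poissonMeasure (rate (fun i => W i ω) l i j).toNNReal) 0).measure_preimage
        (Set.to_countable _).measurableSet.nullMeasurableSet, pi_poissonMeasure_sum_eq]
    congr 2
    have hnn : ∀ j, 0 ≤ rate (fun i => W i ω) l 0 j := by
      intro j
      simp only [hrate, Fin.zero_le, if_true]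
      exact div_nonneg (mul_nonneg (h.nonneg _ _ _) (h.nonneg _ _ _))
        (Finset.sum_nonneg fun k _ => h.nonneg _ _ _)
    rw [← Real.toNNReal_sum_of_nonneg fun j _ => hnn j]
    congr 1
    simp only [hrate, Fin.zero_le, if_true]
    rw [← Finset.sum_div, ← Finset.mul_sum]
    -- Zero total weight makes every weight in the layer zero, so the convention `0 / 0 = 0` gives
    -- the right mean.
    by_cases hT : ∑ k, W k ω l = 0
    · rw [hT, div_zero]
      exact ((Finset.sum_eq_zero_iff_of_nonneg fun k _ => h.nonneg k ω l).1 hT 0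
        (Finset.mem_univ _)).symm
    · rw [mul_div_cancel_right₀ _ hT]
  · rw [indicator_of_notMem (show ω ∉ {ω | (fun i => W i ω) ∈ B} from hω)]
    simp [hω]

end MixedPoisson

/-! ### Pairs of independent Poisson variables -/

section PoissonPair

/-- The law of two independent Poisson variables with the same mean. -/
noncomputable def poissonPair (w : ℝ≥0) : Measure (ℕ × ℕ) :=
  (poissonMeasure w).prod (poissonMeasure w)

instance (w : ℝ≥0) : IsProbabilityMeasure (poissonPair w) := by
  unfold poissonPair; infer_instance

/-- The probability generating function of the Poisson distribution. -/
lemma lintegral_pow_poissonMeasure (w : ℝ≥0) {a : ℝ} (ha : 0 ≤ a) :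
    ∫⁻ n, ENNReal.ofReal (a ^ n) ∂(poissonMeasure w) = ENNReal.ofReal (Real.exp (w * (a - 1))) := by
  rw [poissonMeasure, lintegral_sum_measure]
  simp_rw [lintegral_smul_measure, lintegral_dirac, smul_eq_mul]
  have hs : HasSum (fun n : ℕ => Real.exp (-w) * w ^ n / n.factorial * a ^ n)
      (Real.exp (w * (a - 1))) := by
    have h := (NormedSpace.expSeries_div_hasSum_exp (w * a : ℝ)).mul_left (Real.exp (-w))
    rw [← Real.exp_eq_exp_ℝ, ← Real.exp_add] at h
    have e1 : (fun n : ℕ => Real.exp (-w) * w ^ n / n.factorial * a ^ n) =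
        fun n : ℕ => Real.exp (-w) * ((w * a) ^ n / n.factorial) := by
      ext n
      rw [mul_pow]
      ring
    rwa [e1, show (w : ℝ) * (a - 1) = -w + w * a by ring]
  rw [← hs.tsum_eq, ENNReal.ofReal_tsum_of_nonneg (fun n => by positivity) hs.summable]
  refine tsum_congr fun n => ?_
  rw [← ENNReal.ofReal_mul (by positivity)]

/-- Exponential Markov inequality for a pair of Poisson variables. -/
lemma poissonPair_le (w : ℝ≥0) {E : Set (ℕ × ℕ)} {a c K : ℝ} (ha : 0 ≤ a) (hc : 0 ≤ c)
    (hK : 0 ≤ K) (h : ∀ m ∈ E, 1 ≤ K * (a ^ m.1 * c ^ m.2)) :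
    poissonPair w E ≤ ENNReal.ofReal (K * Real.exp (w * (a + c - 2))) := by
  have h1 : ∀ m ∈ E, 1 ≤ ENNReal.ofReal K * (ENNReal.ofReal (a ^ m.1) * ENNReal.ofReal (c ^ m.2)) := by
    intro m hm
    rw [← ENNReal.ofReal_mul (by positivity), ← ENNReal.ofReal_mul hK, ENNReal.one_le_ofReal]
    exact h m hm
  calc poissonPair w E = ∫⁻ _ in E, 1 ∂(poissonPair w) := by simp
    _ ≤ ∫⁻ m in E, ENNReal.ofReal K * (ENNReal.ofReal (a ^ m.1) * ENNReal.ofReal (c ^ m.2))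
        ∂(poissonPair w) := setLIntegral_mono' (Set.to_countable _).measurableSet h1
    _ ≤ ∫⁻ m, ENNReal.ofReal K * (ENNReal.ofReal (a ^ m.1) * ENNReal.ofReal (c ^ m.2))
        ∂(poissonPair w) := setLIntegral_le_lintegral _ _
    _ = _ := by
      rw [lintegral_const_mul' _ _ ENNReal.ofReal_ne_top, poissonPair,
        lintegral_prod_mul (f := fun n => ENNReal.ofReal (a ^ n))
          (g := fun n => ENNReal.ofReal (c ^ n)) (by fun_prop) (by fun_prop),
        lintegral_pow_poissonMeasure w ha, lintegral_pow_poissonMeasure w hc,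
        ← ENNReal.ofReal_mul (Real.exp_nonneg _), ← Real.exp_add, ← ENNReal.ofReal_mul hK]
      congr 3
      ring

/-- A Chernoff bound for each sign of the difference: `s` tilts the difference and `r` penalizes the
total. The penalty serves events on which the total is bounded, while `r = 0` gives the plain bound.
-/
lemma poissonPair_sub_le (w : ℝ≥0) (s r y : ℝ) {E : Set (ℕ × ℕ)}
    (h : ∀ m ∈ E, y ≤ s * |(m.1 : ℝ) - m.2| - r * (m.1 + m.2)) :
    poissonPair w E ≤ ENNReal.ofReal
      (2 * Real.exp (w * (Real.exp (s - r) + Real.exp (-s - r) - 2) - y)) := by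
  have hsub : E ⊆ {m | y ≤ s * ((m.1 : ℝ) - m.2) - r * (m.1 + m.2)} ∪
      {m | y ≤ s * ((m.2 : ℝ) - m.1) - r * (m.1 + m.2)} := by
    intro m hm
    have := h m hm
    rcases abs_cases ((m.1 : ℝ) - m.2) with h1 | h1
    · left
      rw [h1.1] at this
      exact this
    · right
      rw [h1.1, neg_sub] at this
      exact this
  have h1 : poissonPair w {m | y ≤ s * ((m.1 : ℝ) - m.2) - r * (m.1 + m.2)} ≤
      ENNReal.ofReal (Real.exp (-y) * Real.exp (w * (Real.exp (s - r) + Real.exp (-s - r) - 2))) := by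
    refine poissonPair_le w (Real.exp_nonneg _) (Real.exp_nonneg _) (Real.exp_nonneg _)
      fun m hm => ?_
    rw [← Real.exp_nat_mul, ← Real.exp_nat_mul, ← Real.exp_add, ← Real.exp_add, Real.one_le_exp_iff]
    have hm' : y ≤ s * ((m.1 : ℝ) - m.2) - r * (m.1 + m.2) := hm
    linarith
  have h2 : poissonPair w {m | y ≤ s * ((m.2 : ℝ) - m.1) - r * (m.1 + m.2)} ≤
      ENNReal.ofReal (Real.exp (-y) * Real.exp (w * (Real.exp (-s - r) + Real.exp (s - r) - 2))) := by
    refine poissonPair_le w (Real.exp_nonneg _) (Real.exp_nonneg _) (Real.exp_nonneg _)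
      fun m hm => ?_
    rw [← Real.exp_nat_mul, ← Real.exp_nat_mul, ← Real.exp_add, ← Real.exp_add, Real.one_le_exp_iff]
    have hm' : y ≤ s * ((m.2 : ℝ) - m.1) - r * (m.1 + m.2) := hm
    linarith
  refine (measure_mono hsub).trans ((measure_union_le _ _).trans ((add_le_add h1 h2).trans ?_))
  rw [← ENNReal.ofReal_add (by positivity) (by positivity), ← Real.exp_add, ← Real.exp_add]
  refine le_of_eq ?_
  rw [two_mul]
  congr 3 <;> ring

lemma exp_add_exp_neg_sub_two_le {s : ℝ} (hs : |s| ≤ 1) :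
    Real.exp s + Real.exp (-s) - 2 ≤ 2 * s ^ 2 := by
  have h1 := (abs_le.1 (Real.abs_exp_sub_one_sub_id_le hs)).2
  have h2 := (abs_le.1 (Real.abs_exp_sub_one_sub_id_le (x := -s) (by rwa [abs_neg]))).2
  nlinarith

/-- The difference of two Poisson variables with mean `w` exceeds `√2 x` with a probability which is
at most of the order of any power of `w / x ^ 2`. -/
lemma exists_poissonPair_abs_sub_le (k : ℕ) :
    ∃ C : ℝ, 0 < C ∧ ∀ (x : ℝ) (w : ℝ≥0), 0 < x →
      poissonPair w {m | √2 * x < |(m.1 : ℝ) - m.2|} ≤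
        ENNReal.ofReal (C * (max (w : ℝ) 1 / x ^ 2) ^ k) := by
  refine ⟨2 * Real.exp 2 * (2 * k).factorial, by positivity, fun x w hx => ?_⟩
  set M := max (w : ℝ) 1
  have hM1 : 1 ≤ M := le_max_right _ _
  have hM0 : 0 < M := by linarith
  -- With `s² = 1 / M` and `w ≤ M` the cumulant term stays below `2`. What remains is `exp(-√2 x /
  -- √M)`, which the term of order `2k` of the exponential series bounds by a multiple of `(M /
  -- x²)^k`. Taking the maximum with `1` keeps `s ≤ 1`.
  set s := 1 / √M
  have hs0 : 0 < s := by positivity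
  have hs1 : s ≤ 1 := by
    rw [div_le_one (by positivity)]
    exact Real.one_le_sqrt.2 hM1
  have hs2 : s ^ 2 = 1 / M := by rw [div_pow, Real.sq_sqrt hM0.le, one_pow]
  refine (poissonPair_sub_le w s 0 (s * (√2 * x)) fun m hm => ?_).trans
    (ENNReal.ofReal_le_ofReal ?_)
  · have hm' : √2 * x < |(m.1 : ℝ) - m.2| := hm
    rw [zero_mul, sub_zero]
    gcongr
  · rw [sub_zero, sub_zero, Real.exp_sub]
    have h1 : (w : ℝ) * (Real.exp s + Real.exp (-s) - 2) ≤ 2 := by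
      have h := exp_add_exp_neg_sub_two_le (s := s) (by rwa [abs_of_pos hs0])
      have hw : (w : ℝ) ≤ M := le_max_left _ _
      calc (w : ℝ) * (Real.exp s + Real.exp (-s) - 2) ≤ w * (2 * s ^ 2) := by gcongr
        _ ≤ M * (2 * s ^ 2) := by gcongr
        _ = 2 := by rw [hs2]; field_simp
    have h2 := Real.pow_div_factorial_le_exp (x := s * (√2 * x)) (by positivity) (2 * k)
    have h3 : (s * (√2 * x)) ^ (2 * k) = (2 * x ^ 2 / M) ^ k := by
      rw [pow_mul, mul_pow, mul_pow √2, hs2, Real.sq_sqrt (by norm_num), one_div_mul_eq_div]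
    rw [h3] at h2
    have h4 : 0 < (2 * x ^ 2 / M) ^ k := by positivity
    rw [div_le_iff₀ (by positivity)] at h2
    calc 2 * (Real.exp (w * (Real.exp s + Real.exp (-s) - 2)) / Real.exp (s * (√2 * x)))
        ≤ 2 * (Real.exp 2 / Real.exp (s * (√2 * x))) := by gcongr
      _ ≤ 2 * (Real.exp 2 * ((2 * k).factorial * (M / x ^ 2) ^ k)) := by
        gcongr
        rw [div_eq_mul_inv]
        gcongr
        rw [inv_le_iff_one_le_mul₀ (Real.exp_pos _)]
        have h5 : (1 : ℝ) ≤ (M / x ^ 2) ^ k * (2 * x ^ 2 / M) ^ k := by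
          rw [← mul_pow]
          refine one_le_pow₀ ?_
          field_simp
          norm_num
        calc (1 : ℝ) ≤ (M / x ^ 2) ^ k * (2 * x ^ 2 / M) ^ k := h5
          _ ≤ (M / x ^ 2) ^ k * (Real.exp (s * (√2 * x)) * (2 * k).factorial) := by gcongr
          _ = _ := by ring
      _ = _ := by ring

/-- Two Poisson variables with the same mean are unlikely to be far apart compared with their
size, uniformly in the mean. -/
lemma poissonPair_abs_sub_le_of_add_le (w : ℝ≥0) {ε K : ℝ} (hε : 0 < ε) (hK : 0 < K) {x : ℝ} :
    poissonPair w {m | ε * x ≤ |(m.1 : ℝ) - m.2| ∧ (m.1 : ℝ) + m.2 ≤ K * x} ≤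
      ENNReal.ofReal (2 * Real.exp (-(ε ^ 2 / (2 * K) * x))) := by
  -- The penalty `s² / 2` cancels the dependence on the mean, because `cosh s ≤ exp (s² / 2)`. The
  -- remaining exponent `s ε x - s² K x / 2` is largest at `s = ε / K`.
  set s := ε / K
  have hs : 0 < s := by positivity
  refine (poissonPair_sub_le w s (s ^ 2 / 2) (ε ^ 2 / (2 * K) * x) fun m hm => ?_).trans
    (ENNReal.ofReal_le_ofReal ?_)
  · obtain ⟨h1, h2⟩ := hm
    have e : ε ^ 2 / (2 * K) * x = s * (ε * x) - s ^ 2 / 2 * (K * x) := by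
      simp only [s]
      field_simp
      ring
    rw [e]
    gcongr
  · gcongr
    have h1 : Real.exp (s - s ^ 2 / 2) + Real.exp (-s - s ^ 2 / 2) - 2 ≤ 0 := by
      have h := Real.cosh_le_exp_half_sq s
      rw [Real.cosh_eq] at h
      rw [sub_eq_add_neg s, sub_eq_add_neg (-s), Real.exp_add, Real.exp_add, ← add_mul,
        Real.exp_neg (s ^ 2 / 2)]
      have h2 : (Real.exp s + Real.exp (-s)) * (Real.exp (s ^ 2 / 2))⁻¹ ≤ 2 := by
        rw [← div_eq_mul_inv, div_le_iff₀ (Real.exp_pos _)]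
        linarith
      linarith
    nlinarith [w.2, mul_nonpos_of_nonneg_of_nonpos w.2 h1]

/-- The law of large numbers for Poisson variables with large mean. -/
lemma tendsto_poissonPair_abs_div_sub_one {ε : ℝ} (hε : 0 < ε) (hε2 : ε ≤ 2) :
    Tendsto (fun w : ℝ≥0 => poissonPair w {m | ε ≤ |(m.1 : ℝ) / w - 1|}) atTop (𝓝 0) := by
  have hexp : Tendsto (fun w : ℝ≥0 => ENNReal.ofReal (2 * Real.exp (-(ε ^ 2 / 4 * w)))) atTop
      (𝓝 0) := by
    have h1 : Tendsto (fun w : ℝ≥0 => ε ^ 2 / 4 * (w : ℝ)) atTop atTop :=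
      (NNReal.tendsto_coe_atTop.2 tendsto_id).const_mul_atTop (by positivity)
    have h2 := (Real.tendsto_exp_neg_atTop_nhds_zero.comp h1).const_mul 2
    rw [mul_zero] at h2
    simpa using ENNReal.tendsto_ofReal h2
  refine tendsto_of_tendsto_of_tendsto_of_le_of_le' tendsto_const_nhds hexp
    (Eventually.of_forall fun _ => zero_le) ?_
  filter_upwards [eventually_gt_atTop 0] with w hw
  have hw' : (0 : ℝ) < w := by exact_mod_cast hw
  -- With `e^s ≤ 1 + s + s²` for `|s| ≤ 1`, each one-sided Chernoff exponent is at most `w (s² - ε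
  -- s)`; at `s = ε / 2` this is `-ε² w / 4`.
  set s := ε / 2
  have hs0 : 0 < s := by positivity
  have hs1 : s ≤ 1 := by simp only [s]; linarith
  have hsε : ε = 2 * s := by simp only [s]; ring
  have hsub : {m : ℕ × ℕ | ε ≤ |(m.1 : ℝ) / w - 1|} ⊆
      {m | (1 + ε) * w ≤ m.1} ∪ {m | (m.1 : ℝ) ≤ (1 - ε) * w} := by
    intro m hm
    have hm' : ε ≤ |(m.1 : ℝ) / w - 1| := hm
    rcases le_abs.1 hm' with h | h
    · left
      rw [le_sub_iff_add_le, le_div_iff₀ hw'] at h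
      show (1 + ε) * w ≤ m.1
      linarith
    · right
      have : (m.1 : ℝ) / w ≤ 1 - ε := by linarith
      rwa [div_le_iff₀ hw'] at this
  have h1 : poissonPair w {m | (1 + ε) * w ≤ m.1} ≤
      ENNReal.ofReal (Real.exp (-(s * ((1 + ε) * w))) *
        Real.exp (w * (Real.exp s + 1 - 2))) := by
    refine poissonPair_le w (Real.exp_nonneg _) zero_le_one (Real.exp_nonneg _) fun m hm => ?_
    rw [← Real.exp_nat_mul, one_pow, mul_one, ← Real.exp_add, Real.one_le_exp_iff]
    have hm' : (1 + ε) * w ≤ m.1 := hm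
    nlinarith
  have h2 : poissonPair w {m | (m.1 : ℝ) ≤ (1 - ε) * w} ≤
      ENNReal.ofReal (Real.exp (s * ((1 - ε) * w)) *
        Real.exp (w * (Real.exp (-s) + 1 - 2))) := by
    refine poissonPair_le w (Real.exp_nonneg _) zero_le_one (Real.exp_nonneg _) fun m hm => ?_
    rw [← Real.exp_nat_mul, one_pow, mul_one, ← Real.exp_add, Real.one_le_exp_iff]
    have hm' : (m.1 : ℝ) ≤ (1 - ε) * w := hm
    nlinarith
  refine (measure_mono hsub).trans ((measure_union_le _ _).trans ((add_le_add h1 h2).trans ?_))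
  rw [← ENNReal.ofReal_add (by positivity) (by positivity), ← Real.exp_add, ← Real.exp_add]
  refine ENNReal.ofReal_le_ofReal ?_
  rw [two_mul]
  have e1 := (abs_le.1 (Real.abs_exp_sub_one_sub_id_le (x := s) (by rwa [abs_of_pos hs0]))).2
  have e2 := (abs_le.1 (Real.abs_exp_sub_one_sub_id_le (x := -s)
    (by rwa [abs_neg, abs_of_pos hs0]))).2
  refine add_le_add (Real.exp_le_exp.2 ?_) (Real.exp_le_exp.2 ?_)
  · have := mul_le_mul_of_nonneg_left e1 hw'.le
    rw [hsε]
    nlinarith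
  · have := mul_le_mul_of_nonneg_left e2 hw'.le
    rw [hsε]
    nlinarith

/-! ### The central limit theorem for the difference -/

/-- The law of the normalized difference of two independent Poisson variables. -/
noncomputable def poissonDiff (w : ℝ≥0) : Measure ℝ :=
  (poissonPair w).map fun m => ((m.1 : ℝ) - m.2) / √(2 * w)

instance (w : ℝ≥0) : IsProbabilityMeasure (poissonDiff w) :=
  Measure.isProbabilityMeasure_map .of_discrete

/-- Independence gives the product of the Poisson characteristic functions at `u` and `-u`, with
exponent `w (e^{iu} + e^{-iu} - 2)`. -/
lemma charFun_poissonDiff (w : ℝ≥0) (t : ℝ) :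
    charFun (poissonDiff w) t =
      Complex.exp ((w * (2 * Real.cos (t / √(2 * w)) - 2) : ℝ)) := by
  set u := t / √(2 * w) with hu
  have h1 : charFun (poissonDiff w) t =
      charFun ((poissonMeasure w).map (Nat.cast : ℕ → ℝ)) u *
        charFun ((poissonMeasure w).map (Nat.cast : ℕ → ℝ)) (-u) := by
    rw [charFun_apply_real, charFun_apply_real, charFun_apply_real, poissonDiff,
      integral_map .of_discrete (by fun_prop), integral_map .of_discrete (by fun_prop),
      integral_map .of_discrete (by fun_prop), poissonPair, ← integral_prod_mul]
    refine integral_congr_ae (ae_of_all _ fun m => ?_)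
    simp only
    rw [← Complex.exp_add]
    congr 1
    rw [hu]
    push_cast
    ring
  rw [h1, charFun_map_cast_poissonMeasure, charFun_map_cast_poissonMeasure, ← Complex.exp_add]
  congr 1
  push_cast
  have := Complex.two_cos (u : ℂ)
  rw [this]
  ring_nf

/-- The half-angle formula turns the expression into exactly `-(t² / 2) * sinc(t / (2√(2w)))²` for
`w > 0`, and `sinc` is continuous with value `1` at `0`. -/
lemma tendsto_mul_two_cos_sub_two (t : ℝ) :
    Tendsto (fun w : ℝ≥0 => (w : ℝ) * (2 * Real.cos (t / √(2 * w)) - 2)) atTop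
      (𝓝 (-(t ^ 2 / 2))) := by
  have h0 : Tendsto (fun w : ℝ≥0 => t / √(2 * w) / 2) atTop (𝓝 0) := by
    have h1 : Tendsto (fun w : ℝ≥0 => √(2 * (w : ℝ))) atTop atTop :=
      Real.tendsto_sqrt_atTop.comp
        ((NNReal.tendsto_coe_atTop.2 tendsto_id).const_mul_atTop (by norm_num))
    simpa using (h1.const_div_atTop t).div_const 2
  have h2 := ((Real.continuous_sinc.tendsto 0).comp h0).pow 2 |>.const_mul (-(t ^ 2 / 2))
  rw [Real.sinc_zero, one_pow, mul_one] at h2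
  refine h2.congr' ?_
  filter_upwards [eventually_gt_atTop 0] with w hw
  have hw' : (0 : ℝ) < w := by exact_mod_cast hw
  simp only [Function.comp_apply]
  rcases eq_or_ne t 0 with rfl | ht
  · simp
  set u := t / √(2 * w) / 2 with hu
  have hu0 : u ≠ 0 := by positivity
  have hu2 : t ^ 2 = 8 * w * u ^ 2 := by
    rw [hu, div_pow, div_pow, Real.sq_sqrt (by positivity)]
    field_simp
    norm_num
  have hc : Real.cos (t / √(2 * w)) = 1 - 2 * Real.sin u ^ 2 := by
    rw [show t / √(2 * w) = 2 * u by rw [hu]; ring, Real.cos_two_mul, Real.cos_sq']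
    ring
  rw [hc, Real.sinc_of_ne_zero hu0, hu2]
  field_simp
  ring

/-- `poissonDiff` as a bundled probability measure. -/
noncomputable def poissonDiffProb (w : ℝ≥0) : ProbabilityMeasure ℝ :=
  ⟨poissonDiff w, inferInstance⟩

/-- The standard normal distribution as a bundled probability measure. -/
noncomputable def stdNormalProb : ProbabilityMeasure ℝ := ⟨gaussianReal 0 1, inferInstance⟩

lemma tendsto_poissonDiffProb {w : ℕ → ℝ≥0} (hw : Tendsto w atTop atTop) :
    Tendsto (fun k => poissonDiffProb (w k)) atTop (𝓝 stdNormalProb) := by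
  refine ProbabilityMeasure.tendsto_iff_tendsto_charFun.2 fun t => ?_
  simp only [poissonDiffProb, stdNormalProb, ProbabilityMeasure.coe_mk, charFun_poissonDiff, charFun_gaussianReal]
  refine (Complex.continuous_exp.tendsto _).comp ?_
  have h := (Complex.continuous_ofReal.tendsto _).comp ((tendsto_mul_two_cos_sub_two t).comp hw)
  have e : (t : ℂ) * (0 : ℝ) * Complex.I - ((1 : ℝ≥0) : ℝ) * t ^ 2 / 2 =
      ((-(t ^ 2 / 2) : ℝ) : ℂ) := by
    push_cast
    ring
  rw [e]
  exact h

end PoissonPair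

/-! ### Joint normal limit of the degrees, uniform over large means -/

section JointLimit

/-- The two sets differ by at most four points. This lets the upper bound from closed sets and the
lower bound from open sets in the portmanteau theorem meet. -/
lemma gaussianReal_abs_sandwich (s v : ℝ) :
    gaussianReal 0 1 {z | s ≤ |z| ∧ v * |z| ≤ 1} = gaussianReal 0 1 {z | s < |z| ∧ v * |z| < 1} := by
  have : NullSingletonClass (gaussianReal 0 1) := nullSingletonClass_gaussianReal one_ne_zero
  refine le_antisymm ?_ (measure_mono fun z hz => ⟨hz.1.le, hz.2.le⟩)
  have hsub : {z : ℝ | s ≤ |z| ∧ v * |z| ≤ 1} ⊆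
      {z | s < |z| ∧ v * |z| < 1} ∪ ({s, -s, v⁻¹, -v⁻¹} : Set ℝ) := by
    rintro z ⟨h1, h2⟩
    rcases h1.lt_or_eq with h1 | h1
    · rcases h2.lt_or_eq with h2 | h2
      · exact Or.inl ⟨h1, h2⟩
      · right
        have hz : |z| = v⁻¹ := eq_inv_of_mul_eq_one_right h2
        rcases abs_cases z with h | h
        · have : z = v⁻¹ := by linarith
          simp [this]
        · have : z = -v⁻¹ := by linarith
          simp [this]
    · right
      rcases abs_cases z with h | h
      · have : z = s := by linarith
        simp [this]
      · have : z = -s := by linarith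
        simp [this]
  refine (measure_mono hsub).trans ((measure_union_le _ _).trans ?_)
  rw [(Set.toFinite ({s, -s, v⁻¹, -v⁻¹} : Set ℝ)).measure_zero, add_zero]

/-- Joint limit of the normalized difference and of the first component. -/
lemma tendsto_poissonPair_joint {w : ℕ → ℝ≥0} (hw : Tendsto w atTop atTop) {s : ℕ → ℝ} {s₀ : ℝ}
    (hs : Tendsto s atTop (𝓝 s₀)) (v : ℝ) :
    Tendsto (fun k => poissonPair (w k) {m | s k < |((m.1 : ℝ) - m.2) / √(2 * w k)| ∧
      v * |((m.1 : ℝ) - m.2) / √(2 * w k)| < m.1 / w k}) atTop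
      (𝓝 (gaussianReal 0 1 {z | s₀ < |z| ∧ v * |z| < 1})) := by
  set γ := gaussianReal 0 1
  set e : ℕ → ℝ := fun j => 1 / ((j : ℝ) + 1)
  have he0 : ∀ j, 0 < e j := fun j => Nat.one_div_pos_of_nat
  have he2 : ∀ j, e j ≤ 2 := fun j => by
    have : e j ≤ 1 := by
      rw [div_le_one (by positivity)]
      linarith [(Nat.cast_nonneg j : (0 : ℝ) ≤ j)]
    linarith
  have heanti : Antitone e := fun i j hij => Nat.one_div_le_one_div hij
  have helim : Tendsto e atTop (𝓝 0) := tendsto_one_div_add_atTop_nhds_zero_nat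
  set bad : ℕ → ℕ → ℝ≥0∞ := fun j k => poissonPair (w k) {m | e j ≤ |(m.1 : ℝ) / w k - 1|}
  have hbad : ∀ j, Tendsto (bad j) atTop (𝓝 0) := fun j =>
    (tendsto_poissonPair_abs_div_sub_one (he0 j) (he2 j)).comp hw
  have hY : ∀ k (B : Set ℝ), MeasurableSet B → (poissonDiffProb (w k) : Measure ℝ) B =
      poissonPair (w k) {m | ((m.1 : ℝ) - m.2) / √(2 * w k) ∈ B} := fun k B hB =>
    Measure.map_apply .of_discrete hB
  have hYlim := tendsto_poissonDiffProb hw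
  refine tendsto_order.2 ⟨fun a ha => ?_, fun b hb => ?_⟩
  -- A Slutsky argument: when the first component divided by its mean is within `e j` of `1`, the
  -- shrunken open condition on the difference alone implies the joint condition.
  · set L : ℕ → Set ℝ := fun j => {z | s₀ + e j < |z| ∧ v * |z| < 1 - e j}
    have hLmono : Monotone L := fun i j hij z hz =>
      ⟨by linarith [hz.1, heanti hij], by linarith [hz.2, heanti hij]⟩
    have hLU : ⋃ j, L j = {z | s₀ < |z| ∧ v * |z| < 1} := by
      ext z
      simp only [mem_iUnion, mem_ofPred_eq, L]
      constructor
      · rintro ⟨j, h1, h2⟩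
        exact ⟨by linarith [he0 j], by linarith [he0 j]⟩
      · rintro ⟨h1, h2⟩
        have hm : 0 < min (|z| - s₀) (1 - v * |z|) := lt_min (by linarith) (by linarith)
        obtain ⟨j, hj⟩ := (helim.eventually (gt_mem_nhds hm)).exists
        rw [lt_min_iff] at hj
        exact ⟨j, by linarith [hj.1], by linarith [hj.2]⟩
    have hγL := tendsto_measure_iUnion_atTop (μ := γ) hLmono
    rw [hLU] at hγL
    obtain ⟨j, hj⟩ := (hγL.eventually (lt_mem_nhds ha)).exists
    obtain ⟨a', ha1, ha2⟩ := exists_between hj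
    have hopen : IsOpen (L j) :=
      (isOpen_lt continuous_const continuous_abs).inter
        (isOpen_lt (continuous_const.mul continuous_abs) continuous_const)
    have hlim := ha2.trans_le (ProbabilityMeasure.le_liminf_measure_open_of_tendsto hYlim hopen)
    have hpos : 0 < a' - a := tsub_pos_of_lt ha1
    filter_upwards [eventually_lt_of_lt_liminf hlim, (hbad j).eventually (gt_mem_nhds hpos),
      hs.eventually (gt_mem_nhds (show s₀ < s₀ + e j by linarith [he0 j]))] with k h1 h2 h3
    rw [hY k _ hopen.measurableSet] at h1
    have hsub : {m : ℕ × ℕ | ((m.1 : ℝ) - m.2) / √(2 * w k) ∈ L j} ⊆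
        {m | s k < |((m.1 : ℝ) - m.2) / √(2 * w k)| ∧
          v * |((m.1 : ℝ) - m.2) / √(2 * w k)| < m.1 / w k} ∪
        {m | e j ≤ |(m.1 : ℝ) / w k - 1|} := by
      rintro m ⟨h4, h5⟩
      by_cases h6 : e j ≤ |(m.1 : ℝ) / w k - 1|
      · exact Or.inr h6
      · left
        have := (abs_lt.1 (not_le.1 h6)).1
        exact ⟨by linarith, by linarith⟩
    have h7 := h1.trans_le ((measure_mono hsub).trans (measure_union_le _ _))
    have ha'' : a ≠ ∞ := ne_top_of_lt ha1
    have h8 : a + (a' - a) < poissonPair (w k) {m | s k < |((m.1 : ℝ) - m.2) / √(2 * w k)| ∧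
          v * |((m.1 : ℝ) - m.2) / √(2 * w k)| < m.1 / w k} + (a' - a) := by
      rw [add_tsub_cancel_of_le ha1.le]
      exact h7.trans_le (by gcongr)
    exact lt_of_add_lt_add_right h8
  -- Conversely, off the same bad event the joint condition implies the enlarged closed condition on
  -- the difference alone.
  · set U : ℕ → Set ℝ := fun j => {z | s₀ - e j ≤ |z| ∧ v * |z| ≤ 1 + e j}
    have hUanti : Antitone U := fun i j hij z hz =>
      ⟨by linarith [hz.1, heanti hij], by linarith [hz.2, heanti hij]⟩
    have hUI : ⋂ j, U j = {z | s₀ ≤ |z| ∧ v * |z| ≤ 1} := by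
      ext z
      simp only [mem_iInter, mem_ofPred_eq, U]
      constructor
      · intro h
        constructor
        · refine le_of_tendsto' (f := fun j => s₀ - e j) (x := atTop) ?_ fun j => (h j).1
          simpa using helim.const_sub s₀
        · refine ge_of_tendsto' (f := fun j => 1 + e j) (x := atTop) ?_ fun j => (h j).2
          simpa using helim.const_add 1
      · rintro ⟨h1, h2⟩ j
        exact ⟨by linarith [he0 j], by linarith [he0 j]⟩
    have hclosed : ∀ j, IsClosed (U j) := fun j =>
      (isClosed_le continuous_const continuous_abs).inter
        (isClosed_le (continuous_const.mul continuous_abs) continuous_const)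
    have hγU := tendsto_measure_iInter_atTop (μ := γ)
      (fun j => (hclosed j).measurableSet.nullMeasurableSet) hUanti ⟨0, measure_ne_top _ _⟩
    rw [hUI, gaussianReal_abs_sandwich] at hγU
    obtain ⟨j, hj⟩ := (hγU.eventually (gt_mem_nhds hb)).exists
    obtain ⟨b', hb1, hb2⟩ := exists_between hj
    have hlim := (ProbabilityMeasure.limsup_measure_closed_le_of_tendsto hYlim
      (hclosed j)).trans_lt hb1
    have hpos : 0 < b - b' := tsub_pos_of_lt hb2
    filter_upwards [eventually_lt_of_limsup_lt hlim, (hbad j).eventually (gt_mem_nhds hpos),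
      hs.eventually (lt_mem_nhds (show s₀ - e j < s₀ by linarith [he0 j]))] with k h1 h2 h3
    rw [hY k _ (hclosed j).measurableSet] at h1
    have hsub : {m : ℕ × ℕ | s k < |((m.1 : ℝ) - m.2) / √(2 * w k)| ∧
          v * |((m.1 : ℝ) - m.2) / √(2 * w k)| < m.1 / w k} ⊆
        {m : ℕ × ℕ | ((m.1 : ℝ) - m.2) / √(2 * w k) ∈ U j} ∪
        {m | e j ≤ |(m.1 : ℝ) / w k - 1|} := by
      rintro m ⟨h4, h5⟩
      by_cases h6 : e j ≤ |(m.1 : ℝ) / w k - 1|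
      · exact Or.inr h6
      · left
        have := (abs_lt.1 (not_le.1 h6)).2
        exact ⟨by linarith, by linarith⟩
    calc _ ≤ _ := (measure_mono hsub).trans (measure_union_le _ _)
      _ < b' + (b - b') := ENNReal.add_lt_add h1 h2
      _ = b := add_tsub_cancel_of_le hb2.le

/-- The pairs of degrees at distance more than `x` from the diagonal whose normalized inverse
distance exceeds `v`, when the common mean is `w`. -/
def degreeTail (v x w : ℝ) : Set (ℕ × ℕ) :=
  {m | √2 * x < |(m.1 : ℝ) - m.2| ∧ v < √2 * m.1 / √w / |(m.1 : ℝ) - m.2|}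

/-- The Gaussian counterpart of `degreeTail`. -/
def normalTail (v x w : ℝ) : Set ℝ := {z | x < √w * |z| ∧ v * |z| < 1}

lemma measurableSet_normalTail (v x w : ℝ) : MeasurableSet (normalTail v x w) :=
  (isOpen_lt continuous_const (continuous_const.mul continuous_abs)).measurableSet.inter
    (isOpen_lt (continuous_const.mul continuous_abs) continuous_const).measurableSet

lemma degreeTail_eq {v x : ℝ} {w : ℝ≥0} (hx : 0 ≤ x) (hw : 0 < w) :
    degreeTail v x w = {m | x / √w < |((m.1 : ℝ) - m.2) / √(2 * w)| ∧
      v * |((m.1 : ℝ) - m.2) / √(2 * w)| < m.1 / w} := by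
  have hw' : (0 : ℝ) < w := by exact_mod_cast hw
  have hsw : 0 < √(w : ℝ) := Real.sqrt_pos.2 hw'
  have h2 : (0 : ℝ) < √2 := by positivity
  have hww : √(w : ℝ) * √w = w := Real.mul_self_sqrt hw'.le
  have h22 : √2 * √2 = (2 : ℝ) := Real.mul_self_sqrt (by norm_num)
  ext m
  simp only [degreeTail, mem_ofPred_eq]
  set d := |(m.1 : ℝ) - m.2|
  rw [abs_div, abs_of_nonneg (Real.sqrt_nonneg _), Real.sqrt_mul (by norm_num)]
  have e1 : √2 * x < d ↔ x / √w < d / (√2 * √w) := by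
    rw [div_lt_div_iff₀ hsw (by positivity)]
    constructor <;> intro h <;> nlinarith
  rw [← e1]
  -- The first condition makes the difference non-zero, so the quotient in the second is not a
  -- division by zero and can be cleared.
  refine and_congr_right fun hd => ?_
  have hd0 : 0 < d := lt_of_le_of_lt (by positivity) hd
  rw [lt_div_iff₀ hd0, lt_div_iff₀ hsw, mul_div_assoc', div_lt_div_iff₀ (by positivity) hw']
  rw [show v * d * (w : ℝ) = v * d * √w * √w by rw [mul_assoc (v * d), hww],
    show (m.1 : ℝ) * (√2 * √w) = √2 * m.1 * √w by ring, mul_lt_mul_iff_left₀ hsw]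

lemma normalTail_eq {v x : ℝ} {w : ℝ≥0} (hw : 0 < w) :
    normalTail v x w = {z | x / √w < |z| ∧ v * |z| < 1} := by
  have hsw : 0 < √(w : ℝ) := Real.sqrt_pos.2 (by exact_mod_cast hw)
  ext z
  simp only [normalTail, mem_ofPred_eq]
  rw [div_lt_iff₀' hsw]

/-- Normal approximation of the degrees, uniformly over means that are at least of the order of
the squared distance. -/
lemma exists_abs_poissonPair_sub_gaussianReal_le (v : ℝ) {δ η : ℝ} (hδ : 0 < δ) (hη : 0 < η) :
    ∃ x₀ : ℝ, ∀ (x : ℝ) (w : ℝ≥0), x₀ ≤ x → δ * x ^ 2 ≤ w →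
      |(poissonPair w).real (degreeTail v x w) - (gaussianReal 0 1).real (normalTail v x w)| ≤ η := by
  -- Along a sequence of counterexamples `x / √w` stays in `[0, 1 / √δ]`. On a convergent
  -- subsequence both probabilities tend to the same Gaussian probability, contradicting the gap
  -- `η`.
  by_contra! hcon
  choose x w hx hwx hlt using fun n : ℕ => hcon (n + 1)
  have hx1 : ∀ n, 1 ≤ x n := fun n => by
    linarith [hx n, (Nat.cast_nonneg n : (0 : ℝ) ≤ n)]
  have hw0 : ∀ n, 0 < w n := fun n => by
    have : (0 : ℝ) < w n := lt_of_lt_of_le (by have := hx1 n; positivity) (hwx n)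
    exact_mod_cast this
  have hsmem : ∀ n, x n / √(w n) ∈ Icc 0 (1 / √δ) := by
    intro n
    have h0 : 0 ≤ x n := by linarith [hx1 n]
    refine ⟨by positivity, ?_⟩
    have h1 : √δ * x n ≤ √(w n) := by
      refine Real.le_sqrt_of_sq_le ?_
      rw [mul_pow, Real.sq_sqrt hδ.le]
      exact hwx n
    have h2 : 0 < √(w n : ℝ) := Real.sqrt_pos.2 (by exact_mod_cast hw0 n)
    rw [div_le_div_iff₀ h2 (by positivity)]
    linarith
  obtain ⟨s₀, -, φ, hφ, hlim⟩ := isCompact_Icc.tendsto_subseq hsmem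
  have hxt : Tendsto x atTop atTop := by
    refine tendsto_atTop_mono (f := fun n : ℕ => (n : ℝ)) (fun n => ?_) tendsto_natCast_atTop_atTop
    linarith [hx n]
  have hwt : Tendsto w atTop atTop := by
    rw [← NNReal.tendsto_coe_atTop]
    refine tendsto_atTop_mono hwx ?_
    exact ((tendsto_pow_atTop two_ne_zero).comp hxt).const_mul_atTop hδ
  have h1 := tendsto_poissonPair_joint (hwt.comp hφ.tendsto_atTop) hlim v
  have h2 : Tendsto (fun k => gaussianReal 0 1 {z | x (φ k) / √(w (φ k)) < |z| ∧ v * |z| < 1})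
      atTop (𝓝 (gaussianReal 0 1 {z | s₀ < |z| ∧ v * |z| < 1})) := by
    have : NullSingletonClass (gaussianReal 0 1) := nullSingletonClass_gaussianReal one_ne_zero
    have hm : ∀ a : ℝ, MeasurableSet {z : ℝ | a < |z| ∧ v * |z| < 1} := fun a =>
      (isOpen_lt continuous_const continuous_abs).measurableSet.inter
        (isOpen_lt (continuous_const.mul continuous_abs) continuous_const).measurableSet
    -- The indicators converge except where `|z| = s₀`, a Gaussian null set.
    refine tendsto_measure_of_ae_tendsto_indicator atTop (hm _) (fun k => hm _) MeasurableSet.univ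
      (measure_ne_top _ _) (Eventually.of_forall fun _ => subset_univ _) ?_
    have hnull : ∀ᵐ z ∂(gaussianReal 0 1), z ∉ ({s₀, -s₀} : Set ℝ) :=
      measure_eq_zero_iff_ae_notMem.1 ((Set.toFinite _).measure_zero _)
    filter_upwards [hnull] with z hz
    rcases lt_trichotomy s₀ |z| with h | h | h
    · filter_upwards [hlim.eventually (gt_mem_nhds h)] with k hk
      have hk' : x (φ k) / √(w (φ k)) < |z| := hk
      simp [h, hk']
    · exfalso
      apply hz
      rcases abs_cases z with h' | h'
      · have : z = s₀ := by linarith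
        simp [this]
      · have : z = -s₀ := by linarith
        simp [this]
    · filter_upwards [hlim.eventually (lt_mem_nhds h)] with k hk
      have hk' : |z| < x (φ k) / √(w (φ k)) := hk
      simp [h.not_gt, hk'.not_gt]
  have h3 := ((ENNReal.tendsto_toReal (measure_ne_top _ _)).comp h1).sub
    ((ENNReal.tendsto_toReal (measure_ne_top _ _)).comp h2)
  rw [sub_self] at h3
  have h4 := h3.abs
  rw [abs_zero] at h4
  obtain ⟨k, hk⟩ := (h4.eventually (gt_mem_nhds hη)).exists
  refine lt_irrefl _ ((hlt (φ k)).trans ?_)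
  rw [degreeTail_eq (by linarith [hx1 (φ k)]) (hw0 _), normalTail_eq (hw0 _)]
  exact hk

end JointLimit

/-! ### Truncated moments and Breiman's lemma -/

section Breiman

variable {Ω : Type*} [MeasurableSpace Ω] {P : Measure Ω} [IsProbabilityMeasure P]
  {X : Ω → ℝ} {α : ℝ}

/-- Extends Potter's bound below `z = 1`: there the probability is at most `1`, and the bound from
`1` to `y` already suffices after enlarging the constant. The truncated weight `max X 1` is the one
in the Poisson and Gaussian tail bounds. -/
lemma HasRegularlyVaryingTail.tail_max_potter (h : HasRegularlyVaryingTail P X α) {p : ℕ}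
    (hp : α < p) :
    ∃ C : ℝ, 0 < C ∧ ∀ z y, 0 < z → z ≤ y → 1 ≤ y →
      P.real {ω | z < max (X ω) 1} ≤ C * (y / z) ^ p * P.real {ω | y < X ω} := by
  obtain ⟨C, hC, hpot⟩ := h.tail_potter hp
  have hF1 := h.tail_pos 1
  refine ⟨max C (C / P.real {ω | 1 < X ω}), lt_max_of_lt_left hC, fun z y hz hzy hy => ?_⟩
  have hFy := h.tail_pos y
  have hy0 : 0 < y := by linarith
  rcases le_or_gt 1 z with h1 | h1
  · have : {ω | z < max (X ω) 1} = {ω | z < X ω} := by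
      ext ω
      simp [h1.not_gt]
    rw [this]
    calc _ ≤ _ := hpot z y h1 hzy
      _ ≤ _ := by gcongr; exact le_max_left _ _
  · calc P.real {ω | z < max (X ω) 1} ≤ 1 := measureReal_le_one
      _ = (1 / P.real {ω | 1 < X ω}) * P.real {ω | 1 < X ω} := by field_simp
      _ ≤ (1 / P.real {ω | 1 < X ω}) * (C * (y / 1) ^ p * P.real {ω | y < X ω}) := by
        gcongr
        exact hpot 1 y le_rfl hy
      _ = C / P.real {ω | 1 < X ω} * (y / 1) ^ p * P.real {ω | y < X ω} := by ring
      _ ≤ _ := by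
        gcongr
        exact le_max_right _ _

lemma ofReal_tail (P : Measure Ω) [IsProbabilityMeasure P] (X : Ω → ℝ) (y : ℝ) :
    P {ω | y < X ω} = ENNReal.ofReal (P.real {ω | y < X ω}) :=
  (ofReal_measureReal (measure_ne_top _ _)).symm

/-- A truncated moment is of the order of the tail. -/
lemma HasRegularlyVaryingTail.exists_lintegral_min_pow_le (h : HasRegularlyVaryingTail P X α)
    (hX : Measurable X) {p : ℕ} (hp : α < p) :
    ∃ C : ℝ, 0 < C ∧ ∀ y, 1 ≤ y →
      ∫⁻ ω, ENNReal.ofReal (min (max (X ω) 1 / y) 1 ^ (p + 1)) ∂P ≤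
        ENNReal.ofReal (C * P.real {ω | y < X ω}) := by
  obtain ⟨C, hC, hpot⟩ := h.tail_max_potter hp
  refine ⟨(p + 1) * C, by positivity, fun y hy => ?_⟩
  have hy0 : 0 < y := by linarith
  have hFy := h.tail_pos y
  have hnn : ∀ ω, 0 ≤ min (max (X ω) 1 / y) 1 := fun ω =>
    le_min (div_nonneg (zero_le_one.trans (le_max_right _ _)) hy0.le) zero_le_one
  -- In the layer-cake formula the exponent `p + 1` leaves the weight `t ^ p`, which exactly cancels
  -- the Potter factor `t ^ (-p)`. The integrand is then bounded by a constant on `(0, 1]` and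
  -- vanishes beyond.
  have hl := lintegral_rpow_eq_lintegral_meas_lt_mul P (f := fun ω => min (max (X ω) 1 / y) 1)
    (ae_of_all _ hnn) (by fun_prop) (p := (p + 1 : ℕ)) (by positivity)
  simp_rw [Real.rpow_natCast] at hl
  rw [hl]
  have hb : ∀ t ∈ Ioi (0 : ℝ), P {ω | t < min (max (X ω) 1 / y) 1} *
      ENNReal.ofReal (t ^ (((p + 1 : ℕ) : ℝ) - 1)) ≤
      (Ioc 0 1).indicator (fun _ => ENNReal.ofReal (C * P.real {ω | y < X ω})) t := by
    intro t ht
    have ht0 : 0 < t := ht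
    rcases le_or_gt t 1 with h1 | h1
    · rw [indicator_of_mem (show t ∈ Ioc 0 1 from ⟨ht0, h1⟩)]
      have h2 : P.real {ω | t < min (max (X ω) 1 / y) 1} ≤
          C * (y / (t * y)) ^ p * P.real {ω | y < X ω} := by
        refine le_trans (measureReal_mono fun ω hω => ?_)
          (hpot (t * y) y (by positivity) (by nlinarith) hy)
        have := (lt_min_iff.1 (show t < min (max (X ω) 1 / y) 1 from hω)).1
        rwa [lt_div_iff₀ hy0] at this
      rw [← ofReal_measureReal, ← ENNReal.ofReal_mul measureReal_nonneg]
      refine ENNReal.ofReal_le_ofReal ?_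
      have e : t ^ (((p + 1 : ℕ) : ℝ) - 1) = t ^ p := by
        rw [← Real.rpow_natCast]
        congr 1
        push_cast
        ring
      rw [e]
      calc _ ≤ C * (y / (t * y)) ^ p * P.real {ω | y < X ω} * t ^ p := by gcongr
        _ = C * P.real {ω | y < X ω} * ((y / (t * y)) * t) ^ p := by rw [mul_pow]; ring
        _ = _ := by
          have : y / (t * y) * t = 1 := by field_simp
          rw [this, one_pow, mul_one]
    · have : {ω | t < min (max (X ω) 1 / y) 1} = ∅ := by
        ext ω
        simp [h1.le]
      rw [this]
      simp
  refine (mul_le_mul_right (setLIntegral_mono' measurableSet_Ioi hb) _).trans ?_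
  rw [lintegral_indicator measurableSet_Ioc, Measure.restrict_restrict measurableSet_Ioc,
    inter_eq_left.2 Ioc_subset_Ioi_self, lintegral_const, Measure.restrict_apply_univ,
    Real.volume_Ioc, sub_zero, ENNReal.ofReal_one, mul_one, ← ENNReal.ofReal_mul (by positivity)]
  refine ENNReal.ofReal_le_ofReal (le_of_eq ?_)
  push_cast
  ring

lemma lintegral_pow_gaussianReal_lt_top (k : ℕ) :
    ∫⁻ z, ENNReal.ofReal (|z| ^ k) ∂(gaussianReal 0 1) < ∞ := by
  rcases Nat.eq_zero_or_pos k with rfl | hk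
  · simp
  have h := memLp_id_gaussianReal (μ := 0) (v := 1) (k : ℝ≥0)
  have h2 := lintegral_rpow_enorm_lt_top_of_eLpNorm_lt_top (by simpa using hk.ne') (by simp)
    h.eLpNorm_lt_top
  refine lt_of_eq_of_lt (lintegral_congr fun z => ?_) h2
  simp only [id, Real.enorm_eq_ofReal_abs]
  simp [ENNReal.ofReal_pow]

/-- Markov's inequality for the moment of order `2k`: on the tail, `1 ≤ (max w 1 / x²) * z²`. -/
lemma exists_gaussianReal_normalTail_le (k : ℕ) :
    ∃ C : ℝ, 0 < C ∧ ∀ v x w : ℝ, 0 < x → 0 ≤ w →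
      gaussianReal 0 1 (normalTail v x w) ≤ ENNReal.ofReal (C * (max w 1 / x ^ 2) ^ k) := by
  set m := ∫⁻ z, ENNReal.ofReal (|z| ^ (2 * k)) ∂(gaussianReal 0 1)
  have hm : m < ∞ := lintegral_pow_gaussianReal_lt_top (2 * k)
  refine ⟨m.toReal + 1, by positivity, fun v x w hx hw => ?_⟩
  have h1 : ∀ z ∈ normalTail v x w,
      1 ≤ ENNReal.ofReal ((max w 1 / x ^ 2) ^ k) * ENNReal.ofReal (|z| ^ (2 * k)) := by
    rintro z ⟨hz, -⟩
    rw [← ENNReal.ofReal_mul (by positivity), ENNReal.one_le_ofReal, pow_mul, ← mul_pow]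
    refine one_le_pow₀ ?_
    rw [div_mul_eq_mul_div, one_le_div (by positivity)]
    calc x ^ 2 ≤ (√w * |z|) ^ 2 := by gcongr
      _ = w * |z| ^ 2 := by rw [mul_pow, Real.sq_sqrt hw]
      _ ≤ max w 1 * |z| ^ 2 := by gcongr; exact le_max_left _ _
  calc gaussianReal 0 1 (normalTail v x w) = ∫⁻ _ in normalTail v x w, 1 ∂(gaussianReal 0 1) := by
        simp
    _ ≤ ∫⁻ z in normalTail v x w, ENNReal.ofReal ((max w 1 / x ^ 2) ^ k) *
          ENNReal.ofReal (|z| ^ (2 * k)) ∂(gaussianReal 0 1) :=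
        setLIntegral_mono' (measurableSet_normalTail v x w) h1
    _ ≤ ∫⁻ z, ENNReal.ofReal ((max w 1 / x ^ 2) ^ k) *
          ENNReal.ofReal (|z| ^ (2 * k)) ∂(gaussianReal 0 1) := setLIntegral_le_lintegral _ _
    _ = ENNReal.ofReal ((max w 1 / x ^ 2) ^ k) * m := by
        rw [lintegral_const_mul' _ _ ENNReal.ofReal_ne_top]
    _ ≤ ENNReal.ofReal ((max w 1 / x ^ 2) ^ k) * ENNReal.ofReal (m.toReal + 1) := by
        gcongr
        rw [← ENNReal.ofReal_toReal hm.ne]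
        refine ENNReal.ofReal_le_ofReal ?_
        rw [ENNReal.toReal_ofReal ENNReal.toReal_nonneg]
        linarith
    _ = _ := by
        rw [← ENNReal.ofReal_mul (by positivity)]
        congr 1
        ring

/-- The limiting constant of the joint tail. -/
noncomputable def tailConst (α v : ℝ) : ℝ≥0∞ :=
  ∫⁻ z, {z : ℝ | v * |z| < 1}.indicator (fun z => ENNReal.ofReal (|z| ^ (2 * α))) z
    ∂(gaussianReal 0 1)

/-- Breiman's lemma for a standard normal factor. -/
lemma HasRegularlyVaryingTail.tendsto_lintegral_normalTail (hα : 0 < α)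
    (h : HasRegularlyVaryingTail P X α) (hX : Measurable X) (v : ℝ) :
    Tendsto (fun x : ℝ => (∫⁻ ω, gaussianReal 0 1 (normalTail v x (X ω)) ∂P) /
      P {ω | x ^ 2 < X ω}) atTop (𝓝 (tailConst α v)) := by
  obtain ⟨p, hp⟩ := exists_nat_gt α
  obtain ⟨C, hC, hpot⟩ := h.tail_max_potter hp
  -- interchange of the integrals
  have hswap : ∀ x : ℝ, 0 < x → ∫⁻ ω, gaussianReal 0 1 (normalTail v x (X ω)) ∂P =
      ∫⁻ z, {z : ℝ | v * |z| < 1}.indicator (fun z => P {ω | x < √(X ω) * |z|}) z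
        ∂(gaussianReal 0 1) := by
    intro x hx
    set E : Set (Ω × ℝ) := {q | x < √(X q.1) * |q.2| ∧ v * |q.2| < 1}
    have hE : MeasurableSet E := by
      refine (measurableSet_lt (f := fun _ => x) (g := fun q : Ω × ℝ => √(X q.1) * |q.2|)
        measurable_const ?_).inter (measurableSet_lt (f := fun q : Ω × ℝ => v * |q.2|)
          (g := fun _ => 1) ?_ measurable_const)
      · exact ((hX.comp measurable_fst).sqrt).mul (measurable_snd.abs)
      · exact measurable_snd.abs.const_mul _
    have e1 := Measure.prod_apply (μ := P) (ν := gaussianReal 0 1) hE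
    have e2 := Measure.prod_apply_symm (μ := P) (ν := gaussianReal 0 1) hE
    refine (e1.symm.trans e2).trans (lintegral_congr fun z => ?_)
    by_cases hz : v * |z| < 1
    · rw [indicator_of_mem (show z ∈ {z : ℝ | v * |z| < 1} from hz)]
      congr 1
      ext ω
      simp [E, hz]
    · rw [indicator_of_notMem (show z ∉ {z : ℝ | v * |z| < 1} from hz)]
      convert measure_empty (μ := P)
      ext ω
      simp [E, hz]
  have hset : ∀ x z : ℝ, 0 < x → z ≠ 0 → {ω | x < √(X ω) * |z|} = {ω | x ^ 2 / z ^ 2 < X ω} := by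
    intro x z hx hz
    have hz' : 0 < |z| := abs_pos.2 hz
    ext ω
    simp only [mem_ofPred_eq]
    rw [← div_lt_iff₀ hz', Real.lt_sqrt (by positivity), div_pow, sq_abs]
  have hm : MeasurableSet {z : ℝ | v * |z| < 1} :=
    (isOpen_lt (continuous_const.mul continuous_abs) continuous_const).measurableSet
  have hne : ∀ y, P {ω | y < X ω} ≠ 0 := fun y => by
    rw [ofReal_tail]
    exact (ENNReal.ofReal_pos.2 (h.tail_pos y)).ne'
  -- For fixed `z ≠ 0` the ratio is `P(X > x² / z²) / P(X > x²)`, which tends to `|z| ^ (2α)`. The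
  -- dominating function `1 + C |z| ^ (2p)` comes from monotonicity when `|z| ≤ 1` and from Potter's
  -- bound otherwise; it has a finite Gaussian integral.
  have hlim : Tendsto (fun x : ℝ => ∫⁻ z, {z : ℝ | v * |z| < 1}.indicator
      (fun z => P {ω | x < √(X ω) * |z|} / P {ω | x ^ 2 < X ω}) z ∂(gaussianReal 0 1)) atTop
      (𝓝 (tailConst α v)) := by
    refine tendsto_lintegral_filter_of_dominated_convergence
      (fun z => ENNReal.ofReal (1 + C * |z| ^ (2 * p))) ?_ ?_ ?_ ?_
    · filter_upwards [eventually_gt_atTop 0] with x hx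
      refine Measurable.indicator ?_ hm
      have hEm : MeasurableSet {q : ℝ × Ω | x < √(X q.2) * |q.1|} :=
        measurableSet_lt measurable_const
          (((hX.comp measurable_snd).sqrt).mul (measurable_fst.abs))
      exact (measurable_measure_prodMk_left hEm).div_const _
    · filter_upwards [eventually_ge_atTop 1] with x hx
      refine ae_of_all _ fun z => ?_
      refine (indicator_le_self _ _ z).trans ?_
      have hx0 : 0 < x := by linarith
      have hFx := h.tail_pos (x ^ 2)
      rcases eq_or_ne z 0 with rfl | hz
      · have : {ω | x < √(X ω) * |(0 : ℝ)|} = ∅ := by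
          ext ω
          simp [hx0.le]
        rw [this]
        simp
      · rw [hset x z hx0 hz, ofReal_tail, ofReal_tail, ← ENNReal.ofReal_div_of_pos hFx]
        refine ENNReal.ofReal_le_ofReal ?_
        rw [div_le_iff₀ hFx]
        have hz2 : 0 < z ^ 2 := by positivity
        rcases le_or_gt (z ^ 2) 1 with h1 | h1
        · have : P.real {ω | x ^ 2 / z ^ 2 < X ω} ≤ P.real {ω | x ^ 2 < X ω} :=
            tail_antitone X (by rw [le_div_iff₀ hz2]; nlinarith [sq_nonneg x])
          have h3 : 0 ≤ C * |z| ^ (2 * p) * P.real {ω | x ^ 2 < X ω} := by positivity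
          linarith
        · have h2 := hpot (x ^ 2 / z ^ 2) (x ^ 2) (by positivity)
            (by rw [div_le_iff₀ hz2]; nlinarith [sq_nonneg x]) (by nlinarith)
          have h3 : P.real {ω | x ^ 2 / z ^ 2 < X ω} ≤
              P.real {ω | x ^ 2 / z ^ 2 < max (X ω) 1} :=
            measureReal_mono fun ω hω => lt_max_of_lt_left (mem_ofPred_eq ▸ hω)
          have h4 : x ^ 2 / (x ^ 2 / z ^ 2) = z ^ 2 := by field_simp
          rw [h4, ← pow_mul] at h2
          rw [pow_mul |z|, sq_abs, ← pow_mul]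
          linarith
    · have hsplit : ∀ z : ℝ, ENNReal.ofReal (1 + C * |z| ^ (2 * p)) =
          1 + ENNReal.ofReal C * ENNReal.ofReal (|z| ^ (2 * p)) := by
        intro z
        rw [ENNReal.ofReal_add zero_le_one (by positivity), ENNReal.ofReal_one,
          ENNReal.ofReal_mul hC.le]
      simp_rw [hsplit]
      rw [lintegral_add_left measurable_const, lintegral_const_mul' _ _ ENNReal.ofReal_ne_top]
      refine ENNReal.add_ne_top.2 ⟨by simp, ENNReal.mul_ne_top ENNReal.ofReal_ne_top
        (lintegral_pow_gaussianReal_lt_top (2 * p)).ne⟩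
    · refine ae_of_all _ fun z => ?_
      by_cases hz : z ∈ {z : ℝ | v * |z| < 1}
      · simp only [indicator_of_mem hz]
        rcases eq_or_ne z 0 with rfl | hz0
        · have h00 : (|(0 : ℝ)|) ^ (2 * α) = 0 := by
            rw [abs_zero, Real.zero_rpow (by positivity)]
          rw [h00, ENNReal.ofReal_zero]
          refine tendsto_const_nhds.congr' ?_
          filter_upwards [eventually_gt_atTop 0] with x hx
          have : {ω | x < √(X ω) * |(0 : ℝ)|} = ∅ := by
            ext ω
            simp [hx.le]
          rw [this]
          simp
        · have hl := (h.2.2 (1 / z ^ 2) (by positivity)).comp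
            (tendsto_pow_atTop (α := ℝ) two_ne_zero)
          have e : (1 / z ^ 2 : ℝ) ^ (-α) = |z| ^ (2 * α) := by
            rw [one_div, Real.inv_rpow (sq_nonneg z), Real.rpow_neg (sq_nonneg z), inv_inv,
              ← sq_abs, ← Real.rpow_natCast, ← Real.rpow_mul (abs_nonneg z)]
            norm_num
          rw [e] at hl
          refine (ENNReal.tendsto_ofReal hl).congr' ?_
          filter_upwards [eventually_gt_atTop 0] with x hx
          simp only [Function.comp_apply]
          rw [hset x z hx hz0, ofReal_tail P X (x ^ 2 / z ^ 2), ofReal_tail P X (x ^ 2),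
            ENNReal.ofReal_div_of_pos (h.tail_pos _), one_div_mul_eq_div]
      · simp only [indicator_of_notMem hz]
        exact tendsto_const_nhds
  refine hlim.congr' ?_
  filter_upwards [eventually_gt_atTop 0] with x hx
  rw [hswap x hx, div_eq_mul_inv, ← lintegral_mul_const' _ _ (ENNReal.inv_ne_top.2 (hne _))]
  refine lintegral_congr fun z => ?_
  by_cases hz : z ∈ {z : ℝ | v * |z| < 1}
  · simp only [indicator_of_mem hz, div_eq_mul_inv]
  · simp only [indicator_of_notMem hz, zero_mul]

lemma tailConst_ne_top (α v : ℝ) (hα : 0 < α) : tailConst α v ≠ ∞ := by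
  obtain ⟨k, hk⟩ := exists_nat_gt (2 * α)
  refine ne_top_of_le_ne_top (b := 1 + ∫⁻ z, ENNReal.ofReal (|z| ^ k) ∂(gaussianReal 0 1))
    (ENNReal.add_ne_top.2 ⟨ENNReal.one_ne_top, (lintegral_pow_gaussianReal_lt_top k).ne⟩) ?_
  have : (1 : ℝ≥0∞) = ∫⁻ _, 1 ∂(gaussianReal 0 1) := by simp
  rw [this, ← lintegral_add_left measurable_const]
  refine lintegral_mono fun z => (indicator_le_self _ _ z).trans ?_
  rcases le_or_gt |z| 1 with h1 | h1
  · refine le_add_right ?_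
    rw [ENNReal.ofReal_le_one]
    exact Real.rpow_le_one (abs_nonneg z) h1 (by positivity)
  · refine le_add_left (ENNReal.ofReal_le_ofReal ?_)
    rw [← Real.rpow_natCast]
    exact Real.rpow_le_rpow_of_exponent_le h1.le hk.le

end Breiman

/-! ### Transfer from the normal to the Poisson tail -/

section Comparison

variable {Ω : Type*} [MeasurableSpace Ω] {P : Measure Ω} [IsProbabilityMeasure P]
  {X : Ω → ℝ} {α : ℝ}

/-- Pointwise comparison of the Poisson and the normal tail. -/
lemma exists_degreeTail_normalTail_comparison (v : ℝ) (p : ℕ) :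
    ∃ C : ℝ, 0 < C ∧ ∀ δ η : ℝ, 0 < δ → δ ≤ 1 → 0 < η → ∃ x₀ : ℝ, ∀ x w : ℝ, x₀ ≤ x → 0 ≤ w →
      poissonPair w.toNNReal (degreeTail v x w) ≤ gaussianReal 0 1 (normalTail v x w) +
        ((Ici (δ * x ^ 2)).indicator (fun _ => ENNReal.ofReal η) w +
          ENNReal.ofReal (C * δ * min (max w 1 / x ^ 2) 1 ^ (p + 1))) ∧
      gaussianReal 0 1 (normalTail v x w) ≤ poissonPair w.toNNReal (degreeTail v x w) +
        ((Ici (δ * x ^ 2)).indicator (fun _ => ENNReal.ofReal η) w +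
          ENNReal.ofReal (C * δ * min (max w 1 / x ^ 2) 1 ^ (p + 1))) := by
  -- The power `p + 2` is one more than the moment estimate consumes; for means below `δ x²` the
  -- spare factor `max w 1 / x²` is at most `δ`.
  obtain ⟨C₁, hC₁, hb₁⟩ := exists_poissonPair_abs_sub_le (p + 2)
  obtain ⟨C₂, hC₂, hb₂⟩ := exists_gaussianReal_normalTail_le (p + 2)
  refine ⟨max C₁ C₂, lt_max_of_lt_left hC₁, fun δ η hδ hδ1 hη => ?_⟩
  obtain ⟨x₁, hx₁⟩ := exists_abs_poissonPair_sub_gaussianReal_le v hδ hη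
  -- With `x ≥ 1 / δ` and `δ ≤ 1` one has `1 ≤ δ x²`, so the maximum with `1` does not spoil `max w
  -- 1 ≤ δ x²`.
  refine ⟨max x₁ (1 / δ), fun x w hx hw => ?_⟩
  have hxx₁ : x₁ ≤ x := (le_max_left _ _).trans hx
  have hxδ : 1 / δ ≤ x := (le_max_right _ _).trans hx
  have hx0 : 0 < x := lt_of_lt_of_le (by positivity) hxδ
  have hcoe : ((w.toNNReal : ℝ≥0) : ℝ) = w := Real.coe_toNNReal w hw
  by_cases hwδ : δ * x ^ 2 ≤ w
  · have h := hx₁ x w.toNNReal hxx₁ (by rwa [hcoe])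
    rw [hcoe, abs_le] at h
    have hg : poissonPair w.toNNReal (degreeTail v x w) =
        ENNReal.ofReal ((poissonPair w.toNNReal).real (degreeTail v x w)) :=
      (ofReal_measureReal (measure_ne_top _ _)).symm
    have hh : gaussianReal 0 1 (normalTail v x w) =
        ENNReal.ofReal ((gaussianReal 0 1).real (normalTail v x w)) :=
      (ofReal_measureReal (measure_ne_top _ _)).symm
    rw [indicator_of_mem (show w ∈ Ici (δ * x ^ 2) from hwδ), hg, hh, ← add_assoc, ← add_assoc,
      ← ENNReal.ofReal_add measureReal_nonneg hη.le, ← ENNReal.ofReal_add measureReal_nonneg hη.le]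
    exact ⟨le_add_right (ENNReal.ofReal_le_ofReal (by linarith)),
      le_add_right (ENNReal.ofReal_le_ofReal (by linarith))⟩
  · push Not at hwδ
    set r := max w 1 / x ^ 2 with hr
    have hr0 : 0 ≤ r := by positivity
    have hrδ : r ≤ δ := by
      rw [hr, div_le_iff₀ (by positivity)]
      refine max_le hwδ.le ?_
      rw [div_le_iff₀ hδ] at hxδ
      have hx1 : 1 ≤ x := by nlinarith
      nlinarith
    have hmin : min r 1 = r := min_eq_left (hrδ.trans hδ1)
    have hpow : r ^ (p + 2) ≤ δ * r ^ (p + 1) := by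
      rw [pow_succ, mul_comm]
      gcongr
    rw [indicator_of_notMem (show w ∉ Ici (δ * x ^ 2) from not_le.2 hwδ), zero_add, hmin]
    have hm := le_max_left C₁ C₂
    have hm' := le_max_right C₁ C₂
    constructor
    · refine le_add_left (le_trans ?_ ((hb₁ x w.toNNReal hx0).trans (ENNReal.ofReal_le_ofReal ?_)))
      · exact measure_mono fun m hm => hm.1
      · rw [hcoe, mul_assoc]
        gcongr
    · refine le_add_left ((hb₂ v x w hx0 hw).trans (ENNReal.ofReal_le_ofReal ?_))
      rw [mul_assoc]
      gcongr

/-- The joint tail of a pair of Poisson variables with a common regularly varying random mean. -/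
theorem HasRegularlyVaryingTail.tendsto_lintegral_degreeTail (hα : 0 < α)
    (h : HasRegularlyVaryingTail P X α) (hX : Measurable X) (h0 : ∀ ω, 0 ≤ X ω) (v : ℝ) :
    Tendsto (fun x : ℝ => (∫⁻ ω, poissonPair (X ω).toNNReal (degreeTail v x (X ω)) ∂P) /
      P {ω | x ^ 2 < X ω}) atTop (𝓝 (tailConst α v)) := by
  obtain ⟨p, hp⟩ := exists_nat_gt α
  obtain ⟨C₁, hC₁, hcomp⟩ := exists_degreeTail_normalTail_comparison v p
  obtain ⟨C₂, hC₂, hmom⟩ := h.exists_lintegral_min_pow_le hX hp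
  obtain ⟨C₃, hC₃, hpot⟩ := h.tail_potter hp
  have hne : ∀ y, P {ω | y < X ω} ≠ 0 := fun y => by
    rw [ofReal_tail]
    exact (ENNReal.ofReal_pos.2 (h.tail_pos y)).ne'
  set K := C₃ + C₁ * C₂
  have hK : 0 < K := by positivity
  -- the error is a small multiple of the tail
  have herr : ∀ δ : ℝ, 0 < δ → δ ≤ 1 → ∀ᶠ x : ℝ in atTop,
      (∫⁻ ω, poissonPair (X ω).toNNReal (degreeTail v x (X ω)) ∂P) / P {ω | x ^ 2 < X ω} ≤
        (∫⁻ ω, gaussianReal 0 1 (normalTail v x (X ω)) ∂P) / P {ω | x ^ 2 < X ω} +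
          ENNReal.ofReal (δ * K) ∧
      (∫⁻ ω, gaussianReal 0 1 (normalTail v x (X ω)) ∂P) / P {ω | x ^ 2 < X ω} ≤
        (∫⁻ ω, poissonPair (X ω).toNNReal (degreeTail v x (X ω)) ∂P) / P {ω | x ^ 2 < X ω} +
          ENNReal.ofReal (δ * K) := by
    intro δ hδ hδ1
    -- Chosen to absorb the Potter factor `(2 / δ) ^ p` paid in bounding `P(X > δ x² / 2)` by `P(X >
    -- x²)`, with a factor `δ` to spare. Halving `δ` turns the non-strict inequality on the weight
    -- into a strict one.
    set η := δ * (δ / 2) ^ p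
    have hη : 0 < η := by positivity
    obtain ⟨x₀, hx₀⟩ := hcomp δ η hδ hδ1 hη
    -- The bound `x ≥ 2 / δ`, with `x ≥ 1`, puts `δ / 2 * x²` above `1`, where Potter's bound
    -- applies.
    filter_upwards [eventually_ge_atTop x₀, eventually_ge_atTop (2 / δ), eventually_ge_atTop 1]
      with x h1 h2 h3
    have hx0 : 0 < x := by linarith
    have hF := h.tail_pos (x ^ 2)
    have hx2 : 1 ≤ x ^ 2 := one_le_pow₀ h3
    set err : Ω → ℝ≥0∞ := fun ω => (Ici (δ * x ^ 2)).indicator (fun _ => ENNReal.ofReal η) (X ω) +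
      ENNReal.ofReal (C₁ * δ * min (max (X ω) 1 / x ^ 2) 1 ^ (p + 1))
    have hm1 : Measurable fun ω => (Ici (δ * x ^ 2)).indicator (fun _ => ENNReal.ofReal η) (X ω) :=
      (measurable_const.indicator measurableSet_Ici).comp hX
    have herrm : Measurable err := hm1.add (by fun_prop)
    have hint : ∫⁻ ω, err ω ∂P ≤ ENNReal.ofReal (δ * K * P.real {ω | x ^ 2 < X ω}) := by
      rw [lintegral_add_left hm1]
      have hi1 : ∫⁻ ω, (Ici (δ * x ^ 2)).indicator (fun _ => ENNReal.ofReal η) (X ω) ∂P ≤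
          ENNReal.ofReal (δ * C₃ * P.real {ω | x ^ 2 < X ω}) := by
        have e : ∀ ω, (Ici (δ * x ^ 2)).indicator (fun _ => ENNReal.ofReal η) (X ω) =
            (X ⁻¹' Ici (δ * x ^ 2)).indicator (fun _ => ENNReal.ofReal η) ω := fun ω => rfl
        simp_rw [e]
        rw [lintegral_indicator_const (hX measurableSet_Ici),
          ← ofReal_measureReal (measure_ne_top P _), ← ENNReal.ofReal_mul hη.le]
        refine ENNReal.ofReal_le_ofReal ?_
        have hsub : P.real (X ⁻¹' Ici (δ * x ^ 2)) ≤ P.real {ω | δ / 2 * x ^ 2 < X ω} := by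
          refine measureReal_mono fun ω hω => ?_
          have hω' : δ * x ^ 2 ≤ X ω := hω
          show δ / 2 * x ^ 2 < X ω
          have : 0 < δ * x ^ 2 := by positivity
          linarith
        have hz1 : 1 ≤ δ / 2 * x ^ 2 := by
          rw [div_le_iff₀ hδ] at h2
          nlinarith
        have hpt := hpot (δ / 2 * x ^ 2) (x ^ 2) hz1 (by nlinarith)
        calc η * P.real (X ⁻¹' Ici (δ * x ^ 2))
            ≤ η * (C₃ * (x ^ 2 / (δ / 2 * x ^ 2)) ^ p * P.real {ω | x ^ 2 < X ω}) := by
              gcongr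
              exact hsub.trans hpt
          _ = δ * C₃ * P.real {ω | x ^ 2 < X ω} *
              ((δ / 2) * (x ^ 2 / (δ / 2 * x ^ 2))) ^ p := by
              rw [mul_pow]
              simp only [η]
              ring
          _ = _ := by
              have : (δ / 2) * (x ^ 2 / (δ / 2 * x ^ 2)) = 1 := by field_simp
              rw [this, one_pow, mul_one]
      have hi2 : ∫⁻ ω, ENNReal.ofReal (C₁ * δ * min (max (X ω) 1 / x ^ 2) 1 ^ (p + 1)) ∂P ≤
          ENNReal.ofReal (δ * (C₁ * C₂) * P.real {ω | x ^ 2 < X ω}) := by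
        simp_rw [ENNReal.ofReal_mul (show 0 ≤ C₁ * δ by positivity)]
        rw [lintegral_const_mul' _ _ ENNReal.ofReal_ne_top]
        refine (mul_le_mul_right (hmom _ hx2) _).trans ?_
        rw [← ENNReal.ofReal_mul (by positivity)]
        exact ENNReal.ofReal_le_ofReal (le_of_eq (by ring))
      refine (add_le_add hi1 hi2).trans ?_
      rw [← ENNReal.ofReal_add (by positivity) (by positivity)]
      exact ENNReal.ofReal_le_ofReal (le_of_eq (by simp only [K]; ring))
    have hdiv : ∀ a b : ℝ≥0∞, a ≤ b + ∫⁻ ω, err ω ∂P →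
        a / P {ω | x ^ 2 < X ω} ≤ b / P {ω | x ^ 2 < X ω} + ENNReal.ofReal (δ * K) := by
      intro a b hab
      refine (ENNReal.div_le_div_right (hab.trans (add_le_add_right hint b)) _).trans ?_
      rw [ENNReal.add_div]
      gcongr
      rw [ofReal_tail, ← ENNReal.ofReal_div_of_pos hF, mul_div_cancel_right₀ _ hF.ne']
    constructor
    · apply hdiv
      rw [← lintegral_add_right _ herrm]
      exact lintegral_mono fun ω => (hx₀ x (X ω) h1 (h0 ω)).1
    · apply hdiv
      rw [← lintegral_add_right _ herrm]
      exact lintegral_mono fun ω => (hx₀ x (X ω) h1 (h0 ω)).2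
  have hL := tailConst_ne_top α v hα
  have hH := h.tendsto_lintegral_normalTail hα hX v
  rw [ENNReal.tendsto_nhds hL] at hH ⊢
  intro ε hε
  rcases eq_or_ne ε ∞ with rfl | hεt
  · refine Eventually.of_forall fun x => ⟨by simp, by simp⟩
  have hε' : 0 < ε.toReal := ENNReal.toReal_pos hε.ne' hεt
  set δ := min 1 (ε.toReal / (2 * K))
  have hδ : 0 < δ := lt_min one_pos (by positivity)
  have hδK : ENNReal.ofReal (δ * K) ≤ ε / 2 := by
    rw [← ENNReal.ofReal_toReal hεt, show (2 : ℝ≥0∞) = ENNReal.ofReal 2 by simp,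
      ← ENNReal.ofReal_div_of_pos two_pos]
    refine ENNReal.ofReal_le_ofReal ?_
    have : δ ≤ ε.toReal / (2 * K) := min_le_right _ _
    calc δ * K ≤ ε.toReal / (2 * K) * K := by gcongr
      _ = ε.toReal / 2 := by field_simp
  have hε2 : ε / 2 > 0 := ENNReal.half_pos hε.ne'
  filter_upwards [hH (ε / 2) hε2, herr δ hδ (min_le_left _ _)] with x h1 h2
  constructor
  · rw [tsub_le_iff_right]
    calc tailConst α v ≤ (∫⁻ ω, gaussianReal 0 1 (normalTail v x (X ω)) ∂P) /
          P {ω | x ^ 2 < X ω} + ε / 2 := tsub_le_iff_right.1 h1.1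
      _ ≤ _ + ε / 2 + ε / 2 := by gcongr; exact h2.2.trans (by gcongr)
      _ = _ := by rw [add_assoc, ENNReal.add_halves]
  · calc _ ≤ _ := h2.1
      _ ≤ (tailConst α v + ε / 2) + ε / 2 := add_le_add h1.2 hδK
      _ = _ := by rw [add_assoc, ENNReal.add_halves]

end Comparison

/-! ### The limiting constant -/

section Constant

/-- The integrand, written with the Gaussian density, is even. -/
lemma tailConst_eq_two_mul_lintegral (α v : ℝ) :
    tailConst α v = 2 * ∫⁻ z in {z : ℝ | 0 < z ∧ v * z < 1},
      ENNReal.ofReal (z ^ (2 * α) * gaussianPDFReal 0 1 z) := by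
  have hm : MeasurableSet {z : ℝ | v * |z| < 1} :=
    (isOpen_lt (continuous_const.mul continuous_abs) continuous_const).measurableSet
  set f : ℝ → ℝ≥0∞ := {z : ℝ | v * |z| < 1}.indicator
    (fun z => ENNReal.ofReal (|z| ^ (2 * α) * gaussianPDFReal 0 1 z)) with hf
  have h1 : tailConst α v = ∫⁻ z, f z := by
    rw [tailConst, gaussianReal_of_var_ne_zero _ one_ne_zero,
      lintegral_withDensity_eq_lintegral_mul _ (measurable_gaussianPDF 0 1)
        ((by fun_prop : Measurable fun z : ℝ => ENNReal.ofReal (|z| ^ (2 * α))).indicator hm)]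
    refine lintegral_congr fun z => ?_
    by_cases hz : z ∈ {z : ℝ | v * |z| < 1}
    · simp only [hf, Pi.mul_apply, indicator_of_mem hz, gaussianPDF]
      rw [← ENNReal.ofReal_mul (gaussianPDFReal_nonneg _ _ _), mul_comm]
    · simp only [hf, Pi.mul_apply, indicator_of_notMem hz, mul_zero]
  have heven : ∀ z, f (-z) = f z := by
    intro z
    have hz : (-z ∈ {z : ℝ | v * |z| < 1}) ↔ z ∈ {z : ℝ | v * |z| < 1} := by simp
    by_cases h : z ∈ {z : ℝ | v * |z| < 1}
    · simp only [hf, indicator_of_mem h, indicator_of_mem (hz.2 h), abs_neg]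
      simp [gaussianPDFReal]
    · simp only [hf, indicator_of_notMem h, indicator_of_notMem (mt hz.1 h)]
  have h2 : ∫⁻ z in Iio 0, f z = ∫⁻ z in Ioi 0, f z := by
    have := (Measure.measurePreserving_neg (volume : Measure ℝ)).setLIntegral_comp_preimage_emb
      (Homeomorph.neg ℝ).measurableEmbedding f (Iio 0)
    rw [← this]
    simp [heven]
  have h3 : ∫⁻ z, f z = 2 * ∫⁻ z in Ioi 0, f z := by
    rw [← lintegral_add_compl f (measurableSet_Ioi (a := (0 : ℝ))), compl_Ioi,
      setLIntegral_congr Iio_ae_eq_Iic.symm, h2, two_mul]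
  rw [h1, h3, hf, lintegral_indicator hm, Measure.restrict_restrict hm]
  congr 1
  have hset : {z : ℝ | v * |z| < 1} ∩ Ioi 0 = {z : ℝ | 0 < z ∧ v * z < 1} := by
    ext z
    simp only [mem_inter_iff, mem_ofPred_eq, mem_Ioi]
    constructor
    · rintro ⟨h, h'⟩
      rw [abs_of_pos h'] at h
      exact ⟨h', h⟩
    · rintro ⟨h', h⟩
      rw [abs_of_pos h']
      exact ⟨h, h'⟩
  rw [hset]
  have hms : MeasurableSet {z : ℝ | 0 < z ∧ v * z < 1} := by
    rw [← hset]
    exact hm.inter measurableSet_Ioi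
  refine setLIntegral_congr_fun hms fun z hz => ?_
  rw [abs_of_pos hz.1]

lemma tailConst_eq (α : ℝ) {v : ℝ} (hv : 0 ≤ v) : tailConst α v = 2 * gaussianMoment α v := by
  rw [tailConst_eq_two_mul_lintegral, gaussianMoment]
  congr 1
  rcases hv.eq_or_lt with rfl | hv
  · simp [Ioi]
  · rw [if_neg hv.ne']
    have : {z : ℝ | 0 < z ∧ v * z < 1} = Ioo 0 (1 / v) := by
      ext z
      simp only [mem_ofPred_eq, mem_Ioo]
      rw [lt_div_iff₀' hv]
    rw [this]
    exact setLIntegral_congr Ioo_ae_eq_Ioc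

/-- Positivity makes the limit infinite at `u = 0` and gives the distance from the diagonal a tail
of exactly the order of that of `√W`. -/
lemma tailConst_pos (α v : ℝ) : 0 < tailConst α v := by
  rw [tailConst_eq_two_mul_lintegral]
  refine ENNReal.mul_pos two_ne_zero ?_
  set r := 1 / (|v| + 1)
  have hr : 0 < r := by positivity
  have hsub : Ioo 0 r ⊆ {z : ℝ | 0 < z ∧ v * z < 1} := by
    rintro z ⟨h1, h2⟩
    refine ⟨h1, ?_⟩
    rw [lt_div_iff₀ (by positivity)] at h2
    nlinarith [le_abs_self v]
  refine ne_of_gt (lt_of_lt_of_le ?_ (lintegral_mono_set hsub))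
  refine setLIntegral_pos_iff (by fun_prop) |>.2 ?_
  have : Ioo 0 r ⊆ Function.support
      (fun z : ℝ => ENNReal.ofReal (z ^ (2 * α) * gaussianPDFReal 0 1 z)) ∩ Ioo 0 r := by
    intro z hz
    refine ⟨?_, hz⟩
    have h1 := Real.rpow_pos_of_pos hz.1 (2 * α)
    have h2 := gaussianPDFReal_pos 0 1 z one_ne_zero
    exact (ENNReal.ofReal_pos.2 (mul_pos h1 h2)).ne'
  refine lt_of_lt_of_le ?_ (measure_mono this)
  simpa using hr

end Constant

/-! ### Joint tail of the degrees and distance from the diagonal -/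

section MixedPair

variable {Ω : Type*} [MeasurableSpace Ω] {P : Measure Ω}
  {V : Ω → Fin 2 → ℝ} {D : Ω → Fin 2 → ℕ} {α : ℝ}

lemma poissonPair_singleton (w : ℝ≥0) (m : ℕ × ℕ) :
    poissonPair w {m} = poissonMeasure w {m.1} * poissonMeasure w {m.2} := by
  rw [poissonPair, ← Measure.prod_prod, singleton_prod_singleton]

/-- Probabilities of events in terms of the conditional law given a common random mean. -/
lemma IsMixedPoisson.measure_pair (hD : IsMixedPoisson P V (fun w => w) D) (hV : Measurable V)
    (hV1 : ∀ ω, V ω 1 = V ω 0) {E : ℝ → Set (ℕ × ℕ)} (hE : ∀ m, MeasurableSet {w | m ∈ E w}) :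
    P {ω | (D ω 0, D ω 1) ∈ E (V ω 0)} =
      ∫⁻ ω, poissonPair (V ω 0).toNNReal (E (V ω 0)) ∂P := by
  have hDm : ∀ l, Measurable fun ω => D ω l := fun l => (measurable_pi_apply l).comp hD.1
  refine measure_mem_eq_lintegral (S := Fin 2 → ℝ) (X := V) (D := fun ω => (D ω 0, D ω 1))
    (κ := fun s => poissonPair (s 0).toNNReal) (E := fun s => E (s 0)) hV
    ((hDm 0).prodMk (hDm 1)) (fun m => ?_) (fun B hB m => ?_)
    fun m => (measurable_pi_apply (X := fun _ : Fin 2 => ℝ) 0) (hE m)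
  · simp_rw [poissonPair_singleton]
    exact ((measurable_poissonMeasure_toNNReal_singleton _).comp (measurable_pi_apply 0)).mul
      ((measurable_poissonMeasure_toNNReal_singleton _).comp (measurable_pi_apply 0))
  · have h := hD.2 B hB ![m.1, m.2]
    have e : ∀ ω, D ω = ![m.1, m.2] ↔ (D ω 0, D ω 1) = m := by
      intro ω
      rw [funext_iff, Prod.ext_iff]
      simp [Fin.forall_fin_two]
    simp_rw [e] at h
    refine h.trans (lintegral_congr fun ω => ?_)
    rw [Fin.prod_univ_two, poissonPair_singleton, hV1]
    rfl

variable [IsProbabilityMeasure P]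

lemma measurableSet_mem_degreeTail (v x : ℝ) (m : ℕ × ℕ) :
    MeasurableSet {w | m ∈ degreeTail v x w} :=
  (MeasurableSet.const (√2 * x < |(m.1 : ℝ) - m.2|)).inter (measurableSet_lt
    (g := fun w : ℝ => √2 * m.1 / √w / |(m.1 : ℝ) - m.2|) measurable_const (by fun_prop))

/-- The joint tail of the degrees, relative to the tail of the weight. -/
lemma IsMixedPoisson.tendsto_degreeTail (hD : IsMixedPoisson P V (fun w => w) D) (hα : 0 < α)
    (hV : Measurable V) (hV1 : ∀ ω, V ω 1 = V ω 0) (h0 : ∀ ω, 0 ≤ V ω 0)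
    (h : HasRegularlyVaryingTail P (fun ω => V ω 0) α) (v : ℝ) :
    Tendsto (fun x : ℝ => P {ω | (D ω 0, D ω 1) ∈ degreeTail v x (V ω 0)} /
      P {ω | x < √(V ω 0)}) atTop (𝓝 (tailConst α v)) := by
  refine (h.tendsto_lintegral_degreeTail hα ((measurable_pi_apply 0).comp hV) h0 v).congr' ?_
  filter_upwards [eventually_ge_atTop 0] with x hx
  rw [hD.measure_pair hV hV1 (measurableSet_mem_degreeTail v x)]
  congr 2
  ext ω
  exact (Real.lt_sqrt hx).symm

/-- The product of two limits at `x = u * b₀ t`, where `b₀` is the quantile of `√W`: `t P(√W > x) →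
u ^ (-2α)`, and the joint tail relative to `P(√W > x)`. -/
lemma IsMixedPoisson.tendsto_joint_of_pos (hD : IsMixedPoisson P V (fun w => w) D) (hα : 0 < α)
    (hV : Measurable V) (hV1 : ∀ ω, V ω 1 = V ω 0) (h0 : ∀ ω, 0 ≤ V ω 0)
    (h : HasRegularlyVaryingTail P (fun ω => V ω 0) α) {u : ℝ} (hu : 0 < u) (v : ℝ) :
    Tendsto (fun t : ℝ => ENNReal.ofReal t * P {ω | (D ω 0, D ω 1) ∈
      degreeTail v (u * quantile P (fun ω => √(V ω 0)) (1 - 1 / t)) (V ω 0)}) atTop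
      (𝓝 (ENNReal.ofReal u ^ (-(2 * α)) * tailConst α v)) := by
  have hX : Measurable fun ω => √(V ω 0) := ((measurable_pi_apply 0).comp hV).sqrt
  have hX0 : ∀ ω, 0 ≤ √(V ω 0) := fun ω => Real.sqrt_nonneg _
  have hq := h.sqrt.tendsto_quantile hX hX0
  have h1 := (hD.tendsto_degreeTail hα hV hV1 h0 h v).comp (hq.const_mul_atTop hu)
  have h2 := ENNReal.tendsto_ofReal (h.sqrt.tendsto_mul_tail_mul_quantile hX hX0 hu)
  rw [← ENNReal.ofReal_rpow_of_pos hu] at h2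
  have hu' : ENNReal.ofReal u ^ (-(2 * α)) ≠ ∞ := by
    rw [ENNReal.ofReal_rpow_of_pos hu]
    exact ENNReal.ofReal_ne_top
  have h3 := ENNReal.Tendsto.mul h2 (Or.inr (tailConst_ne_top α v hα)) h1 (Or.inr hu')
  refine h3.congr' ?_
  filter_upwards [eventually_gt_atTop 0] with t ht
  simp only [Function.comp_apply]
  have hp := h.sqrt.tail_pos (u * quantile P (fun ω => √(V ω 0)) (1 - 1 / t))
  rw [ENNReal.ofReal_mul ht.le, ← ofReal_tail, mul_assoc, ENNReal.mul_div_cancel]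
  · rw [ofReal_tail P (fun ω => √(V ω 0))]
    exact (ENNReal.ofReal_pos.2 hp).ne'
  · exact measure_ne_top _ _

/-- The joint tail at level `u ≥ 0`, with an infinite limit for `u = 0`. -/
lemma IsMixedPoisson.tendsto_joint (hD : IsMixedPoisson P V (fun w => w) D) (hα : 0 < α)
    (hV : Measurable V) (hV1 : ∀ ω, V ω 1 = V ω 0) (h0 : ∀ ω, 0 ≤ V ω 0)
    (h : HasRegularlyVaryingTail P (fun ω => V ω 0) α) {u : ℝ} (hu : 0 ≤ u) (v : ℝ) :
    Tendsto (fun t : ℝ => ENNReal.ofReal t * P {ω | (D ω 0, D ω 1) ∈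
      degreeTail v (u * quantile P (fun ω => √(V ω 0)) (1 - 1 / t)) (V ω 0)}) atTop
      (𝓝 (ENNReal.ofReal u ^ (-(2 * α)) * tailConst α v)) := by
  rcases hu.lt_or_eq with hu | rfl
  · exact hD.tendsto_joint_of_pos hα hV hV1 h0 h hu v
  have hc0 := tailConst_pos α v
  have hct := tailConst_ne_top α v hα
  rw [ENNReal.ofReal_zero, ENNReal.zero_rpow_of_neg (by linarith), ENNReal.top_mul hc0.ne',
    ENNReal.tendsto_nhds_top_iff_nnreal]
  intro M
  have hq := h.sqrt.tendsto_quantile ((measurable_pi_apply 0).comp hV).sqrt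
    fun ω => Real.sqrt_nonneg (V ω 0)
  have hMt : (M : ℝ≥0∞) / tailConst α v ≠ ∞ := ENNReal.div_ne_top ENNReal.coe_ne_top hc0.ne'
  -- A positive level `u` is built with `u ^ (-2α) = y`, so that its finite limit already exceeds
  -- `M`.
  set y := (M / tailConst α v).toReal + 1
  have hy : 0 < y := by positivity
  have hyM : (M : ℝ≥0∞) < ENNReal.ofReal y * tailConst α v := by
    rw [← ENNReal.div_lt_iff (Or.inl hc0.ne') (Or.inl hct)]
    rw [← ENNReal.ofReal_toReal hMt]
    exact ENNReal.ofReal_lt_ofReal_iff hy |>.2 (lt_add_one _)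
  set u := y ^ (-(1 / (2 * α)))
  have hu : 0 < u := by positivity
  have huy : ENNReal.ofReal u ^ (-(2 * α)) = ENNReal.ofReal y := by
    rw [ENNReal.ofReal_rpow_of_pos hu, ← Real.rpow_mul hy.le]
    congr 1
    rw [neg_mul_neg, one_div_mul_cancel (by positivity), Real.rpow_one]
  have hl := hD.tendsto_joint_of_pos hα hV hV1 h0 h hu v
  rw [huy] at hl
  filter_upwards [hl.eventually (lt_mem_nhds hyM), hq.eventually_ge_atTop 0] with t h1 h2
  -- The event at level zero contains the one at level `u`, since the quantile is eventually
  -- non-negative.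
  refine h1.trans_le ?_
  gcongr
  rintro ω ⟨h3, h4⟩
  refine ⟨lt_of_le_of_lt ?_ h3, h4⟩
  rw [zero_mul, mul_zero]
  positivity

/-- The distance of a point of the quadrant from the diagonal. -/
lemma infDist_diagonal {x : EuclideanSpace ℝ (Fin 2)} (hx : x ∈ orthant 2) :
    Metric.infDist x diagonal = |x 0 - x 1| / √2 := by
  have h2 : (0 : ℝ) < √2 := by positivity
  have hsq : |x 0 - x 1| / √2 = √((x 0 - x 1) ^ 2 / 2) := by
    rw [Real.sqrt_div (sq_nonneg _), Real.sqrt_sq_eq_abs]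
  -- The nearest point has both coordinates equal to the mean; it stays in the quadrant because `x`
  -- does.
  have hmem : diagPoint ((x 0 + x 1) / 2) ∈ diagonal :=
    ⟨fun _ => div_nonneg (add_nonneg (hx 0) (hx 1)) two_pos.le, rfl⟩
  refine le_antisymm ?_ ?_
  · refine (Metric.infDist_le_dist_of_mem hmem).trans (le_of_eq ?_)
    rw [hsq, EuclideanSpace.dist_eq, Fin.sum_univ_two, Real.dist_eq, Real.dist_eq, sq_abs, sq_abs]
    congr 1
    simp only [diagPoint, vec]
    ring
  · refine (Metric.le_infDist ⟨_, hmem⟩).2 fun {y} hy => ?_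
    rw [hsq, EuclideanSpace.dist_eq, Fin.sum_univ_two, Real.dist_eq, Real.dist_eq, sq_abs, sq_abs]
    refine Real.sqrt_le_sqrt ?_
    have hy' : y 0 = y 1 := hy.2
    rw [hy']
    nlinarith [sq_nonneg (x 0 - y 1 + (x 1 - y 1))]

lemma natVec_mem_orthant (m : Fin 2 → ℕ) : natVec m ∈ orthant 2 := fun l => Nat.cast_nonneg (m l)

lemma infDist_natVec_diagonal (m : Fin 2 → ℕ) :
    Metric.infDist (natVec m) diagonal = |(m 0 : ℝ) - m 1| / √2 :=
  infDist_diagonal (natVec_mem_orthant m)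

/-- The distance of the degrees from the diagonal has a regularly varying tail. -/
theorem IsMixedPoisson.hasRegularlyVaryingTail_infDist
    (hD : IsMixedPoisson P V (fun w => w) D) (hα : 0 < α)
    (hV : Measurable V) (hV1 : ∀ ω, V ω 1 = V ω 0) (h0 : ∀ ω, 0 ≤ V ω 0)
    (h : HasRegularlyVaryingTail P (fun ω => V ω 0) α) :
    HasRegularlyVaryingTail P (fun ω => Metric.infDist (natVec (D ω)) diagonal) (2 * α) := by
  -- With `v = -1` the second condition always holds, its quantity being non-negative even under
  -- division by zero; only the distance remains.
  have hct := tailConst_ne_top α (-1) hα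
  refine hasRegularlyVaryingTail_of_tendsto (G := fun x => P.real {ω | x < √(V ω 0)})
    (c := (tailConst α (-1)).toReal) (ENNReal.toReal_pos (tailConst_pos _ _).ne' hct)
    h.sqrt.1 h.sqrt.2.2 ?_
  refine ((ENNReal.tendsto_toReal hct).comp
    (hD.tendsto_degreeTail hα hV hV1 h0 h (-1))).congr fun x => ?_
  simp only [Function.comp_apply, ENNReal.toReal_div]
  congr 2
  refine congrArg P ?_
  ext ω
  simp only [infDist_natVec_diagonal, degreeTail, mem_ofPred_eq]
  rw [lt_div_iff₀' (show (0 : ℝ) < √2 by positivity)]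
  refine and_iff_left (lt_of_lt_of_le (show (-1 : ℝ) < 0 by norm_num) ?_)
  positivity

/-- A pair of degrees is unlikely to be far from the diagonal compared with its size. -/
lemma IsMixedPoisson.measure_far_le (hD : IsMixedPoisson P V (fun w => w) D) (hV : Measurable V)
    (hV1 : ∀ ω, V ω 1 = V ω 0) {ε K : ℝ} (hε : 0 < ε) (hK : 0 < K) (x : ℝ) :
    P {ω | ε * x ≤ |(D ω 0 : ℝ) - D ω 1| ∧ (D ω 0 : ℝ) + D ω 1 ≤ K * x} ≤
      ENNReal.ofReal (2 * Real.exp (-(ε ^ 2 / (2 * K) * x))) := by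
  have h := hD.measure_pair hV hV1
    (E := fun _ => {m | ε * x ≤ |(m.1 : ℝ) - m.2| ∧ (m.1 : ℝ) + m.2 ≤ K * x})
    fun m => MeasurableSet.const _
  refine h.le.trans ?_
  calc _ ≤ ∫⁻ _, ENNReal.ofReal (2 * Real.exp (-(ε ^ 2 / (2 * K) * x))) ∂P :=
        lintegral_mono fun ω => poissonPair_abs_sub_le_of_add_le _ hε hK
    _ = _ := by simp

end MixedPair

/-! ### Failure of regular variation off the diagonal -/

section NoMRV

variable {Ω : Type*} [MeasurableSpace Ω] {P : Measure Ω}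
  {V : Ω → Fin 2 → ℝ} {D : Ω → Fin 2 → ℕ} {α : ℝ}

lemma measurableSet_orthant_diff_diagonal : MeasurableSet (orthant 2 \ diagonal) :=
  (measurableSet_orthant 2).diff measurableSet_diagonal

lemma continuous_infDist_diagonal :
    Continuous fun x : EuclideanSpace ℝ (Fin 2) => Metric.infDist x diagonal :=
  Metric.continuous_infDist_pt _

/-- The points off the diagonal at distance at least `ε` from it. -/
def farSet (ε : ℝ) : Set (EuclideanSpace ℝ (Fin 2)) :=
  {x | x ∈ orthant 2 \ diagonal ∧ ε ≤ Metric.infDist x diagonal}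

/-- The points of `farSet ε` with entries that sum up to at most `K`. -/
def farBoundedSet (ε K : ℝ) : Set (EuclideanSpace ℝ (Fin 2)) :=
  {x | x ∈ farSet ε ∧ x 0 + x 1 ≤ K}

lemma measurableSet_farSet (ε : ℝ) : MeasurableSet (farSet ε) :=
  measurableSet_orthant_diff_diagonal.inter
    (measurableSet_le measurable_const continuous_infDist_diagonal.measurable)

lemma measurableSet_farBoundedSet (ε K : ℝ) : MeasurableSet (farBoundedSet ε K) :=
  (measurableSet_farSet ε).inter
    (measurableSet_le (f := fun x : EuclideanSpace ℝ (Fin 2) => x 0 + x 1) (by fun_prop)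
      measurable_const)

/-- A continuous function that is `1` far from the diagonal and `0` close to it. -/
noncomputable def farTest (ε : ℝ) (x : EuclideanSpace ℝ (Fin 2)) : ℝ :=
  min 1 (max 0 (2 / ε * Metric.infDist x diagonal - 1))

/-- A version of `farTest` with bounded support. -/
noncomputable def farBoundedTest (ε K : ℝ) (x : EuclideanSpace ℝ (Fin 2)) : ℝ :=
  farTest ε x * min 1 (max 0 (K + 1 - (x 0 + x 1)))

lemma farTest_nonneg (ε : ℝ) (x : EuclideanSpace ℝ (Fin 2)) : 0 ≤ farTest ε x :=
  le_min zero_le_one (le_max_left _ _)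

lemma farTest_le_one (ε : ℝ) (x : EuclideanSpace ℝ (Fin 2)) : farTest ε x ≤ 1 := min_le_left _ _

lemma farTest_eq_zero {ε : ℝ} (hε : 0 < ε) {x : EuclideanSpace ℝ (Fin 2)}
    (hx : Metric.infDist x diagonal < ε / 2) : farTest ε x = 0 := by
  have : 2 / ε * Metric.infDist x diagonal - 1 ≤ 0 := by
    rw [div_mul_eq_mul_div, sub_nonpos, div_le_one hε]
    linarith
  rw [farTest, max_eq_left this]
  exact min_eq_right zero_le_one

lemma farTest_eq_one {ε : ℝ} (hε : 0 < ε) {x : EuclideanSpace ℝ (Fin 2)}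
    (hx : ε ≤ Metric.infDist x diagonal) : farTest ε x = 1 := by
  have : 1 ≤ 2 / ε * Metric.infDist x diagonal - 1 := by
    rw [div_mul_eq_mul_div, le_sub_iff_add_le, le_div_iff₀ hε]
    linarith
  exact min_eq_left (this.trans (le_max_right _ _))

lemma continuous_farTest (ε : ℝ) : Continuous (farTest ε) :=
  continuous_const.min (continuous_const.max
    ((continuous_const.mul continuous_infDist_diagonal).sub continuous_const))

lemma isMTest_farTest {ε : ℝ} (hε : 0 < ε) : IsMTest diagonal (farTest ε) :=
  ⟨(continuous_farTest ε).continuousOn, fun x _ => farTest_nonneg ε x,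
    ⟨1, fun x _ => farTest_le_one ε x⟩, ε / 2, half_pos hε, fun _ _ hx => farTest_eq_zero hε hx⟩

lemma farBoundedTest_le_farTest (ε K : ℝ) (x : EuclideanSpace ℝ (Fin 2)) :
    farBoundedTest ε K x ≤ farTest ε x :=
  mul_le_of_le_one_right (farTest_nonneg ε x) (min_le_left _ _)

lemma isMTest_farBoundedTest {ε : ℝ} (hε : 0 < ε) (K : ℝ) :
    IsMTest diagonal (farBoundedTest ε K) := by
  refine ⟨Continuous.continuousOn ?_, fun x _ => ?_, ⟨1, fun x _ => ?_⟩, ε / 2, half_pos hε,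
    fun x _ hx => ?_⟩
  · exact (continuous_farTest ε).mul (by fun_prop)
  · exact mul_nonneg (farTest_nonneg ε x) (le_min zero_le_one (le_max_left _ _))
  · exact (farBoundedTest_le_farTest ε K x).trans (farTest_le_one ε x)
  · rw [farBoundedTest, farTest_eq_zero hε hx, zero_mul]

lemma farBoundedTest_eq_one {ε K : ℝ} (hε : 0 < ε) {x : EuclideanSpace ℝ (Fin 2)}
    (hx : x ∈ farBoundedSet ε K) : farBoundedTest ε K x = 1 := by
  rw [farBoundedTest, farTest_eq_one hε hx.1.2, one_mul]
  have hxK := hx.2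
  exact min_eq_left (le_trans (by linarith) (le_max_right _ _))

lemma farBoundedTest_eq_zero {ε K : ℝ} (hε : 0 < ε) {x : EuclideanSpace ℝ (Fin 2)}
    (hx : x ∈ orthant 2 \ diagonal) (hx' : x ∉ farBoundedSet (ε / 2) (K + 1)) :
    farBoundedTest ε K x = 0 := by
  by_cases h : ε / 2 ≤ Metric.infDist x diagonal
  · have h2 : K + 1 < x 0 + x 1 := by
      by_contra! h3
      exact hx' ⟨⟨hx, h⟩, h3⟩
    rw [farBoundedTest, max_eq_left (show K + 1 - (x 0 + x 1) ≤ 0 by linarith),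
      min_eq_right zero_le_one, mul_zero]
  · rw [farBoundedTest, farTest_eq_zero hε (not_le.1 h), zero_mul]

/-- A non-zero measure off the diagonal charges one of the sets `farBoundedSet`. -/
lemma exists_measure_farBoundedSet_pos {ν : Measure (EuclideanSpace ℝ (Fin 2))}
    (hν : ν (orthant 2 \ diagonal)ᶜ = 0) (h0 : ν ≠ 0) :
    ∃ ε K : ℝ, 0 < ε ∧ 0 < K ∧ 0 < ν (farBoundedSet ε K) := by
  by_contra! hcon
  -- The diagonal is closed in the quadrant, so sets with distance at least `1 / (n + 1)` and entry
  -- sum at most `n + 1` exhaust its complement; if all were null, the measure would vanish.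
  have hcov : orthant 2 \ diagonal ⊆
      ⋃ n : ℕ, farBoundedSet (1 / ((n : ℝ) + 1)) ((n : ℝ) + 1) := by
    intro x hx
    have hd : 0 < Metric.infDist x diagonal := by
      rw [infDist_diagonal hx.1]
      have : x 0 - x 1 ≠ 0 := fun h => hx.2 ⟨hx.1, sub_eq_zero.1 h⟩
      positivity
    obtain ⟨n, hn⟩ := exists_nat_gt (max (x 0 + x 1) (1 / Metric.infDist x diagonal))
    have h1 : x 0 + x 1 < n := (le_max_left _ _).trans_lt hn
    have h2 : 1 / Metric.infDist x diagonal < n := (le_max_right _ _).trans_lt hn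
    refine mem_iUnion.2 ⟨n, ⟨hx, ?_⟩, by linarith⟩
    rw [div_lt_iff₀ hd] at h2
    rw [div_le_iff₀ (by positivity)]
    nlinarith
  have hz : ν (orthant 2 \ diagonal) = 0 := by
    refine measure_mono_null hcov (measure_iUnion_null fun n => ?_)
    exact le_antisymm (hcon _ _ (by positivity) (by positivity)) zero_le
  refine h0 (Measure.measure_univ_eq_zero.1 ?_)
  rw [← measure_add_measure_compl measurableSet_orthant_diff_diagonal, hz, hν, add_zero]

lemma measurable_natVec (hD : Measurable D) : Measurable fun ω => natVec (D ω) := by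
  have : Measurable (natVec : (Fin 2 → ℕ) → EuclideanSpace ℝ (Fin 2)) := .of_discrete
  exact this.comp hD

lemma scaled_law_apply (hD : Measurable D) (t c : ℝ) {s : Set (EuclideanSpace ℝ (Fin 2))}
    (hs : MeasurableSet s) :
    (ENNReal.ofReal t • (P.map fun ω => natVec (D ω)).map fun x => c⁻¹ • x) s =
      ENNReal.ofReal t * P {ω | c⁻¹ • natVec (D ω) ∈ s} := by
  rw [Measure.smul_apply, smul_eq_mul, Measure.map_apply (by fun_prop) hs,
    Measure.map_apply (measurable_natVec hD) ((measurable_const_smul c⁻¹) hs)]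
  rfl

lemma smul_natVec_mem_orthant {c : ℝ} (hc : 0 < c) (m : Fin 2 → ℕ) :
    c⁻¹ • natVec m ∈ orthant 2 := fun l =>
  mul_nonneg (inv_nonneg.2 hc.le) (natVec_mem_orthant m l)

lemma infDist_smul_natVec {c : ℝ} (hc : 0 < c) (m : Fin 2 → ℕ) :
    Metric.infDist (c⁻¹ • natVec m) diagonal = Metric.infDist (natVec m) diagonal / c := by
  rw [infDist_diagonal (smul_natVec_mem_orthant hc m), infDist_natVec_diagonal]
  have : (c⁻¹ • natVec m) 0 - (c⁻¹ • natVec m) 1 = ((m 0 : ℝ) - m 1) / c := by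
    simp only [natVec, vec, PiLp.smul_apply, smul_eq_mul]
    ring
  rw [this, abs_div, abs_of_pos hc]
  ring

variable [IsProbabilityMeasure P]

/-- The degrees are not multivariate regularly varying off the diagonal: a scaling at which the
limit is finite would have to be so small that the limit vanishes on bounded sets. -/
theorem IsMixedPoisson.not_isMRV_diagonal
    (hD : IsMixedPoisson P V (fun w => w) D) (hα : 0 < α)
    (hV : Measurable V) (hV1 : ∀ ω, V ω 1 = V ω 0) (h0 : ∀ ω, 0 ≤ V ω 0)
    (h : HasRegularlyVaryingTail P (fun ω => V ω 0) α) (α₀ : ℝ) (c : ℝ → ℝ)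
    (ν : Measure (EuclideanSpace ℝ (Fin 2))) :
    ¬ IsMRV (P.map fun ω => natVec (D ω)) α₀ c ν diagonal := by
  rintro ⟨-, ⟨hcpos, -, -⟩, ⟨hν, hνfin⟩, hν0, hconv⟩
  set μ : ℝ → Measure (EuclideanSpace ℝ (Fin 2)) := fun t =>
    ENNReal.ofReal t • (P.map fun ω => natVec (D ω)).map fun x => (c t)⁻¹ • x
  set R : ℝ → ℝ := fun x => P.real {ω | x < Metric.infDist (natVec (D ω)) diagonal}
  have hO := measurableSet_orthant_diff_diagonal
  have hRV := hD.hasRegularlyVaryingTail_infDist hα hV hV1 h0 h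
  obtain ⟨p, c₀, hc₀, hlow⟩ := exists_polynomial_lower_bound (tail_antitone _) hRV.tail_pos hRV.2.2
  -- the tail at the scale `c` is bounded
  obtain ⟨B, hB, hBbound⟩ : ∃ B : ℝ, 0 < B ∧ ∀ᶠ t in atTop, t * R (c t) ≤ B := by
    have hlim := hconv _ (isMTest_farTest (ε := 1) one_pos)
    have hfin : ∫⁻ x in orthant 2 \ diagonal, ENNReal.ofReal (farTest 1 x) ∂ν < ∞ := by
      have hle : ∀ x ∈ orthant 2 \ diagonal, ENNReal.ofReal (farTest 1 x) ≤
          (farSet (1 / 2)).indicator 1 x := by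
        intro x hx
        by_cases h1 : 1 / 2 ≤ Metric.infDist x diagonal
        · rw [indicator_of_mem (show x ∈ farSet (1 / 2) from ⟨hx, h1⟩), Pi.one_apply,
            ENNReal.ofReal_le_one]
          exact farTest_le_one 1 x
        · rw [farTest_eq_zero one_pos (not_le.1 h1), ENNReal.ofReal_zero]
          exact zero_le
      refine (setLIntegral_mono' hO hle).trans_lt ((setLIntegral_le_lintegral _ _).trans_lt ?_)
      rw [lintegral_indicator_one (measurableSet_farSet _)]
      exact hνfin _ (by norm_num)
    set B := (∫⁻ x in orthant 2 \ diagonal, ENNReal.ofReal (farTest 1 x) ∂ν).toReal + 1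
    have hB : 0 < B := by positivity
    refine ⟨B, hB, ?_⟩
    have hltB : ∫⁻ x in orthant 2 \ diagonal, ENNReal.ofReal (farTest 1 x) ∂ν <
        ENNReal.ofReal B := by
      rw [← ENNReal.ofReal_toReal hfin.ne]
      exact (ENNReal.ofReal_lt_ofReal_iff hB).2 (lt_add_one _)
    filter_upwards [hlim.eventually (gt_mem_nhds hltB), hcpos, eventually_gt_atTop 0]
      with t h1 h2 h3
    have h4 : μ t (farSet 1) ≤ ∫⁻ x in orthant 2 \ diagonal, ENNReal.ofReal (farTest 1 x) ∂(μ t) := by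
      rw [← lintegral_indicator_one (measurableSet_farSet 1), ← lintegral_indicator hO]
      refine lintegral_mono fun x => ?_
      by_cases hx : x ∈ farSet 1
      · rw [indicator_of_mem hx, indicator_of_mem hx.1, farTest_eq_one one_pos hx.2]
        simp
      · rw [indicator_of_notMem hx]
        exact zero_le
    have h5 := (h4.trans h1.le)
    rw [scaled_law_apply hD.1 t (c t) (measurableSet_farSet 1)] at h5
    have h6 : ENNReal.ofReal (t * R (c t)) ≤ ENNReal.ofReal B := by
      refine le_trans ?_ h5
      rw [ENNReal.ofReal_mul h3.le, ofReal_measureReal (measure_ne_top _ _)]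
      refine mul_le_mul_right (measure_mono fun ω hω => ?_) _
      have hω' : c t < Metric.infDist (natVec (D ω)) diagonal := hω
      have hd : 1 ≤ Metric.infDist ((c t)⁻¹ • natVec (D ω)) diagonal := by
        rw [infDist_smul_natVec h2, one_le_div h2]
        exact hω'.le
      refine ⟨⟨smul_natVec_mem_orthant h2 _, fun hdiag => ?_⟩, hd⟩
      rw [Metric.infDist_zero_of_mem hdiag] at hd
      linarith
    exact (ENNReal.ofReal_le_ofReal_iff hB.le).1 h6
  -- the scale grows at most logarithmically
  obtain ⟨a, ℓ, ha, hℓ, hexp⟩ : ∃ a ℓ : ℝ, 0 < a ∧ 0 < ℓ ∧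
      ∀ᶠ t in atTop, ℓ ≤ t * Real.exp (-(a * c t)) := by
    obtain ⟨ε, K, hε, hK, hpos⟩ := exists_measure_farBoundedSet_pos hν hν0
    have hlim := hconv _ (isMTest_farBoundedTest hε K)
    have hge : ν (farBoundedSet ε K) ≤
        ∫⁻ x in orthant 2 \ diagonal, ENNReal.ofReal (farBoundedTest ε K x) ∂ν := by
      rw [← lintegral_indicator_one (measurableSet_farBoundedSet ε K), ← lintegral_indicator hO]
      refine lintegral_mono fun x => ?_
      by_cases hx : x ∈ farBoundedSet ε K
      · rw [indicator_of_mem hx, indicator_of_mem hx.1.1, farBoundedTest_eq_one hε hx]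
        simp
      · rw [indicator_of_notMem hx]
        exact zero_le
    obtain ⟨ℓ', hℓ'0, hℓ'⟩ := exists_between (hpos.trans_le hge)
    have hℓ't : ℓ' ≠ ∞ := ne_top_of_lt hℓ'
    -- The test function is supported at distance at least `ε / 2` with sum at most `K + 1`.
    -- Distance is the difference over `√2`, whence `√2 * (ε / 2)`. The factor `2` of the
    -- exponential bound halves the lower bound.
    refine ⟨(√2 * (ε / 2)) ^ 2 / (2 * (K + 1)), ℓ'.toReal / 2, by positivity,
      half_pos (ENNReal.toReal_pos hℓ'0.ne' hℓ't), ?_⟩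
    filter_upwards [hlim.eventually (lt_mem_nhds hℓ'), hcpos, eventually_gt_atTop 0]
      with t h1 h2 h3
    have h4 : ∫⁻ x in orthant 2 \ diagonal, ENNReal.ofReal (farBoundedTest ε K x) ∂(μ t) ≤
        μ t (farBoundedSet (ε / 2) (K + 1)) := by
      rw [← lintegral_indicator_one (measurableSet_farBoundedSet _ _)]
      refine (setLIntegral_mono' hO fun x hx => ?_).trans (setLIntegral_le_lintegral _ _)
      by_cases hx' : x ∈ farBoundedSet (ε / 2) (K + 1)
      · rw [indicator_of_mem hx', Pi.one_apply, ENNReal.ofReal_le_one]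
        exact (farBoundedTest_le_farTest ε K x).trans (farTest_le_one ε x)
      · rw [farBoundedTest_eq_zero hε hx hx', ENNReal.ofReal_zero]
        exact zero_le
    have h5 := h1.le.trans h4
    rw [scaled_law_apply hD.1 t (c t) (measurableSet_farBoundedSet _ _)] at h5
    have h6 : P {ω | (c t)⁻¹ • natVec (D ω) ∈ farBoundedSet (ε / 2) (K + 1)} ≤
        ENNReal.ofReal (2 * Real.exp (-((√2 * (ε / 2)) ^ 2 / (2 * (K + 1)) * c t))) := by
      refine (measure_mono fun ω hω => ?_).trans (hD.measure_far_le hV hV1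
        (show 0 < √2 * (ε / 2) by positivity) (show 0 < K + 1 by positivity) (c t))
      obtain ⟨⟨-, h7⟩, h8⟩ := hω
      rw [infDist_smul_natVec h2, infDist_natVec_diagonal, le_div_iff₀ h2,
        le_div_iff₀' (by positivity)] at h7
      have e : ((c t)⁻¹ • natVec (D ω)) 0 + ((c t)⁻¹ • natVec (D ω)) 1 =
          ((D ω 0 : ℝ) + D ω 1) / c t := by
        simp only [natVec, vec, PiLp.smul_apply, smul_eq_mul]
        ring
      rw [e, div_le_iff₀ h2] at h8
      exact ⟨by linarith, h8⟩
    have h7 := h5.trans (mul_le_mul_right h6 _)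
    rw [← ENNReal.ofReal_mul h3.le, ← ENNReal.ofReal_toReal hℓ't,
      ENNReal.ofReal_le_ofReal_iff (by positivity)] at h7
    linarith
  -- the two bounds are incompatible
  obtain ⟨C, hC, hCbound⟩ : ∃ C : ℝ, 0 < C ∧ ∀ᶠ t in atTop, max (c t) 1 ^ (p + 1) ≤ C * t := by
    -- The exponential bound is weakened to the single power `p + 1`, just above the exponent `p` of
    -- the polynomial lower bound. The maximum with `1` is needed because that bound holds only from
    -- `1` on; it costs the factor `exp a`.
    refine ⟨(p + 1).factorial * Real.exp a / (ℓ * a ^ (p + 1)), by positivity, ?_⟩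
    filter_upwards [hexp, hcpos] with t h1 h2
    set M := max (c t) 1
    have hM : M ≤ c t + 1 := max_le (by linarith) (by linarith)
    have hM0 : 0 < M := lt_max_of_lt_right one_pos
    rw [Real.exp_neg, ← div_eq_mul_inv, le_div_iff₀ (Real.exp_pos _)] at h1
    have h3 := Real.pow_div_factorial_le_exp (x := a * M) (by positivity) (p + 1)
    have h4 : Real.exp (a * M) ≤ Real.exp (a * c t) * Real.exp a := by
      rw [← Real.exp_add]
      refine Real.exp_le_exp.2 ?_
      nlinarith
    rw [div_le_iff₀ (by positivity), mul_pow] at h3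
    rw [div_mul_eq_mul_div, le_div_iff₀ (by positivity)]
    calc M ^ (p + 1) * (ℓ * a ^ (p + 1)) = ℓ * (a ^ (p + 1) * M ^ (p + 1)) := by ring
      _ ≤ ℓ * (Real.exp (a * c t) * Real.exp a * (p + 1).factorial) := by
        exact mul_le_mul_of_nonneg_left
          (h3.trans (mul_le_mul_of_nonneg_right h4 (by positivity))) hℓ.le
      _ = (p + 1).factorial * Real.exp a * (ℓ * Real.exp (a * c t)) := by ring
      _ ≤ (p + 1).factorial * Real.exp a * t := by gcongr
  -- Combining `t ≤ (B / c₀) M ^ p` with `M ^ (p + 1) ≤ C t` bounds `M`, hence `t`, by a constant.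
  have hfinal : ∀ᶠ t : ℝ in atTop, t ≤ B / c₀ * (C * (B / c₀)) ^ p := by
    filter_upwards [hBbound, hCbound, eventually_gt_atTop 0] with t h1 h2 h3
    set M := max (c t) 1
    have hM1 : 1 ≤ M := le_max_right _ _
    have hM0 : 0 < M := by linarith
    have h4 : R M ≤ R (c t) := tail_antitone _ (le_max_left _ _)
    have h5 := hlow M hM1
    have h6 : t * c₀ ≤ B * M ^ p := by
      calc t * c₀ ≤ t * (M ^ p * R M) := by gcongr
        _ ≤ t * (M ^ p * R (c t)) := by gcongr
        _ = t * R (c t) * M ^ p := by ring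
        _ ≤ B * M ^ p := by gcongr
    have h7 : t ≤ B / c₀ * M ^ p := by
      rw [div_mul_eq_mul_div, le_div_iff₀ hc₀]
      exact h6
    have h8 : M ≤ C * (B / c₀) := by
      have h9 : M * M ^ p ≤ C * (B / c₀) * M ^ p := by
        rw [← pow_succ']
        calc M ^ (p + 1) ≤ C * t := h2
          _ ≤ C * (B / c₀ * M ^ p) := by gcongr
          _ = _ := by ring
      exact le_of_mul_le_mul_right h9 (by positivity)
    calc t ≤ B / c₀ * M ^ p := h7
      _ ≤ _ := by gcongr
  obtain ⟨t, h1, h2⟩ := (hfinal.and (eventually_gt_atTop (B / c₀ * (C * (B / c₀)) ^ p))).exists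
  linarith

end NoMRV

/-! ### The rescaled joint tail -/

/-- The level is divided by `s = √2 κ ^ (1 / (2α))`, and `s ^ (2α) = 2 ^ α κ`. Working with extended
non-negative values keeps the identity valid at `u = 0`, where both sides may be infinite. -/
lemma rescaled_const_mul {α u : ℝ} (hα : 0 < α) {κ : ℝ} (hκ : 0 < κ) (G : ℝ≥0∞) :
    ENNReal.ofReal (u / (√2 * κ ^ (1 / (2 * α)))) ^ (-(2 * α)) * (2 * G) =
      ENNReal.ofReal u ^ (-(2 * α)) * (ENNReal.ofReal (2 ^ (1 + α) * κ) * G) := by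
  set s := √2 * κ ^ (1 / (2 * α))
  have hs : 0 < s := by positivity
  have hs' : s ^ (2 * α) = 2 ^ α * κ := by
    rw [Real.mul_rpow (by positivity) (by positivity), ← Real.rpow_mul hκ.le,
      one_div_mul_cancel (by positivity), Real.rpow_one, Real.sqrt_eq_rpow,
      ← Real.rpow_mul (by norm_num)]
    congr 2
    ring
  have hsn : ENNReal.ofReal s ≠ 0 := (ENNReal.ofReal_pos.2 hs).ne'
  have e1 : ENNReal.ofReal (u / s) ^ (-(2 * α)) =
      ENNReal.ofReal u ^ (-(2 * α)) * ENNReal.ofReal (2 ^ α * κ) := by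
    rw [ENNReal.ofReal_div_of_pos hs, div_eq_mul_inv, ENNReal.rpow_neg, ENNReal.rpow_neg,
      ENNReal.mul_rpow_of_nonneg _ _ (by positivity), ENNReal.inv_rpow,
      ENNReal.ofReal_rpow_of_pos hs, hs', ENNReal.mul_inv, inv_inv]
    · right
      exact ENNReal.inv_ne_top.2 (ENNReal.ofReal_pos.2 (by positivity)).ne'
    · right
      exact ENNReal.inv_ne_zero.2 ENNReal.ofReal_ne_top
  have e2 : ENNReal.ofReal (2 ^ (1 + α) * κ) = ENNReal.ofReal (2 ^ α * κ) * 2 := by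
    rw [show (2 : ℝ≥0∞) = ENNReal.ofReal 2 by simp, ← ENNReal.ofReal_mul (by positivity),
      Real.rpow_add two_pos, Real.rpow_one]
    congr 1
    ring
  rw [e1, e2]
  ring

end DegreeTails

theorem mainTheorem5 {Ω : Type*} [MeasurableSpace Ω] (P : Measure Ω) [IsProbabilityMeasure P]
    (α : ℝ) (hα : 0 < α) (n : ℕ) [NeZero n]
    (W : Fin n → Ω → Fin 2 → ℝ) (A : Ω → Fin n → Fin n → Fin 2 → ℕ)
    (hNR : DegreeTails.IsNorrosReittu P W A)
    (hW : ∀ i ω, W i ω 1 = W i ω 0)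
    (hRV : DegreeTails.HasRegularlyVaryingTail P (fun ω => W 0 ω 0) α)
    (b b₀ : ℝ → ℝ)
    (hb : ∀ t, b t = DegreeTails.quantile P (fun ω => W 0 ω 0) (1 - 1 / t))
    (hb₀ : ∀ t, b₀ t = DegreeTails.quantile P (fun ω => √(W 0 ω 0)) (1 - 1 / t))
    (D : Ω → Fin 2 → ℕ)
    (hD : DegreeTails.IsMixedPoisson P (W 0) (fun w => w) D) :
    -- the degree vector of node 1, given all weights, has the conditional law of `D` given `W 0`
    DegreeTails.IsMixedPoisson P (fun ω i => W i ω) (fun w => w 0)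
      (DegreeTails.degree A 0) ∧
    -- the weights are multivariate regularly varying, with limit measure on the diagonal
    (∃ ν, DegreeTails.IsMRV (P.map (fun ω => DegreeTails.vec (W 0 ω))) α b ν {0} ∧
      ν DegreeTails.diagonalᶜ = 0) ∧
    -- the joint tail, for the Euclidean distance `|D 0 - D 1| / √2` from the diagonal
    (∀ u v : ℝ, 0 ≤ u → 0 ≤ v →
      Tendsto (fun t : ℝ => ENNReal.ofReal t *
          P {ω | u < |(D ω 0 : ℝ) - D ω 1| / (√2 * b₀ t) ∧
            v < (√2 * D ω 0 / √(W 0 ω 0)) / |(D ω 0 : ℝ) - D ω 1|})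
        atTop
        (𝓝 (ENNReal.ofReal u ^ (-(2 * α)) * (2 * DegreeTails.gaussianMoment α v)))) ∧
    -- the joint tail, rescaled
    (∀ u v : ℝ, 0 ≤ u → 0 ≤ v →
      Tendsto (fun t : ℝ => ENNReal.ofReal t *
          P {ω | u < |(D ω 0 : ℝ) - D ω 1| / b₀ t *
              (√Real.pi / Real.Gamma (α + 1 / 2)) ^ (1 / (2 * α)) ∧
            v < (√2 * D ω 0 / √(W 0 ω 0)) / |(D ω 0 : ℝ) - D ω 1|})
        atTop
        (𝓝 (ENNReal.ofReal u ^ (-(2 * α)) *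
          (ENNReal.ofReal (2 ^ (1 + α) * √Real.pi / Real.Gamma (α + 1 / 2)) *
            DegreeTails.gaussianMoment α v)))) ∧
    -- the distance from the diagonal is regularly varying with tail index `2 α`
    DegreeTails.HasRegularlyVaryingTail P
      (fun ω => Metric.infDist (DegreeTails.natVec (D ω)) DegreeTails.diagonal) (2 * α) ∧
    -- there is no regular variation off the diagonal, whatever the index, scaling and limit measure
    (∀ (α₀ : ℝ) (c : ℝ → ℝ) (ν₀ : Measure (EuclideanSpace ℝ (Fin 2))),
      ¬ DegreeTails.IsMRV (P.map (fun ω => DegreeTails.natVec (D ω))) α₀ c ν₀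
        DegreeTails.diagonal) ∧
    -- in particular, no hidden regular variation
    ¬ DegreeTails.HasHRV (P.map (fun ω => DegreeTails.natVec (D ω))) DegreeTails.diagonal := by
  have hV : Measurable (W 0) := hNR.measurable_weight 0
  have hX : Measurable fun ω => W 0 ω 0 := (measurable_pi_apply 0).comp hV
  have h0 : ∀ ω, 0 ≤ W 0 ω 0 := fun ω => hNR.nonneg 0 ω 0
  have hsX : Measurable fun ω => √(W 0 ω 0) := hX.sqrt
  have hb₀' : b₀ = fun t => DegreeTails.quantile P (fun ω => √(W 0 ω 0)) (1 - 1 / t) := funext hb₀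
  have hb' : b = fun t => DegreeTails.quantile P (fun ω => W 0 ω 0) (1 - 1 / t) := funext hb
  have hb₀lim : Tendsto b₀ atTop atTop := by
    rw [hb₀']
    exact hRV.sqrt.tendsto_quantile hsX fun ω => Real.sqrt_nonneg _
  have hjoint : ∀ u v : ℝ, 0 ≤ u → 0 ≤ v →
      Tendsto (fun t : ℝ => ENNReal.ofReal t *
          P {ω | u < |(D ω 0 : ℝ) - D ω 1| / (√2 * b₀ t) ∧
            v < (√2 * D ω 0 / √(W 0 ω 0)) / |(D ω 0 : ℝ) - D ω 1|})
        atTop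
        (𝓝 (ENNReal.ofReal u ^ (-(2 * α)) * (2 * DegreeTails.gaussianMoment α v))) := by
    intro u v hu hv
    rw [← DegreeTails.tailConst_eq α hv]
    refine (hD.tendsto_joint hα hV (hW 0) h0 hRV hu v).congr' ?_
    -- Only where the quantile is positive can the inequality with `√2 * b₀ t` in the denominator be
    -- multiplied out.
    filter_upwards [hb₀lim.eventually_gt_atTop 0] with t ht
    rw [hb₀ t] at ht ⊢
    congr 2
    ext ω
    refine and_congr_left fun _ => ?_
    rw [lt_div_iff₀ (by positivity)]
    exact iff_of_eq (by congr 1; ring)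
  have hMRV := hD.not_isMRV_diagonal hα hV (hW 0) h0 hRV
  refine ⟨DegreeTails.isMixedPoisson_degree hNR, ⟨DegreeTails.diagMeasure α, ?_,
    DegreeTails.diagMeasure_compl_diagonal⟩, hjoint, fun u v hu hv => ?_,
    hD.hasRegularlyVaryingTail_infDist hα hV (hW 0) h0 hRV, hMRV, ?_⟩
  · have e : (fun ω => DegreeTails.vec (W 0 ω)) = fun ω => DegreeTails.diagPoint (W 0 ω 0) :=
      funext fun ω => congrArg DegreeTails.vec (funext fun l => by
        fin_cases l
        exacts [rfl, hW 0 ω])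
    rw [hb', e]
    exact DegreeTails.isMRV_diagPoint hα hRV hX h0
  · have hΓ : 0 < Real.Gamma (α + 1 / 2) := Real.Gamma_pos_of_pos (by positivity)
    set κ := √Real.pi / Real.Gamma (α + 1 / 2) with hκdef
    have hκ : 0 < κ := div_pos (Real.sqrt_pos.2 Real.pi_pos) hΓ
    have hs : 0 < √2 * κ ^ (1 / (2 * α)) := by positivity
    -- The rescaled event at level `u` is the unscaled one at this smaller or larger level, the
    -- factor `√2` of the Euclidean distance being absorbed.
    have h := hjoint (u / (√2 * κ ^ (1 / (2 * α)))) v (by positivity) hv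
    rw [DegreeTails.rescaled_const_mul hα hκ, hκdef, ← mul_div_assoc] at h
    rw [mul_div_assoc] at h ⊢
    refine h.congr fun t => ?_
    congr 2
    ext ω
    refine and_congr_left fun _ => ?_
    rw [div_lt_iff₀ hs]
    refine iff_of_eq (congrArg (u < ·) ?_)
    have h2 : (√2 : ℝ) ≠ 0 := by positivity
    field_simp
  · rintro ⟨_, α₀, _, c₀, _, ν₀, -, -, -, h⟩
    exact hMRV α₀ c₀ ν₀ h
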